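/- All spaces are Hausdorff. Let $n\ge 2$ and let $(A_j,a_j)$, $j\in\mathbb N$, be a sequence of based spaces. The shrinking wedge $\widetilde{\bigvee}_{j}A_j$ is the one-point union of the $(A_j,a_j)$ with wedge point $b_0$, in which a set $U$ is open iff $U\cap A_j$ is open in $A_j$ for every $j$ and, in case $b_0\in U$, $A_j\subseteq U$ for all but finitely many $j$. Write $r_j$ for the canonical retraction of a wedge onto $A_j$, and $\mathbb H_k$ for the shrinking wedge of a sequence of copies of the sphere $S^k$. A based space $(X,x)$ is called sequentially $m$-connected if, for every $0\le k\le m$, every based map $(\mathbb H_k,b_0)\to(X,x)$ is homotopic rel. basepoint to the constant map. 1. The canonical homomorphism $$\phi:\pi_n\Big(\widetilde{\bigvee}_{j}A_j,b_0\Big)\to\prod_{j\in\mathbb N}\pi_n(A_j,a_j),\qquad \phi([f])=([r_1\circ f],[r_2\circ f],\dots)$$ is a split epimorphism, i.e. there is a group homomorphism $s$ with $\phi\circ s=\mathrm{id}$. 2. If $(A_j,a_j)$ is sequentially $(n-1)$-connected for every $j\in\mathbb N$, then $\phi$ is an isomorphism. 3. If $(A_j,a_j)$ is sequentially $(n-1)$-connected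 for every $j\in\mathbb N$, then for the ordinary wedge $\bigvee_j A_j$ with the weak topology there is an isomorphism $\pi_n(\bigvee_j A_j,b_0)\cong\bigoplus_{j\in\mathbb N}\pi_n(A_j,a_j)$, given by $[f]\mapsto([r_j\circ f])_j$. -/

import Mathlib

open scoped Topology unitInterval DirectSum

noncomputable section

universe u v w

/-! ### Wedges of based spaces -/

section Wedge

variable {J : Type v} {A : J → Type u} (a : ∀ j, A j)

/-- The relation that glues the basepoint of each `A j` to one extra point. -/
inductive WedgeRel : (Unit ⊕ Σ j, A j) → (Unit ⊕ Σ j, A j) → Prop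
  | glue (j : J) : WedgeRel (Sum.inl ()) (Sum.inr ⟨j, a j⟩)

/-- The underlying set of the one-point union of the based sets `(A j, a j)`. -/
def WedgeSet : Type (max u v) := Quot (WedgeRel a)

/-- The wedge point. -/
def WedgeSet.base : WedgeSet a := Quot.mk _ (Sum.inl ())

/-- The canonical injection of the `j`-th summand. -/
def WedgeSet.incl (j : J) (x : A j) : WedgeSet a := Quot.mk _ (Sum.inr ⟨j, x⟩)

theorem WedgeSet.incl_basepoint (j : J) : WedgeSet.incl a j (a j) = WedgeSet.base a :=
  (Quot.sound (WedgeRel.glue j)).symm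

open Classical in
/-- The canonical retraction onto the `j`-th summand: it is the identity on `A j` and sends
every other summand to `a j`. -/
def WedgeSet.retr (j : J) : WedgeSet a → A j :=
  Quot.lift
    (Sum.elim (fun _ => a j) (fun p => if h : p.1 = j then h ▸ p.2 else a j))
    (by
      rintro _ _ ⟨i⟩
      by_cases h : i = j
      · subst h; simp
      · simp [h])

theorem WedgeSet.retr_base (j : J) : WedgeSet.retr a j (WedgeSet.base a) = a j := rfl

theorem WedgeSet.retr_incl_self (j : J) (x : A j) :
    WedgeSet.retr a j (WedgeSet.incl a j x) = x := by
  simp [WedgeSet.retr, WedgeSet.incl]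

theorem WedgeSet.retr_incl_of_ne {i j : J} (h : i ≠ j) (x : A i) :
    WedgeSet.retr a j (WedgeSet.incl a i x) = a j := by
  simp [WedgeSet.retr, WedgeSet.incl, h]

variable [∀ j, TopologicalSpace (A j)]

/-- The topology of the shrinking wedge: a set `U` is open if its trace on every summand is open
and, in case `U` contains the wedge point, `U` contains all but finitely many of the summands. -/
@[reducible]
def WedgeSet.shrinkingTopology : TopologicalSpace (WedgeSet a) where
  IsOpen U := (∀ j, IsOpen (WedgeSet.incl a j ⁻¹' U)) ∧
    (WedgeSet.base a ∈ U → {j | ¬ Set.range (WedgeSet.incl a j) ⊆ U}.Finite)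
  isOpen_univ := ⟨fun _ => isOpen_univ, fun _ => by simp⟩
  isOpen_inter U V hU hV := by
    refine ⟨fun j => (hU.1 j).inter (hV.1 j), fun h => ?_⟩
    refine ((hU.2 h.1).union (hV.2 h.2)).subset fun j hj => ?_
    by_contra hc
    have hU' : Set.range (WedgeSet.incl a j) ⊆ U := by
      by_contra h'
      exact hc (Or.inl h')
    have hV' : Set.range (WedgeSet.incl a j) ⊆ V := by
      by_contra h'
      exact hc (Or.inr h')
    exact hj (Set.subset_inter hU' hV')
  isOpen_sUnion S hS := by
    refine ⟨fun j => ?_, ?_⟩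
    · rw [Set.sUnion_eq_biUnion, Set.preimage_iUnion₂]
      exact isOpen_biUnion fun U hU => (hS U hU).1 j
    · rintro ⟨U, hU, hb⟩
      exact ((hS U hU).2 hb).subset fun j hj hc =>
        hj (hc.trans (Set.subset_sUnion_of_mem hU))

/-- The ordinary wedge: the one-point union with the weak (quotient) topology. -/
def WeakWedge : Type (max u v) := WedgeSet a

instance : TopologicalSpace (WeakWedge a) :=
  inferInstanceAs (TopologicalSpace (Quot (WedgeRel a)))

/-- The wedge point of the ordinary wedge. -/
def WeakWedge.base : WeakWedge a := WedgeSet.base a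

/-- The shrinking wedge of the based spaces `(A j, a j)`.  (It is used for countable index
types.) -/
def ShrinkingWedge : Type (max u v) := WedgeSet a

instance : TopologicalSpace (ShrinkingWedge a) := WedgeSet.shrinkingTopology a

/-- The wedge point of the shrinking wedge. -/
def ShrinkingWedge.base : ShrinkingWedge a := WedgeSet.base a

theorem WedgeSet.continuous_retr_incl (i j : J) :
    Continuous fun x : A i => WedgeSet.retr a j (WedgeSet.incl a i x) := by
  by_cases h : i = j
  · subst h
    simpa only [WedgeSet.retr_incl_self] using continuous_id'
  · simpa only [WedgeSet.retr_incl_of_ne a h] using continuous_const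

/-- The retraction of the ordinary wedge onto its `j`-th summand, as a continuous map. -/
def WeakWedge.retr (j : J) : C(WeakWedge a, A j) where
  toFun := WedgeSet.retr a j
  continuous_toFun := by
    refine continuous_quot_lift _ ?_
    refine continuous_sum_dom.2 ⟨continuous_const, ?_⟩
    exact continuous_sigma fun i => WedgeSet.continuous_retr_incl a i j

/-- The retraction of the shrinking wedge onto its `j`-th summand, as a continuous map. -/
def ShrinkingWedge.retr (j : J) : C(ShrinkingWedge a, A j) where
  toFun := WedgeSet.retr a j
  continuous_toFun := by
    refine continuous_def.2 fun U hU => ⟨fun i => ?_, fun hb => ?_⟩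
    · exact hU.preimage (WedgeSet.continuous_retr_incl a i j)
    · refine (Set.finite_singleton j).subset fun i hi => ?_
      by_contra hne
      refine hi ?_
      rintro _ ⟨x, rfl⟩
      change WedgeSet.retr a j (WedgeSet.incl a i x) ∈ U
      rw [WedgeSet.retr_incl_of_ne a hne]
      exact hb

end Wedge

/-! ### Hawaiian earrings and sequential connectedness -/

/-- The unit sphere `S^k` in `ℝ^(k+1)`. -/
abbrev UnitSphere (k : ℕ) : Type :=
  Metric.sphere (0 : EuclideanSpace ℝ (Fin (k + 1))) 1

/-- The basepoint `(1, 0, …, 0)` of `S^k`. -/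
def UnitSphere.base (k : ℕ) : UnitSphere k :=
  ⟨EuclideanSpace.single 0 1, by simp⟩

/-- The `k`-dimensional Hawaiian earring: the shrinking wedge of a sequence of copies
of `S^k`. -/
abbrev HawaiianEarring (k : ℕ) : Type :=
  ShrinkingWedge (fun _ : ℕ => UnitSphere.base k)

/-- The wedge point of the Hawaiian earring. -/
abbrev HawaiianEarring.base (k : ℕ) : HawaiianEarring k :=
  ShrinkingWedge.base (fun _ : ℕ => UnitSphere.base k)

/-- `X` is sequentially `n`-connected at `x`: for every `0 ≤ k ≤ n` the set of pointed homotopy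
classes of based maps from the `k`-dimensional Hawaiian earring to `(X, x)` is trivial, that is,
every such map is homotopic rel basepoint to the constant map. -/
def SequentiallyConnectedAt (n : ℕ) (X : Type u) [TopologicalSpace X] (x : X) : Prop :=
  ∀ k ≤ n, ∀ f : C(HawaiianEarring k, X), f (HawaiianEarring.base k) = x →
    f.HomotopicRel (ContinuousMap.const _ x) {HawaiianEarring.base k}

/-! ### Induced homomorphisms on homotopy groups -/

section Induced

variable {X : Type u} {Y : Type v} [TopologicalSpace X] [TopologicalSpace Y] {x : X} {y : Y}

/-- Post-composition of an `n`-loop with a based map. -/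
def GenLoop.postcomp {N : Type w} (f : C(X, Y)) (hf : f x = y) (p : GenLoop N X x) :
    GenLoop N Y y :=
  ⟨f.comp p.1, fun t ht => (congrArg f (p.2 t ht)).trans hf⟩

/-- The homomorphism `[p] ↦ [f ∘ p]` that a based map induces on `n`-th homotopy groups. -/
def HomotopyGroup.inducedHom (n : ℕ) [NeZero n] (f : C(X, Y)) (hf : f x = y) :
    π_ n X x →* π_ n Y y :=
  MonoidHom.mk'
    (Quotient.map (GenLoop.postcomp f hf)
      fun p q (h : p.1.HomotopicRel q.1 (Cube.boundary (Fin n))) => h.comp_continuousMap f)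
    (by
      rintro ⟨p⟩ ⟨q⟩
      have i : Fin n := 0
      have key : GenLoop.postcomp f hf (GenLoop.transAt i q p) =
          GenLoop.transAt i (GenLoop.postcomp f hf q) (GenLoop.postcomp f hf p) := by
        ext t
        change f (ite _ _ _) = ite _ _ _
        split_ifs <;> rfl
      refine (congrArg (Quotient.map (GenLoop.postcomp f hf) _)
        (HomotopyGroup.mul_spec (i := i) (p := p) (q := q))).trans ?_
      refine Eq.trans ?_ (HomotopyGroup.mul_spec (i := i) (p := GenLoop.postcomp f hf p)
        (q := GenLoop.postcomp f hf q)).symm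
      exact congrArg (Quotient.mk _) key)

end Induced

/-! ### The canonical homomorphisms -/

section Canonical

variable {J : Type v} {A : J → Type u} [∀ j, TopologicalSpace (A j)] (a : ∀ j, A j)
  (n : ℕ) [NeZero n]

/-- The canonical homomorphism `[f] ↦ ([r_j ∘ f])_j` from the `n`-th homotopy group of the
shrinking wedge to the product of the `n`-th homotopy groups of the summands. -/
def ShrinkingWedge.canonicalHom :
    π_ n (ShrinkingWedge a) (ShrinkingWedge.base a) →* ∀ j, π_ n (A j) (a j) :=
  MonoidHom.pi fun j =>
    HomotopyGroup.inducedHom n (ShrinkingWedge.retr a j) (WedgeSet.retr_base a j)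

/-- The same homomorphism `[f] ↦ ([r_j ∘ f])_j` for the ordinary wedge. -/
def WeakWedge.canonicalHom :
    π_ n (WeakWedge a) (WeakWedge.base a) →* ∀ j, π_ n (A j) (a j) :=
  MonoidHom.pi fun j =>
    HomotopyGroup.inducedHom n (WeakWedge.retr a j) (WedgeSet.retr_base a j)

end Canonical

end

/-!
Since the basepoints are closed, the shrinking wedge carries the topology induced from the product
of its summands (`ShrinkingWedge.continuous_of_retr`).  So a map into it is the same as a family of
maps into the summands, any two of which have disjoint supports; there is no further condition.

The section of the canonical homomorphism is infinite concatenation: the `j`-th loop is run through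
on the `j`-th of the slots `[1 - 2⁻ʲ, 1 - 2⁻ʲ⁻¹]` of one coordinate of the cube
(`GenLoop.concat`).  It is a homomorphism because two loops can be multiplied along another
coordinate, where multiplication commutes with infinite concatenation
(`GenLoop.homotopic_concat_transAt`).

Injectivity says that a loop `f` is homotopic to the infinite concatenation of its coordinates
`r_j ∘ f`.  There are two steps.

*Dyadic position.*  The complement of the zero set of a coordinate `r_j ∘ f` is decomposed into
dyadic Whitney cells, which shrink towards the zero set.  As `A_j` is sequentially
`(n - 1)`-connected, the coordinate can be contracted inductively on the cells of dimension less
than `n`.  In each dimension the spheroids that have to be contracted form a null sequence, hence a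
map of a Hawaiian earring, and the null-homotopy of the latter provides a null sequence of
null-homotopies; this makes the result continuous along the zero set
(`SequentiallyConnectedAt.exists_dyadic_homotopy`).  These homotopies do not enlarge the supports,
so they fit together to a homotopy of `f`.  Afterwards, each point outside the preimage of the
wedge point is interior to a dyadic cube that is mapped into a single summand
(`GenLoop.exists_homotopic_isDyadicMap`).

*Bisection.*  The cube is bisected again and again, along the coordinate axes in cyclic order, and
a box that is mapped into a single summand is not divided any further.  Dyadic cubes are nested, so
a box that has to be divided is mapped to the wedge point along the dividing hyperplane
(`IsBoxOf.eq_base`), and the loop on it is the product of the loops on the two halves.  Let the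
`m`-th approximation be the map that performs the infinite concatenation separately on each box of
the `m`-th stage.  Consecutive approximations are homotopic, since infinite concatenation is a
homomorphism.  This homotopy can be chosen within the boxes and with values, coordinate by
coordinate, among those of `f` on the same box
(`controlledHomotopic_coordConcat_glueHalves`).  As the boxes shrink to points, the infinite
concatenation of all these homotopies converges to `f`
(`GenLoop.homotopic_of_controlledHomotopic`).  The approximation of stage zero is the infinite
concatenation of the coordinates of `f`.

A loop in the ordinary wedge meets only finitely many summands outside of the wedge point
(`WeakWedge.exists_retr_eq_of_isCompact`).  Hence it is fixed by the composition of the identity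
map to the shrinking wedge with a map that collapses almost all summands, so the third claim
follows from the second.
-/

/-! ### Shrinking wedges as subspaces of products -/

section WedgeBasics

universe u v w

variable {J : Type v} {A : J → Type u} {a : ∀ j, A j}

theorem WedgeSet.eq_base_or_incl (x : WedgeSet a) :
    x = WedgeSet.base a ∨ ∃ j y, x = WedgeSet.incl a j y := by
  rcases x with ⟨⟨⟩ | ⟨j, y⟩⟩
  · exact Or.inl rfl
  · exact Or.inr ⟨j, y, rfl⟩

theorem WedgeSet.eq_incl_of_retr_ne {x : WedgeSet a} {j : J} (h : WedgeSet.retr a j x ≠ a j) :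
    x = WedgeSet.incl a j (WedgeSet.retr a j x) := by
  rcases WedgeSet.eq_base_or_incl x with rfl | ⟨i, y, rfl⟩
  · exact absurd (WedgeSet.retr_base a j) h
  · by_cases hij : i = j
    · subst hij
      rw [WedgeSet.retr_incl_self]
    · exact absurd (WedgeSet.retr_incl_of_ne a hij y) h

theorem WedgeSet.eq_base_of_retr_eq {x : WedgeSet a} (h : ∀ j, WedgeSet.retr a j x = a j) :
    x = WedgeSet.base a := by
  rcases WedgeSet.eq_base_or_incl x with rfl | ⟨i, y, rfl⟩
  · rfl
  · have := h i
    rw [WedgeSet.retr_incl_self] at this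
    rw [this, WedgeSet.incl_basepoint]

theorem WedgeSet.ext_retr {x y : WedgeSet a}
    (h : ∀ j, WedgeSet.retr a j x = WedgeSet.retr a j y) : x = y := by
  by_cases hx : ∀ j, WedgeSet.retr a j x = a j
  · rw [WedgeSet.eq_base_of_retr_eq hx,
      WedgeSet.eq_base_of_retr_eq fun j => (h j).symm.trans (hx j)]
  · obtain ⟨j, hj⟩ := not_forall.1 hx
    have hj' : WedgeSet.retr a j y ≠ a j := h j ▸ hj
    exact (WedgeSet.eq_incl_of_retr_ne hj).trans
      ((congrArg _ (h j)).trans (WedgeSet.eq_incl_of_retr_ne hj').symm)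

theorem WedgeSet.retr_eq_of_retr_ne {x : WedgeSet a} {i j : J} (hi : WedgeSet.retr a i x ≠ a i)
    (hij : i ≠ j) : WedgeSet.retr a j x = a j := by
  exact (congrArg _ (WedgeSet.eq_incl_of_retr_ne hi)).trans (WedgeSet.retr_incl_of_ne a hij _)

open Classical in
/-- The point of the one-point union with prescribed coordinates `x j`.  It is meaningful if at
most one of them differs from the basepoint. -/
noncomputable def WedgeSet.ofFamily (a : ∀ j, A j) (x : ∀ j, A j) : WedgeSet a :=
  if h : ∃ j, x j ≠ a j then WedgeSet.incl a h.choose (x h.choose) else WedgeSet.base a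

theorem WedgeSet.retr_ofFamily {x : ∀ j, A j}
    (hx : ∀ i j, x i ≠ a i → x j ≠ a j → i = j) (j : J) :
    WedgeSet.retr a j (WedgeSet.ofFamily a x) = x j := by
  classical
  unfold WedgeSet.ofFamily
  split_ifs with h
  · by_cases hj : h.choose = j
    · have : ∀ i, i = j → WedgeSet.retr a j (WedgeSet.incl a i (x i)) = x j := by
        rintro i rfl
        exact WedgeSet.retr_incl_self a i _
      exact this _ hj
    · rw [WedgeSet.retr_incl_of_ne a hj]
      by_contra hne
      exact hj (hx _ _ h.choose_spec (Ne.symm hne))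
  · push Not at h
    rw [WedgeSet.retr_base, h j]

/-- The canonical injection of the `j`-th summand into the shrinking wedge. -/
def ShrinkingWedge.incl (a : ∀ j, A j) (j : J) (x : A j) : ShrinkingWedge a :=
  WedgeSet.incl a j x

theorem ShrinkingWedge.incl_basepoint (j : J) :
    ShrinkingWedge.incl a j (a j) = ShrinkingWedge.base a := WedgeSet.incl_basepoint a j

theorem ShrinkingWedge.eq_base_or_incl (x : ShrinkingWedge a) :
    x = ShrinkingWedge.base a ∨ ∃ j y, x = ShrinkingWedge.incl a j y :=
  WedgeSet.eq_base_or_incl x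

variable [∀ j, TopologicalSpace (A j)]

theorem ShrinkingWedge.isOpen_iff {U : Set (ShrinkingWedge a)} :
    IsOpen U ↔ (∀ j, IsOpen (ShrinkingWedge.incl a j ⁻¹' U)) ∧
      (ShrinkingWedge.base a ∈ U →
        {j | ¬ Set.range (ShrinkingWedge.incl a j) ⊆ U}.Finite) := Iff.rfl

theorem ShrinkingWedge.ext_retr {x y : ShrinkingWedge a}
    (h : ∀ j, ShrinkingWedge.retr a j x = ShrinkingWedge.retr a j y) : x = y :=
  WedgeSet.ext_retr h

theorem ShrinkingWedge.retr_base (j : J) :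
    ShrinkingWedge.retr a j (ShrinkingWedge.base a) = a j := rfl

theorem ShrinkingWedge.retr_incl_self (j : J) (x : A j) :
    ShrinkingWedge.retr a j (ShrinkingWedge.incl a j x) = x := WedgeSet.retr_incl_self a j x

theorem ShrinkingWedge.retr_incl_of_ne {i j : J} (h : i ≠ j) (x : A i) :
    ShrinkingWedge.retr a j (ShrinkingWedge.incl a i x) = a j := WedgeSet.retr_incl_of_ne a h x

theorem ShrinkingWedge.eq_incl_of_retr_ne {x : ShrinkingWedge a} {j : J}
    (h : ShrinkingWedge.retr a j x ≠ a j) :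
    x = ShrinkingWedge.incl a j (ShrinkingWedge.retr a j x) :=
  WedgeSet.eq_incl_of_retr_ne h

theorem ShrinkingWedge.eq_base_of_retr_eq {x : ShrinkingWedge a}
    (h : ∀ j, ShrinkingWedge.retr a j x = a j) : x = ShrinkingWedge.base a :=
  WedgeSet.eq_base_of_retr_eq h

theorem ShrinkingWedge.eq_of_retr_ne {x : ShrinkingWedge a} {i j : J}
    (hi : ShrinkingWedge.retr a i x ≠ a i) (hj : ShrinkingWedge.retr a j x ≠ a j) : i = j := by
  by_contra hij
  exact hj (WedgeSet.retr_eq_of_retr_ne hi hij)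

/-- If the basepoints are closed, the shrinking wedge carries the topology induced from the
product of its summands. -/
theorem ShrinkingWedge.continuous_of_retr [∀ j, T1Space (A j)] {X : Type w} [TopologicalSpace X]
    {f : X → ShrinkingWedge a} (hf : ∀ j, Continuous fun x => ShrinkingWedge.retr a j (f x)) :
    Continuous f := by
  refine continuous_def.2 fun U hU => isOpen_iff_mem_nhds.2 fun x hx => ?_
  rw [ShrinkingWedge.isOpen_iff] at hU
  rw [Set.mem_preimage] at hx
  by_cases hb : ∀ j, ShrinkingWedge.retr a j (f x) = a j
  · rw [ShrinkingWedge.eq_base_of_retr_eq hb] at hx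
    have hfin := hU.2 hx
    have hN : ∀ᶠ y in 𝓝 x, ∀ j ∈ {j | ¬ Set.range (ShrinkingWedge.incl a j) ⊆ U},
        ShrinkingWedge.retr a j (f y) ∈ ShrinkingWedge.incl a j ⁻¹' U := by
      refine (Filter.eventually_all_finite hfin).2 fun j _ => ?_
      refine (hf j).continuousAt.eventually_mem ((hU.1 j).mem_nhds ?_)
      rw [Set.mem_preimage, hb j, ShrinkingWedge.incl_basepoint]
      exact hx
    filter_upwards [hN] with y hy
    rw [Set.mem_preimage]
    rcases ShrinkingWedge.eq_base_or_incl (f y) with h | ⟨j, z, h⟩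
    · rw [h]; exact hx
    · by_cases hj : Set.range (ShrinkingWedge.incl a j) ⊆ U
      · rw [h]; exact hj ⟨z, rfl⟩
      · have := hy j hj
        rw [Set.mem_preimage, h, ShrinkingWedge.retr_incl_self] at this
        rwa [h]
  · obtain ⟨j, hj⟩ := not_forall.1 hb
    have h1 : ∀ᶠ y in 𝓝 x, ShrinkingWedge.retr a j (f y) ∈
        ShrinkingWedge.incl a j ⁻¹' U ∩ {a j}ᶜ := by
      refine (hf j).continuousAt.eventually_mem
        (((hU.1 j).inter isClosed_singleton.isOpen_compl).mem_nhds ⟨?_, hj⟩)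
      rw [Set.mem_preimage, ← ShrinkingWedge.eq_incl_of_retr_ne hj]
      exact hx
    filter_upwards [h1] with y hy
    rw [Set.mem_preimage, ShrinkingWedge.eq_incl_of_retr_ne hy.2]
    exact hy.1

/-- The map into the shrinking wedge with prescribed coordinates, any two of which have disjoint
supports. -/
noncomputable def ShrinkingWedge.ofFamily [∀ j, T1Space (A j)] {X : Type w} [TopologicalSpace X]
    (f : ∀ j, C(X, A j)) (hf : ∀ x i j, f i x ≠ a i → f j x ≠ a j → i = j) :
    C(X, ShrinkingWedge a) where
  toFun x := WedgeSet.ofFamily a fun j => f j x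
  continuous_toFun := by
    refine ShrinkingWedge.continuous_of_retr fun j => ?_
    refine (f j).continuous.congr fun x => ?_
    exact (WedgeSet.retr_ofFamily (hf x) j).symm

theorem ShrinkingWedge.retr_ofFamily [∀ j, T1Space (A j)] {X : Type w} [TopologicalSpace X]
    (f : ∀ j, C(X, A j)) (hf : ∀ x i j, f i x ≠ a i → f j x ≠ a j → i = j) (j : J) (x : X) :
    ShrinkingWedge.retr a j (ShrinkingWedge.ofFamily f hf x) = f j x :=
  WedgeSet.retr_ofFamily (hf x) j

theorem ShrinkingWedge.continuous_incl (j : J) : Continuous (ShrinkingWedge.incl a j) :=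
  continuous_def.2 fun _ hU => (ShrinkingWedge.isOpen_iff.1 hU).1 j

/-- A family of based maps that converges to the basepoint defines a map on the shrinking
wedge. -/
def ShrinkingWedge.desc {Y : Type w} [TopologicalSpace Y] {y : Y} (f : ∀ j, C(A j, Y))
    (hf : ∀ j, f j (a j) = y)
    (hn : ∀ V ∈ 𝓝 y, {j | ¬ Set.range (f j) ⊆ V}.Finite) : C(ShrinkingWedge a, Y) where
  toFun := Quot.lift (Sum.elim (fun _ => y) fun p => f p.1 p.2)
    (by rintro _ _ ⟨j⟩; exact (hf j).symm)
  continuous_toFun := by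
    refine continuous_def.2 fun U hU => ⟨fun j => hU.preimage (f j).continuous, fun hb => ?_⟩
    refine (hn U (hU.mem_nhds hb)).subset fun j hj hc => hj ?_
    rintro _ ⟨x, rfl⟩
    exact hc ⟨x, rfl⟩

theorem ShrinkingWedge.desc_incl {Y : Type w} [TopologicalSpace Y] {y : Y} (f : ∀ j, C(A j, Y))
    (hf : ∀ j, f j (a j) = y)
    (hn : ∀ V ∈ 𝓝 y, {j | ¬ Set.range (f j) ⊆ V}.Finite) (j : J) (x : A j) :
    ShrinkingWedge.desc f hf hn (ShrinkingWedge.incl a j x) = f j x := rfl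

theorem ShrinkingWedge.desc_base {Y : Type w} [TopologicalSpace Y] {y : Y} (f : ∀ j, C(A j, Y))
    (hf : ∀ j, f j (a j) = y)
    (hn : ∀ V ∈ 𝓝 y, {j | ¬ Set.range (f j) ⊆ V}.Finite) :
    ShrinkingWedge.desc f hf hn (ShrinkingWedge.base a) = y := rfl

/-- Every neighbourhood of the wedge point contains almost all summands. -/
theorem ShrinkingWedge.finite_of_mem_nhds {U : Set (ShrinkingWedge a)}
    (hU : U ∈ 𝓝 (ShrinkingWedge.base a)) :
    {j | ∃ x, ShrinkingWedge.incl a j x ∉ U}.Finite := by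
  obtain ⟨V, hVU, hV, hb⟩ := mem_nhds_iff.1 hU
  refine ((ShrinkingWedge.isOpen_iff.1 hV).2 hb).subset ?_
  rintro j ⟨x, hx⟩ hc
  exact hx (hVU (hc ⟨x, rfl⟩))

end WedgeBasics

/-! ### Homotopies of generalized loops -/

section GenLoopHomotopy

universe u v w

variable {N : Type w} {X : Type u} [TopologicalSpace X] {x : X}

theorem GenLoop.homotopic_of_map {f g : GenLoop N X x} (H : C(I × (N → I), X))
    (h0 : ∀ y, H (0, y) = f y) (h1 : ∀ y, H (1, y) = g y)
    (hb : ∀ t, ∀ y ∈ Cube.boundary N, H (t, y) = x) : GenLoop.Homotopic f g :=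
  ⟨{ toContinuousMap := H
     map_zero_left := h0
     map_one_left := h1
     prop' := fun t y hy => (hb t y hy).trans (f.2 y hy).symm }⟩

theorem GenLoop.Homotopic.exists_map {f g : GenLoop N X x} (h : GenLoop.Homotopic f g) :
    ∃ H : C(I × (N → I), X), (∀ y, H (0, y) = f y) ∧ (∀ y, H (1, y) = g y) ∧
      ∀ t, ∀ y ∈ Cube.boundary N, H (t, y) = x := by
  obtain ⟨H⟩ := h
  refine ⟨H.toContinuousMap, H.apply_zero, H.apply_one, fun t y hy => ?_⟩
  exact (H.eq_fst t hy).trans (f.2 y hy)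

theorem GenLoop.transAt_apply [DecidableEq N] (i : N) (f g : GenLoop N X x) (t : N → I) :
    GenLoop.transAt i f g t = if (t i : ℝ) ≤ 1 / 2
      then f (Function.update t i <| Set.projIcc 0 1 zero_le_one (2 * (t i : ℝ)))
      else g (Function.update t i <| Set.projIcc 0 1 zero_le_one (2 * (t i : ℝ) - 1)) := rfl

theorem GenLoop.postcomp_apply {Y : Type v} [TopologicalSpace Y] {y : Y} (φ : C(X, Y))
    (hφ : φ x = y) (f : GenLoop N X x) (t : N → I) : GenLoop.postcomp φ hφ f t = φ (f t) := rfl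

theorem GenLoop.notMem_boundary_of_ne (f : GenLoop N X x) {y : N → I} (h : f y ≠ x) :
    y ∉ Cube.boundary N :=
  fun hy => h (f.2 y hy)

/-- The class of a generalized loop in the homotopy group. -/
def HomotopyGroup.ofLoop (f : GenLoop N X x) : HomotopyGroup N X x :=
  Quotient.mk (GenLoop.Homotopic.setoid N x) f

theorem HomotopyGroup.ofLoop_eq_iff {f g : GenLoop N X x} :
    HomotopyGroup.ofLoop f = HomotopyGroup.ofLoop g ↔ GenLoop.Homotopic f g :=
  Quotient.eq (r := GenLoop.Homotopic.setoid N x)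

theorem HomotopyGroup.exists_ofLoop_eq (y : HomotopyGroup N X x) :
    ∃ f : GenLoop N X x, HomotopyGroup.ofLoop f = y :=
  Quotient.exists_rep y

theorem HomotopyGroup.ofLoop_mul [DecidableEq N] [Nonempty N] (i : N) (f g : GenLoop N X x) :
    HomotopyGroup.ofLoop f * HomotopyGroup.ofLoop g =
      HomotopyGroup.ofLoop (GenLoop.transAt i g f) :=
  HomotopyGroup.mul_spec

theorem HomotopyGroup.inducedHom_ofLoop {Y : Type v} [TopologicalSpace Y] {y : Y} (n : ℕ)
    [NeZero n] (φ : C(X, Y)) (hφ : φ x = y) (f : GenLoop (Fin n) X x) :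
    HomotopyGroup.inducedHom n φ hφ (HomotopyGroup.ofLoop f) =
      HomotopyGroup.ofLoop (GenLoop.postcomp φ hφ f) := rfl

end GenLoopHomotopy

/-! ### Infinite concatenation -/

section Concat

universe u w

/-- The clamped affine map of the unit interval that stretches the `j`-th slot
`[1 - 2⁻ʲ, 1 - 2⁻ʲ⁻¹]` over the whole interval. -/
noncomputable def slotCoord (j : ℕ) (s : I) : I :=
  Set.projIcc 0 1 zero_le_one (2 ^ (j + 1) * (s : ℝ) - 2 ^ (j + 1) + 2)

theorem continuous_slotCoord (j : ℕ) : Continuous (slotCoord j) :=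
  continuous_projIcc.comp (by fun_prop)

theorem slotCoord_zero (j : ℕ) : slotCoord j 0 = 0 := by
  refine Set.projIcc_of_le_left _ ?_
  have : (1 : ℝ) ≤ 2 ^ j := one_le_pow₀ (by norm_num)
  simp only [Set.Icc.coe_zero, mul_zero, pow_succ]
  linarith

theorem slotCoord_one (j : ℕ) : slotCoord j 1 = 1 := by
  refine Set.projIcc_of_right_le _ ?_
  simp only [Set.Icc.coe_one, mul_one]
  linarith

theorem slotCoord_disjoint {i j : ℕ} {s : I} (hi0 : slotCoord i s ≠ 0) (hi1 : slotCoord i s ≠ 1)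
    (hj0 : slotCoord j s ≠ 0) (hj1 : slotCoord j s ≠ 1) : i = j := by
  have key : ∀ k, slotCoord k s ≠ 0 → slotCoord k s ≠ 1 →
      1 < 2 ^ (k + 1) * (1 - (s : ℝ)) ∧ 2 ^ (k + 1) * (1 - (s : ℝ)) < 2 := by
    intro k h0 h1
    constructor
    · by_contra hc
      exact h1 (Set.projIcc_of_right_le _ (by linarith))
    · by_contra hc
      exact h0 (Set.projIcc_of_le_left _ (by linarith))
  have lt : ∀ k l, k < l → 1 < 2 ^ (k + 1) * (1 - (s : ℝ)) → 2 ^ (l + 1) * (1 - (s : ℝ)) < 2 →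
      False := by
    intro k l hkl h1 h2
    have h3 : (2 : ℝ) ^ (k + 1) * 2 ≤ 2 ^ (l + 1) := by
      rw [← pow_succ]
      exact pow_le_pow_right₀ (by norm_num) (by omega)
    have hs : (0 : ℝ) ≤ 1 - s := by linarith [s.2.2]
    nlinarith
  obtain ⟨a1, a2⟩ := key i hi0 hi1
  obtain ⟨b1, b2⟩ := key j hj0 hj1
  rcases lt_trichotomy i j with h | h | h
  · exact (lt i j h a1 b2).elim
  · exact h
  · exact (lt j i h b1 a2).elim

variable {N : Type w} [DecidableEq N]

/-- The map of the cube that stretches the `j`-th slot of the `i`-th coordinate. -/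
noncomputable def slot (i : N) (j : ℕ) : C(N → I, N → I) where
  toFun x := Function.update x i (slotCoord j (x i))
  continuous_toFun := continuous_id.update i ((continuous_slotCoord j).comp (continuous_apply i))

theorem slot_apply (i : N) (j : ℕ) (x : N → I) :
    slot i j x = Function.update x i (slotCoord j (x i)) := rfl

theorem slot_mem_boundary (i : N) (j : ℕ) {x : N → I} (hx : x ∈ Cube.boundary N) :
    slot i j x ∈ Cube.boundary N := by
  obtain ⟨k, hk⟩ := hx
  refine ⟨k, ?_⟩
  rw [slot_apply]
  by_cases hki : k = i
  · subst hki
    rw [Function.update_self]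
    rcases hk with hk | hk <;> rw [hk]
    · exact Or.inl (slotCoord_zero j)
    · exact Or.inr (slotCoord_one j)
  · rwa [Function.update_of_ne hki]

theorem slot_disjoint {i : N} {j k : ℕ} {x : N → I} (hj : slot i j x ∉ Cube.boundary N)
    (hk : slot i k x ∉ Cube.boundary N) : j = k := by
  have key : ∀ l, slot i l x ∉ Cube.boundary N →
      slotCoord l (x i) ≠ 0 ∧ slotCoord l (x i) ≠ 1 := by
    intro l hl
    refine ⟨fun h => hl ⟨i, Or.inl ?_⟩, fun h => hl ⟨i, Or.inr ?_⟩⟩ <;>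
      rw [slot_apply, Function.update_self, h]
  exact slotCoord_disjoint (key j hj).1 (key j hj).2 (key k hk).1 (key k hk).2

/-- The linear homotopy from the stretching of the `j`-th slot to the identity. -/
noncomputable def slotHomotopy (i : N) (j : ℕ) : C(I × (N → I), N → I) where
  toFun p := Function.update p.2 i (Set.projIcc 0 1 zero_le_one
    ((1 - (p.1 : ℝ)) * slotCoord j (p.2 i) + p.1 * p.2 i))
  continuous_toFun := by
    refine continuous_snd.update i (continuous_projIcc.comp ?_)
    have := continuous_slotCoord j
    fun_prop

theorem slotHomotopy_zero (i : N) (j : ℕ) (x : N → I) : slotHomotopy i j (0, x) = slot i j x := by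
  simp [slotHomotopy, slot_apply]

theorem slotHomotopy_one (i : N) (j : ℕ) (x : N → I) : slotHomotopy i j (1, x) = x := by
  simp [slotHomotopy]

theorem slotHomotopy_mem_boundary (i : N) (j : ℕ) (t : I) {x : N → I}
    (hx : x ∈ Cube.boundary N) : slotHomotopy i j (t, x) ∈ Cube.boundary N := by
  obtain ⟨k, hk⟩ := hx
  refine ⟨k, ?_⟩
  by_cases hki : k = i
  · subst hki
    rcases hk with hk | hk
    · left
      simp [slotHomotopy, hk, slotCoord_zero]
    · right
      simp [slotHomotopy, hk, slotCoord_one]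
  · simpa [slotHomotopy, Function.update_of_ne hki] using hk

variable {A : ℕ → Type u} [∀ j, TopologicalSpace (A j)] {a : ∀ j, A j}

theorem GenLoop.eq_of_slot_ne (i : N) (f : ∀ j, GenLoop N (A j) (a j)) (x : N → I) (j k : ℕ)
    (hj : (f j).1.comp (slot i j) x ≠ a j) (hk : (f k).1.comp (slot i k) x ≠ a k) : j = k :=
  slot_disjoint (GenLoop.notMem_boundary_of_ne (f j) hj) (GenLoop.notMem_boundary_of_ne (f k) hk)

variable [∀ j, T1Space (A j)]

/-- The infinite concatenation of the loops `f j` along the `i`-th coordinate: on the `j`-th slot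
it runs through `f j` in the `j`-th summand of the shrinking wedge. -/
noncomputable def GenLoop.concat (i : N) (f : ∀ j, GenLoop N (A j) (a j)) :
    GenLoop N (ShrinkingWedge a) (ShrinkingWedge.base a) :=
  ⟨ShrinkingWedge.ofFamily (fun j => (f j).1.comp (slot i j)) (GenLoop.eq_of_slot_ne i f),
    fun y hy => ShrinkingWedge.eq_base_of_retr_eq fun j => by
      rw [ShrinkingWedge.retr_ofFamily]
      exact (f j).2 _ (slot_mem_boundary i j hy)⟩

theorem GenLoop.retr_concat (i : N) (f : ∀ j, GenLoop N (A j) (a j)) (j : ℕ) (x : N → I) :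
    ShrinkingWedge.retr a j (GenLoop.concat i f x) = f j (slot i j x) :=
  ShrinkingWedge.retr_ofFamily _ (GenLoop.eq_of_slot_ne i f) j x

theorem GenLoop.Homotopic.concat (i : N) {f g : ∀ j, GenLoop N (A j) (a j)}
    (h : ∀ j, GenLoop.Homotopic (f j) (g j)) :
    GenLoop.Homotopic (GenLoop.concat i f) (GenLoop.concat i g) := by
  choose H h0 h1 hb using fun j => (h j).exists_map
  have hne : ∀ j t y, H j (t, y) ≠ a j → y ∉ Cube.boundary N := fun j t y hy hm => hy (hb j t y hm)
  refine GenLoop.homotopic_of_map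
    (ShrinkingWedge.ofFamily (fun j => (H j).comp ((ContinuousMap.id I).prodMap (slot i j)))
      fun p j k hj hk => slot_disjoint (hne j _ _ hj) (hne k _ _ hk))
    (fun y => ?_) (fun y => ?_) fun t y hy => ?_
  · refine ShrinkingWedge.ext_retr fun j => ?_
    rw [ShrinkingWedge.retr_ofFamily, GenLoop.retr_concat]
    exact h0 j _
  · refine ShrinkingWedge.ext_retr fun j => ?_
    rw [ShrinkingWedge.retr_ofFamily, GenLoop.retr_concat]
    exact h1 j _
  · refine ShrinkingWedge.eq_base_of_retr_eq fun j => ?_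
    rw [ShrinkingWedge.retr_ofFamily]
    exact hb j _ _ (slot_mem_boundary i j hy)

/-- The interchange law for the concatenations along two different coordinates. -/
theorem GenLoop.concat_transAt {i k : N} (hik : k ≠ i) (f g : ∀ j, GenLoop N (A j) (a j)) :
    GenLoop.concat i (fun j => GenLoop.transAt k (f j) (g j)) =
      GenLoop.transAt k (GenLoop.concat i f) (GenLoop.concat i g) := by
  refine GenLoop.ext _ _ fun x => ShrinkingWedge.ext_retr fun j => ?_
  rw [GenLoop.retr_concat, GenLoop.transAt_apply, GenLoop.transAt_apply]
  have hk : slot i j x k = x k := by rw [slot_apply, Function.update_of_ne hik]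
  have hu : ∀ s : I, Function.update (slot i j x) k s = slot i j (Function.update x k s) := by
    intro s
    rw [slot_apply, slot_apply, Function.update_comm hik, Function.update_of_ne hik.symm]
  rw [hk]
  split_ifs
  · rw [GenLoop.retr_concat, hu]
  · rw [GenLoop.retr_concat, hu]

/-- Infinite concatenation respects the multiplication of homotopy classes.  This is where the
dimension has to be at least two. -/
theorem GenLoop.homotopic_concat_transAt [Nontrivial N] (i k : N)
    (f g : ∀ j, GenLoop N (A j) (a j)) :
    GenLoop.Homotopic (GenLoop.concat i (fun j => GenLoop.transAt k (f j) (g j)))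
      (GenLoop.transAt k (GenLoop.concat i f) (GenLoop.concat i g)) := by
  -- concatenation along a coordinate other than `i` gives a homotopic loop, and strictly commutes
  -- with the infinite concatenation
  obtain ⟨l, hl⟩ := exists_ne i
  have h1 : ∀ j, GenLoop.Homotopic (GenLoop.transAt k (f j) (g j))
      (GenLoop.transAt l (f j) (g j)) := fun j =>
    Quotient.exact (HomotopyGroup.transAt_indep (i := k) l (f j) (g j))
  refine (GenLoop.Homotopic.concat i h1).trans ?_
  rw [GenLoop.concat_transAt hl]
  exact Quotient.exact (HomotopyGroup.transAt_indep (i := l) k _ _)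

/-- Stretching the `j`-th slot over the whole cube deforms the `j`-th coordinate of the infinite
concatenation to the `j`-th loop. -/
theorem GenLoop.homotopic_retr_concat (i : N) (f : ∀ j, GenLoop N (A j) (a j)) (j : ℕ) :
    GenLoop.Homotopic (GenLoop.postcomp (ShrinkingWedge.retr a j) (ShrinkingWedge.retr_base j)
      (GenLoop.concat i f)) (f j) := by
  refine GenLoop.homotopic_of_map ((f j).1.comp (slotHomotopy i j)) (fun y => ?_) (fun y => ?_)
    fun t y hy => ?_
  · rw [GenLoop.postcomp_apply, GenLoop.retr_concat, ContinuousMap.comp_apply, slotHomotopy_zero]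
    rfl
  · rw [ContinuousMap.comp_apply, slotHomotopy_one]
    rfl
  · exact (f j).2 _ (slotHomotopy_mem_boundary i j t hy)

end Concat

section SectionHom

universe u

variable {A : ℕ → Type u} [∀ j, TopologicalSpace (A j)] (a : ∀ j, A j)

theorem ShrinkingWedge.canonicalHom_ofLoop (n : ℕ) [NeZero n]
    (f : GenLoop (Fin n) (ShrinkingWedge a) (ShrinkingWedge.base a)) (j : ℕ) :
    ShrinkingWedge.canonicalHom a n (HomotopyGroup.ofLoop f) j = HomotopyGroup.ofLoop
      (GenLoop.postcomp (ShrinkingWedge.retr a j) (ShrinkingWedge.retr_base j) f) := rfl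

theorem HomotopyGroup.exists_family_ofLoop_eq {n : ℕ} (x : ∀ j, π_ n (A j) (a j)) :
    ∃ f : ∀ j, GenLoop (Fin n) (A j) (a j), x = fun j => HomotopyGroup.ofLoop (f j) := by
  choose f hf using fun j => HomotopyGroup.exists_ofLoop_eq (x j)
  exact ⟨f, funext fun j => (hf j).symm⟩

variable [∀ j, T1Space (A j)]

/-- Infinite concatenation as a map of homotopy groups. -/
noncomputable def HomotopyGroup.concat (n : ℕ) [NeZero n] (x : ∀ j, π_ n (A j) (a j)) :
    π_ n (ShrinkingWedge a) (ShrinkingWedge.base a) :=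
  HomotopyGroup.ofLoop
    (GenLoop.concat 0 fun j => Classical.choose (HomotopyGroup.exists_ofLoop_eq (x j)))

theorem HomotopyGroup.concat_ofLoop (n : ℕ) [NeZero n] (f : ∀ j, GenLoop (Fin n) (A j) (a j)) :
    HomotopyGroup.concat a n (fun j => HomotopyGroup.ofLoop (f j)) =
      HomotopyGroup.ofLoop (GenLoop.concat 0 f) :=
  HomotopyGroup.ofLoop_eq_iff.2 (GenLoop.Homotopic.concat 0 fun j =>
    HomotopyGroup.ofLoop_eq_iff.1
      (Classical.choose_spec (HomotopyGroup.exists_ofLoop_eq (HomotopyGroup.ofLoop (f j)))))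

/-- Infinite concatenation as a homomorphism of homotopy groups. -/
noncomputable def HomotopyGroup.concatHom (n : ℕ) [n.AtLeastTwo] :
    (∀ j, π_ n (A j) (a j)) →* π_ n (ShrinkingWedge a) (ShrinkingWedge.base a) :=
  MonoidHom.mk' (HomotopyGroup.concat a n) (by
    intro x y
    obtain ⟨f, rfl⟩ := HomotopyGroup.exists_family_ofLoop_eq a x
    obtain ⟨g, rfl⟩ := HomotopyGroup.exists_family_ofLoop_eq a y
    have h : ((fun j => HomotopyGroup.ofLoop (f j)) * fun j => HomotopyGroup.ofLoop (g j) :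
        ∀ j, π_ n (A j) (a j)) =
          fun j => HomotopyGroup.ofLoop (GenLoop.transAt 0 (g j) (f j)) :=
      funext fun j => HomotopyGroup.ofLoop_mul 0 (f j) (g j)
    rw [h, HomotopyGroup.concat_ofLoop, HomotopyGroup.concat_ofLoop, HomotopyGroup.concat_ofLoop,
      HomotopyGroup.ofLoop_mul 0]
    exact HomotopyGroup.ofLoop_eq_iff.2 (GenLoop.homotopic_concat_transAt 0 0 g f))

theorem HomotopyGroup.concatHom_ofLoop (n : ℕ) [n.AtLeastTwo]
    (f : ∀ j, GenLoop (Fin n) (A j) (a j)) :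
    HomotopyGroup.concatHom a n (fun j => HomotopyGroup.ofLoop (f j)) =
      HomotopyGroup.ofLoop (GenLoop.concat 0 f) :=
  HomotopyGroup.concat_ofLoop a n f

theorem ShrinkingWedge.canonicalHom_concatHom (n : ℕ) [n.AtLeastTwo]
    (x : ∀ j, π_ n (A j) (a j)) :
    ShrinkingWedge.canonicalHom a n (HomotopyGroup.concatHom a n x) = x := by
  obtain ⟨f, rfl⟩ := HomotopyGroup.exists_family_ofLoop_eq a x
  funext j
  rw [HomotopyGroup.concatHom_ofLoop, ShrinkingWedge.canonicalHom_ofLoop]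
  exact HomotopyGroup.ofLoop_eq_iff.2 (GenLoop.homotopic_retr_concat 0 f j)

end SectionHom

/-! ### Null sequences of spheres in sequentially connected spaces -/

section SphereCollapse

universe u w

/-- The one-point compactification of `ℝᵈ` as the unit sphere, with the point at infinity as
the basepoint. -/
theorem UnitSphere.exists_onePoint_homeomorph (d : ℕ) :
    ∃ e : OnePoint (Fin d → ℝ) ≃ₜ UnitSphere d, e OnePoint.infty = UnitSphere.base d := by
  have hv : ‖(EuclideanSpace.single 0 1 : EuclideanSpace ℝ (Fin (d + 1)))‖ = 1 := by simp
  have hv₀ : (EuclideanSpace.single 0 1 : EuclideanSpace ℝ (Fin (d + 1))) ≠ 0 := by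
    intro h
    rw [h, norm_zero] at hv
    exact zero_ne_one hv
  have : Fact (Module.finrank ℝ (EuclideanSpace ℝ (Fin (d + 1))) = d + 1) := ⟨by simp⟩
  have hV : Module.finrank ℝ (Fin d → ℝ) =
      Module.finrank ℝ (ℝ ∙ (EuclideanSpace.single 0 1 : EuclideanSpace ℝ (Fin (d + 1))))ᗮ := by
    rw [Submodule.finrank_orthogonal_span_singleton (n := d) hv₀]
    simp
  obtain ⟨e⟩ := FiniteDimensional.nonempty_continuousLinearEquiv_of_finrank_eq hV
  refine ⟨e.toHomeomorph.onePointCongr.trans (onePointHyperplaneHomeoUnitSphere hv), ?_⟩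
  rw [Homeomorph.trans_apply]
  exact OnePoint.equivOfIsEmbeddingOfRangeEq_apply_infty _ _ _ _

variable {E : Type w} [NormedAddCommGroup E] [NormedSpace ℝ E]

/-- The radial contraction of a normed space onto its open unit ball. -/
noncomputable def ballContraction (v : E) : E := (1 + ‖v‖)⁻¹ • v

/-- The radial expansion of the open unit ball, inverse to `ballContraction`. -/
noncomputable def ballExpansion (y : E) : E := (1 - ‖y‖)⁻¹ • y

theorem continuous_ballContraction : Continuous (ballContraction : E → E) := by
  refine Continuous.smul (Continuous.inv₀ (by fun_prop) fun v => ?_) continuous_id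
  positivity

theorem continuousOn_ballExpansion : ContinuousOn (ballExpansion : E → E) {y | ‖y‖ < 1} := by
  refine ContinuousOn.smul (ContinuousOn.inv₀ (by fun_prop) fun v hv => ?_) continuousOn_id
  have : ‖v‖ < 1 := hv
  linarith

theorem norm_ballContraction (v : E) : ‖ballContraction v‖ = ‖v‖ / (1 + ‖v‖) := by
  rw [ballContraction, norm_smul, norm_inv, Real.norm_of_nonneg (by positivity), div_eq_inv_mul]

theorem norm_ballContraction_lt (v : E) : ‖ballContraction v‖ < 1 := by
  rw [norm_ballContraction, div_lt_one (by positivity)]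
  linarith

theorem ballExpansion_ballContraction (v : E) : ballExpansion (ballContraction v) = v := by
  have h : (1 - ‖v‖ / (1 + ‖v‖))⁻¹ * (1 + ‖v‖)⁻¹ = 1 := by
    have : (1 + ‖v‖) ≠ 0 := by positivity
    field_simp
    ring
  rw [ballExpansion, norm_ballContraction, ballContraction, smul_smul, h, one_smul]

theorem ballContraction_ballExpansion {y : E} (hy : ‖y‖ < 1) :
    ballContraction (ballExpansion y) = y := by
  have h1 : 0 < 1 - ‖y‖ := by linarith
  have hn : ‖ballExpansion y‖ = (1 - ‖y‖)⁻¹ * ‖y‖ := by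
    rw [ballExpansion, norm_smul, norm_inv, Real.norm_of_nonneg h1.le]
  rw [ballContraction, hn, ballExpansion, smul_smul]
  have h : (1 + (1 - ‖y‖)⁻¹ * ‖y‖)⁻¹ * (1 - ‖y‖)⁻¹ = 1 := by
    have : (1 + (1 - ‖y‖)⁻¹ * ‖y‖) = (1 - ‖y‖)⁻¹ := by
      field_simp
      ring
    rw [this, inv_inv, mul_inv_cancel₀ h1.ne']
  rw [h, one_smul]

open Classical in
/-- The collapse of the complement of the open unit ball to the point at infinity. -/
noncomputable def ballCollapse (y : E) : OnePoint E :=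
  if ‖y‖ < 1 then ((ballExpansion y : E) : OnePoint E) else OnePoint.infty

theorem ballCollapse_of_lt {y : E} (hy : ‖y‖ < 1) :
    ballCollapse y = ((ballExpansion y : E) : OnePoint E) := if_pos hy

theorem ballCollapse_of_le {y : E} (hy : 1 ≤ ‖y‖) : ballCollapse y = OnePoint.infty :=
  if_neg hy.not_gt

theorem continuous_ballCollapse : Continuous (ballCollapse : E → OnePoint E) := by
  refine continuous_iff_continuousAt.2 fun y => ?_
  by_cases hy : ‖y‖ < 1
  · have hopen : {y : E | ‖y‖ < 1} ∈ 𝓝 y :=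
      (isOpen_lt continuous_norm continuous_const).mem_nhds hy
    refine ContinuousAt.congr (f := fun z => ((ballExpansion z : E) : OnePoint E)) ?_ ?_
    · exact OnePoint.continuous_coe.continuousAt.comp
        (continuousOn_ballExpansion.continuousAt hopen)
    · filter_upwards [hopen] with z hz
      exact (ballCollapse_of_lt hz).symm
  · rw [ContinuousAt, ballCollapse_of_le (not_lt.1 hy),
      OnePoint.hasBasis_nhds_infty.tendsto_right_iff]
    rintro s ⟨-, hs⟩
    have hK : IsCompact (ballContraction '' s) := hs.image continuous_ballContraction
    have hyK : y ∉ ballContraction '' s := by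
      rintro ⟨v, -, rfl⟩
      exact hy (norm_ballContraction_lt v)
    filter_upwards [hK.isClosed.isOpen_compl.mem_nhds hyK] with z hz
    by_cases hz1 : ‖z‖ < 1
    · refine Or.inl ⟨ballExpansion z, fun hs' => hz ?_, (ballCollapse_of_lt hz1).symm⟩
      exact ⟨_, hs', ballContraction_ballExpansion hz1⟩
    · exact Or.inr (ballCollapse_of_le (not_lt.1 hz1))

/-- A map that is constant off the open unit ball extends over the one-point compactification. -/
theorem exists_onePoint_extension [ProperSpace E] {X : Type u} [TopologicalSpace X] {x : X}
    (g : C(E, X)) (hg : ∀ y, 1 ≤ ‖y‖ → g y = x) :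
    ∃ G : C(OnePoint E, X), (∀ y, G (ballCollapse y) = g y) ∧ G OnePoint.infty = x ∧
      ∀ p, ∃ y, G p = g y ∨ G p = x := by
  have hlim : Filter.Tendsto (fun v => g (ballContraction v)) (Filter.coclosedCompact E) (𝓝 x) := by
    rw [Filter.coclosedCompact_eq_cocompact]
    intro V hV
    obtain ⟨U, hUV, hU, hx⟩ := mem_nhds_iff.1 hV
    have hK : IsCompact (Metric.closedBall (0 : E) 1 ∩ g ⁻¹' Uᶜ) :=
      (isCompact_closedBall 0 1).inter_right (hU.isClosed_compl.preimage g.continuous)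
    have hlt : Metric.closedBall (0 : E) 1 ∩ g ⁻¹' Uᶜ ⊆ {y | ‖y‖ < 1} := by
      rintro y ⟨-, hy⟩
      by_contra hc
      exact hy (by rw [hg y (not_lt.1 hc)]; exact hx)
    refine Filter.mem_map.2 (Filter.mem_cocompact.2
      ⟨_, hK.image_of_continuousOn (continuousOn_ballExpansion.mono hlt), fun v hv => ?_⟩)
    by_contra hc
    refine hv ⟨ballContraction v, ⟨?_, fun h => hc (hUV h)⟩, ballExpansion_ballContraction v⟩
    rw [mem_closedBall_zero_iff]
    exact (norm_ballContraction_lt v).le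
  refine ⟨OnePoint.continuousMapMk (g.comp ⟨ballContraction, continuous_ballContraction⟩) x hlim,
    fun y => ?_, rfl, fun p => ?_⟩
  · by_cases hy : ‖y‖ < 1
    · rw [ballCollapse_of_lt hy]
      exact congrArg g (ballContraction_ballExpansion hy)
    · rw [ballCollapse_of_le (not_lt.1 hy), hg y (not_lt.1 hy)]
      rfl
  · induction p using OnePoint.rec with
    | infty => exact ⟨0, Or.inr rfl⟩
    | coe v => exact ⟨_, Or.inl rfl⟩

end SphereCollapse

section NullFamilies

universe u v w

variable {X : Type u} [TopologicalSpace X] {x : X}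

/-- A family of maps converges to the point `x` on `S`: every neighbourhood of `x` contains the
images of `S` under almost all of them. -/
def NullFamily {ι : Type v} {T : Type w} (x : X) (S : Set T) (f : ι → T → X) : Prop :=
  ∀ V ∈ 𝓝 x, {i | ∃ p ∈ S, f i p ∉ V}.Finite

/-- In a sequentially connected space a null sequence of spheroids has a null sequence of
null-homotopies. -/
theorem SequentiallyConnectedAt.exists_nullhomotopy_nat {m d : ℕ}
    (hX : SequentiallyConnectedAt m X x) (hd : d ≤ m) (g : ℕ → C(Fin d → ℝ, X))
    (hg : ∀ i y, 1 ≤ ‖y‖ → g i y = x)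
    (hn : NullFamily x Set.univ fun i => g i) :
    ∃ G : ℕ → C(I × (Fin d → ℝ), X), (∀ i y, G i (0, y) = g i y) ∧ (∀ i y, G i (1, y) = x) ∧
      (∀ i t y, 1 ≤ ‖y‖ → G i (t, y) = x) ∧ NullFamily x Set.univ fun i => G i := by
  obtain ⟨e, he⟩ := UnitSphere.exists_onePoint_homeomorph d
  choose G hG hGi hGr using fun i => exists_onePoint_extension (g i) (hg i)
  let f : ℕ → C(UnitSphere d, X) := fun i => (G i).comp ⟨e.symm, e.symm.continuous⟩
  have hf : ∀ i, f i (UnitSphere.base d) = x := fun i => by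
    change G i (e.symm (UnitSphere.base d)) = x
    rw [← he, e.symm_apply_apply, hGi]
  have hfn : ∀ V ∈ 𝓝 x, {i | ¬ Set.range (f i) ⊆ V}.Finite := by
    intro V hV
    refine (hn V hV).subset fun i hi => ?_
    obtain ⟨_, ⟨p, rfl⟩, hp⟩ := Set.not_subset.1 hi
    obtain ⟨y, hy⟩ := hGr i (e.symm p)
    change G i (e.symm p) ∉ V at hp
    rcases hy with hy | hy
    · exact ⟨y, trivial, by rwa [hy] at hp⟩
    · rw [hy] at hp
      exact absurd (mem_of_mem_nhds hV) hp
  -- the spheroids form a map of the Hawaiian earring, and a null-homotopy of it restricts to a null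
  -- sequence of null-homotopies, because almost all spheres are close to the wedge point
  obtain ⟨K⟩ := hX d hd (ShrinkingWedge.desc f hf hfn) (ShrinkingWedge.desc_base f hf hfn)
  let q : ℕ → (Fin d → ℝ) → HawaiianEarring d := fun i y =>
    ShrinkingWedge.incl (fun _ : ℕ => UnitSphere.base d) i (e (ballCollapse y))
  have hq : ∀ i, Continuous (q i) := fun i =>
    (ShrinkingWedge.continuous_incl i).comp (e.continuous.comp continuous_ballCollapse)
  have hKb : ∀ t, K (t, HawaiianEarring.base d) = x := fun t =>
    (K.eq_fst t rfl).trans (ShrinkingWedge.desc_base f hf hfn)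
  refine ⟨fun i => K.toContinuousMap.comp
    ⟨fun p => (p.1, q i p.2), continuous_fst.prodMk ((hq i).comp continuous_snd)⟩,
    fun i y => ?_, fun i y => ?_, fun i t y hy => ?_, fun V hV => ?_⟩
  · refine (K.apply_zero _).trans ?_
    rw [ShrinkingWedge.desc_incl]
    change G i (e.symm (e (ballCollapse y))) = _
    rw [e.symm_apply_apply, hG]
  · exact K.apply_one _
  · have : q i y = HawaiianEarring.base d := by
      change ShrinkingWedge.incl (fun _ : ℕ => UnitSphere.base d) i (e (ballCollapse y)) = _
      rw [ballCollapse_of_le hy, he]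
      exact ShrinkingWedge.incl_basepoint i
    change K (t, q i y) = x
    rw [this, hKb]
  · have hU : ∀ᶠ z in 𝓝 (HawaiianEarring.base d), ∀ t ∈ (Set.univ : Set I), K (t, z) ∈ V := by
      refine isCompact_univ.eventually_forall_of_forall_eventually fun t _ => ?_
      have hc : ContinuousAt (fun p : HawaiianEarring d × I => K (p.2, p.1))
          (HawaiianEarring.base d, t) :=
        (K.continuous.comp (continuous_snd.prodMk continuous_fst)).continuousAt
      exact hc.eventually_mem (by rw [hKb]; exact hV)
    refine (ShrinkingWedge.finite_of_mem_nhds hU).subset ?_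
    rintro i ⟨⟨t, y⟩, -, hp⟩
    exact ⟨e (ballCollapse y), fun h => hp (h t trivial)⟩

theorem SequentiallyConnectedAt.exists_nullhomotopy {m d : ℕ}
    (hX : SequentiallyConnectedAt m X x) (hd : d ≤ m) {ι : Type v} [Countable ι]
    (g : ι → C(Fin d → ℝ, X)) (hg : ∀ i y, 1 ≤ ‖y‖ → g i y = x)
    (hn : NullFamily x Set.univ fun i => g i) :
    ∃ G : ι → C(I × (Fin d → ℝ), X), (∀ i y, G i (0, y) = g i y) ∧ (∀ i y, G i (1, y) = x) ∧
      (∀ i t y, 1 ≤ ‖y‖ → G i (t, y) = x) ∧ NullFamily x Set.univ fun i => G i := by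
  obtain ⟨φ, hφ⟩ := exists_injective_nat ι
  let g' : ℕ → C(Fin d → ℝ, X) := Function.extend φ g fun _ => ContinuousMap.const _ x
  have hg' : ∀ i, g' (φ i) = g i := fun i => hφ.extend_apply _ _ _
  have hg'' : ∀ k, (¬ ∃ i, φ i = k) → g' k = ContinuousMap.const _ x := fun k hk =>
    Function.extend_apply' _ _ _ hk
  obtain ⟨G, h0, h1, hb, hG⟩ := hX.exists_nullhomotopy_nat hd g'
    (fun k y hy => by
      by_cases hk : ∃ i, φ i = k
      · obtain ⟨i, rfl⟩ := hk
        rw [hg', hg i y hy]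
      · rw [hg'' k hk]; rfl)
    (fun V hV => by
      refine ((hn V hV).image φ).subset ?_
      rintro k ⟨y, -, hy⟩
      change g' k y ∉ V at hy
      by_cases hk : ∃ i, φ i = k
      · obtain ⟨i, rfl⟩ := hk
        exact ⟨i, ⟨y, trivial, by rwa [hg'] at hy⟩, rfl⟩
      · rw [hg'' k hk] at hy
        exact absurd (mem_of_mem_nhds hV) hy)
  refine ⟨fun i => G (φ i), fun i y => (h0 _ _).trans (by rw [hg']), fun i => h1 _,
    fun i => hb _, fun V hV => ?_⟩
  exact (hG V hV).preimage (f := φ) hφ.injOn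

end NullFamilies

/-! ### Filling a cylinder from its bottom and its sides -/

section Filling

universe u v w

variable {E : Type w} [NormedAddCommGroup E]

/-- The bottom and the sides of the cylinder over the closed unit ball. -/
def cylinderShell (E : Type w) [NormedAddCommGroup E] : Set (I × E) :=
  {p | ‖p.2‖ = 1 ∨ p.1 = 0 ∧ ‖p.2‖ ≤ 1}

/-- The scaling factor of the central projection onto `cylinderShell`. -/
noncomputable def shellScale (p : I × E) : ℝ := max ‖p.2‖ (1 - (p.1 : ℝ) / 2)

theorem shellScale_pos (p : I × E) : 0 < shellScale p := by
  refine lt_max_of_lt_right ?_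
  have := p.1.2.2
  linarith

variable [NormedSpace ℝ E]

/-- The projection onto `cylinderShell` from the point at height `2` on the axis. -/
noncomputable def shellRetraction : C(I × E, I × E) where
  toFun p := (Set.projIcc 0 1 zero_le_one (2 - (2 - (p.1 : ℝ)) / shellScale p),
    (shellScale p)⁻¹ • p.2)
  continuous_toFun := by
    have hs : Continuous (shellScale : I × E → ℝ) := by
      unfold shellScale
      fun_prop
    have hs0 : ∀ p : I × E, shellScale p ≠ 0 := fun p => (shellScale_pos p).ne'
    refine Continuous.prodMk (continuous_projIcc.comp ?_) ?_
    · exact continuous_const.sub (Continuous.div (by fun_prop) hs hs0)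
    · exact (hs.inv₀ hs0).smul continuous_snd

theorem shellRetraction_mem (p : I × E) : shellRetraction p ∈ cylinderShell E := by
  have hpos := shellScale_pos p
  have hn : ‖(shellRetraction p).2‖ = (shellScale p)⁻¹ * ‖p.2‖ := by
    change ‖(shellScale p)⁻¹ • p.2‖ = _
    rw [norm_smul, norm_inv, Real.norm_of_nonneg hpos.le]
  rcases le_total (1 - (p.1 : ℝ) / 2) ‖p.2‖ with h | h
  · left
    have hs : shellScale p = ‖p.2‖ := max_eq_left h
    rw [hn, ← hs, inv_mul_cancel₀ hpos.ne']
  · right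
    have hs : shellScale p = 1 - (p.1 : ℝ) / 2 := max_eq_right h
    constructor
    · refine Set.projIcc_of_le_left zero_le_one ?_
      have : (2 - (p.1 : ℝ)) / shellScale p = 2 := by
        rw [div_eq_iff hpos.ne', hs]
        ring
      rw [this]
      norm_num
    · rw [hn, inv_mul_le_iff₀ hpos, mul_one]
      exact le_max_left _ _

theorem shellRetraction_eq_self {p : I × E} (hp : p ∈ cylinderShell E) :
    shellRetraction p = p := by
  have h0 := p.1.2.1
  have hs : shellScale p = 1 := by
    rcases hp with hp | ⟨hp, hp'⟩
    · rw [shellScale, hp]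
      exact max_eq_left (by linarith)
    · rw [shellScale, hp]
      simpa using hp'
  refine Prod.ext ?_ ?_
  · change Set.projIcc 0 1 zero_le_one (2 - (2 - (p.1 : ℝ)) / shellScale p) = _
    rw [hs, div_one, sub_sub_cancel, Set.projIcc_val]
  · change (shellScale p)⁻¹ • p.2 = _
    rw [hs, inv_one, one_smul]

theorem shellRetraction_one {y : E} (hy : 1 ≤ ‖y‖) :
    (shellRetraction (1, y)).1 = 1 ∧ ‖(shellRetraction (1, y)).2‖ = 1 := by
  have hs : shellScale ((1 : I), y) = ‖y‖ := max_eq_left (by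
    simp only [Set.Icc.coe_one]
    linarith)
  constructor
  · refine Set.projIcc_of_right_le zero_le_one ?_
    rw [hs, Set.Icc.coe_one]
    have : (2 - 1) / ‖y‖ ≤ 1 := (div_le_one (by linarith)).2 (by linarith)
    linarith
  · change ‖(shellScale ((1 : I), y))⁻¹ • y‖ = 1
    rw [hs, norm_smul, norm_inv, norm_norm, inv_mul_cancel₀ (by linarith)]

variable {X : Type u} [TopologicalSpace X] {x : X}

/-- A homotopy that is constant where `b` vanishes can be run at speed `1 / b`. -/
theorem continuous_rescaled_homotopy {Z : Type w} [TopologicalSpace Z] {Ψ : I × Z → X}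
    (hΨ : Continuous Ψ) {b : Z → ℝ} (hb : Continuous b)
    (hΨb : ∀ t z, b z = 0 → Ψ (t, z) = x) :
    Continuous fun p : ℝ × Z => Ψ (Set.projIcc 0 1 zero_le_one (p.1 / b p.2), p.2) := by
  refine continuous_iff_continuousAt.2 fun p => ?_
  by_cases hp : b p.2 = 0
  · have hval : ∀ t, Ψ (t, p.2) = x := fun t => hΨb t _ hp
    rw [ContinuousAt, hval]
    intro V hV
    have hU : ∀ᶠ z in 𝓝 p.2, ∀ t ∈ (Set.univ : Set I), Ψ (t, z) ∈ V := by
      refine isCompact_univ.eventually_forall_of_forall_eventually fun t _ => ?_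
      have hc : ContinuousAt (fun q : Z × I => Ψ (q.2, q.1)) (p.2, t) :=
        (hΨ.comp (continuous_snd.prodMk continuous_fst)).continuousAt
      exact hc.eventually_mem (by rw [hval]; exact hV)
    have hU' : ∀ᶠ q : ℝ × Z in 𝓝 p, ∀ t ∈ (Set.univ : Set I), Ψ (t, q.2) ∈ V :=
      continuous_snd.continuousAt.eventually hU
    refine Filter.mem_map.2 ?_
    filter_upwards [hU'] with q hq
    exact hq _ trivial
  · refine hΨ.continuousAt.comp (ContinuousAt.prodMk ?_ continuous_snd.continuousAt)
    refine continuous_projIcc.continuousAt.comp ?_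
    exact continuous_fst.continuousAt.div (hb.comp continuous_snd).continuousAt hp

/-- A null family of maps on the bottom and the sides of cylinders over discs extends to a null
family of maps of the cylinders. -/
theorem exists_extension_of_shell {ι : Type v} (ψ : ι → I × E → X)
    (hψ : ∀ e, ContinuousOn (ψ e) (cylinderShell E)) (hn : NullFamily x (cylinderShell E) ψ) :
    ∃ F : ι → C(I × E, X), (∀ e, ∀ p ∈ cylinderShell E, F e p = ψ e p) ∧
      (∀ e, (∀ y, ‖y‖ = 1 → ψ e (1, y) = x) → ∀ y, 1 ≤ ‖y‖ → F e (1, y) = x) ∧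
      NullFamily x Set.univ fun e => F e := by
  refine ⟨fun e => ⟨fun p => ψ e (shellRetraction p),
    (hψ e).comp_continuous shellRetraction.continuous shellRetraction_mem⟩,
    fun e p hp => ?_, fun e h y hy => ?_, fun V hV => (hn V hV).subset ?_⟩
  · exact congrArg (ψ e) (shellRetraction_eq_self hp)
  · obtain ⟨h1, h2⟩ := shellRetraction_one hy
    change ψ e (shellRetraction (1, y)) = x
    have h3 : shellRetraction (1, y) = (1, (shellRetraction ((1 : I), y)).2) :=
      Prod.ext h1 rfl
    rw [h3, h _ h2]
  · rintro e ⟨p, -, hp⟩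
    exact ⟨_, shellRetraction_mem p, hp⟩

/-- If moreover the maps send the rim of the top to the basepoint, and the space is sequentially
connected, the extension can be chosen to send the whole top to the basepoint. -/
theorem SequentiallyConnectedAt.exists_fill_of_shell {m d : ℕ}
    (hX : SequentiallyConnectedAt m X x) (hd : d ≤ m) {ι : Type v} [Countable ι]
    (ψ : ι → I × (Fin d → ℝ) → X)
    (hψ : ∀ e, ContinuousOn (ψ e) (cylinderShell (Fin d → ℝ)))
    (h1 : ∀ e y, ‖y‖ = 1 → ψ e (1, y) = x)
    (hn : NullFamily x (cylinderShell (Fin d → ℝ)) ψ) :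
    ∃ F : ι → C(I × (Fin d → ℝ), X), (∀ e, ∀ p ∈ cylinderShell (Fin d → ℝ), F e p = ψ e p) ∧
      (∀ e y, F e (1, y) = x) ∧ NullFamily x Set.univ fun e => F e := by
  obtain ⟨Φ, hΦ, hΦ1, hΦn⟩ := exists_extension_of_shell ψ hψ hn
  obtain ⟨Ψ, hΨ0, hΨ1, hΨb, hΨn⟩ := hX.exists_nullhomotopy hd
    (fun e => (Φ e).comp ⟨fun y => (1, y), by fun_prop⟩) (fun e y hy => hΦ1 e (h1 e) y hy)
    (fun V hV => (hΦn V hV).subset (by rintro e ⟨y, -, hy⟩; exact ⟨(1, y), trivial, hy⟩))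
  -- first the extension over the cylinder is run through, then the null-homotopy of its top; the
  -- time `b y` spent on the latter vanishes over the rim, where the former is prescribed
  let b : (Fin d → ℝ) → ℝ := fun y => max 0 (1 - ‖y‖)
  have hb : Continuous b := by fun_prop
  have hb0 : ∀ y, 0 ≤ b y := fun y => le_max_left _ _
  have hb1 : ∀ y, b y = 0 ↔ 1 ≤ ‖y‖ := fun y => by
    simp only [b, max_eq_left_iff, tsub_le_iff_right, zero_add]
  let s : I × (Fin d → ℝ) → ℝ := fun p => p.1 * (1 + b p.2)
  have hs : Continuous s := by fun_prop
  have hF : ∀ e, Continuous fun p : I × (Fin d → ℝ) =>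
      if s p ≤ 1 then Φ e (Set.projIcc 0 1 zero_le_one (s p), p.2)
      else Ψ e (Set.projIcc 0 1 zero_le_one ((s p - 1) / b p.2), p.2) := by
    intro e
    refine Continuous.if_le ?_ ?_ hs continuous_const fun p hp => ?_
    · exact (Φ e).continuous.comp ((continuous_projIcc.comp hs).prodMk continuous_snd)
    · exact (continuous_rescaled_homotopy (Ψ e).continuous hb
        (fun t z hz => hΨb e t z ((hb1 z).1 hz))).comp
        ((hs.sub continuous_const).prodMk continuous_snd)
    · rw [hp, sub_self, zero_div, Set.projIcc_left, Set.projIcc_right]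
      exact (hΨ0 e _).symm
  refine ⟨fun e => ⟨_, hF e⟩, fun e p hp => ?_, fun e y => ?_, fun V hV => ?_⟩
  · have hsp : s p = p.1 := by
      rcases hp with hp | ⟨hp, -⟩
      · simp only [s, (hb1 p.2).2 hp.ge, add_zero, mul_one]
      · simp only [s, hp, Set.Icc.coe_zero, zero_mul]
    change (if s p ≤ 1 then _ else _) = _
    rw [if_pos (hsp ▸ p.1.2.2), hsp, Set.projIcc_val]
    exact hΦ e p hp
  · change (if s (1, y) ≤ 1 then _ else _) = _
    have hs1 : s (1, y) = 1 + b y := by simp [s]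
    rcases (hb0 y).eq_or_lt with h | h
    · rw [if_pos (by rw [hs1, ← h]; norm_num), hs1, ← h, add_zero, Set.projIcc_right]
      exact hΦ1 e (h1 e) y ((hb1 y).1 h.symm)
    · rw [if_neg (by rw [hs1]; linarith), hs1, add_sub_cancel_left, div_self h.ne',
        Set.projIcc_right]
      exact hΨ1 e y
  · refine ((hΦn V hV).union (hΨn V hV)).subset ?_
    rintro e ⟨p, -, hp⟩
    change (if s p ≤ 1 then _ else _) ∉ V at hp
    split_ifs at hp
    · exact Or.inl ⟨_, trivial, hp⟩
    · exact Or.inr ⟨_, trivial, hp⟩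

end Filling

/-! ### The Whitney decomposition into dyadic cells -/

section Whitney

/-- A dyadic cell of `ℝⁿ`: the product of the intervals with endpoints `lo i / 2 ^ level` and
`hi i / 2 ^ level`.  In the cells of interest `hi i` is `lo i` or `lo i + 1`. -/
@[ext]
structure DyadicCell (n : ℕ) where
  /-- The mesh of the grid is `2 ^ (-level)`. -/
  level : ℕ
  /-- The lower endpoints, in units of the mesh. -/
  lo : Fin n → ℤ
  /-- The upper endpoints, in units of the mesh. -/
  hi : Fin n → ℤ

variable {n : ℕ}

/-- The open cell of the grid of mesh `2 ^ (-m)` that contains `x`. -/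
noncomputable def dyadicCell (m : ℕ) (x : Fin n → ℝ) : DyadicCell n :=
  ⟨m, fun i => ⌊2 ^ m * x i⌋, fun i => ⌈2 ^ m * x i⌉⟩

namespace DyadicCell

instance : Countable (DyadicCell n) := by
  have hinj : Function.Injective
      fun c : DyadicCell n => (c.level, c.lo, c.hi) := by
    rintro ⟨a, b, c⟩ ⟨a', b', c'⟩ h
    simpa using h
  exact hinj.countable

/-- The closed cell. -/
def carrier (c : DyadicCell n) : Set (Fin n → ℝ) :=
  {y | ∀ i, (c.lo i : ℝ) ≤ 2 ^ c.level * y i ∧ 2 ^ c.level * y i ≤ c.hi i}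

/-- The union of the closed cubes of the grid that contain the cell. -/
def star (c : DyadicCell n) : Set (Fin n → ℝ) :=
  {y | ∀ i, (c.hi i : ℝ) - 1 ≤ 2 ^ c.level * y i ∧ 2 ^ c.level * y i ≤ c.lo i + 1}

/-- The coordinates that vary on the cell. -/
def free (c : DyadicCell n) : Finset (Fin n) := Finset.univ.filter fun i => c.lo i ≠ c.hi i

/-- The dimension of the cell. -/
def dim (c : DyadicCell n) : ℕ := c.free.card

theorem mem_free {c : DyadicCell n} {i : Fin n} : i ∈ c.free ↔ c.lo i ≠ c.hi i := by
  simp [free]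

theorem dim_le (c : DyadicCell n) : c.dim ≤ n :=
  (Finset.card_le_univ c.free).trans_eq (Fintype.card_fin n)

theorem isClosed_carrier (c : DyadicCell n) : IsClosed c.carrier := by
  have : c.carrier = ⋂ i, {y : Fin n → ℝ | (c.lo i : ℝ) ≤ 2 ^ c.level * y i ∧
      2 ^ c.level * y i ≤ c.hi i} := by
    ext y
    simp [carrier]
  rw [this]
  refine isClosed_iInter fun i => ?_
  have hi : Continuous fun y : Fin n → ℝ => 2 ^ c.level * y i := by fun_prop
  exact (isClosed_le continuous_const hi).inter (isClosed_le hi continuous_const)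

end DyadicCell

theorem floor_ceil_cases (r : ℝ) : (⌊r⌋ = ⌈r⌉ ∧ r = ⌊r⌋) ∨
    (⌈r⌉ = ⌊r⌋ + 1 ∧ (⌊r⌋ : ℝ) < r ∧ r < ⌊r⌋ + 1) := by
  rcases (Int.floor_le r).eq_or_lt with h | h
  · left
    refine ⟨?_, h.symm⟩
    rw [← h]
    simp
  · right
    have h2 : r < ⌊r⌋ + 1 := Int.lt_floor_add_one r
    refine ⟨Int.ceil_eq_iff.2 ⟨?_, ?_⟩, h, h2⟩
    · push_cast
      linarith
    · push_cast
      exact h2.le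

theorem mem_carrier_dyadicCell (m : ℕ) (x : Fin n → ℝ) : x ∈ (dyadicCell m x).carrier :=
  fun _ => ⟨Int.floor_le _, Int.le_ceil _⟩

theorem carrier_subset_star (m : ℕ) (x : Fin n → ℝ) :
    (dyadicCell m x).carrier ⊆ (dyadicCell m x).star := by
  intro y hy i
  have h1 : (⌈2 ^ m * x i⌉ : ℝ) ≤ ⌊2 ^ m * x i⌋ + 1 := by
    exact_mod_cast Int.ceil_le_floor_add_one (2 ^ m * x i)
  obtain ⟨h2, h3⟩ := hy i
  exact ⟨(sub_le_iff_le_add.2 h1).trans h2, h3.trans h1⟩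

theorem abs_sub_le_of_mem_star {m : ℕ} {x y : Fin n → ℝ} (hy : y ∈ (dyadicCell m x).star)
    (i : Fin n) : |y i - x i| ≤ 1 / 2 ^ m := by
  obtain ⟨h1, h2⟩ := hy i
  have h3 := Int.floor_le (2 ^ m * x i)
  have h4 := Int.le_ceil (2 ^ m * x i)
  have hp : (0 : ℝ) < 2 ^ m := by positivity
  have key : |2 ^ m * (y i - x i)| ≤ 1 := by
    change (⌈2 ^ m * x i⌉ : ℝ) - 1 ≤ 2 ^ m * y i at h1
    change 2 ^ m * y i ≤ (⌊2 ^ m * x i⌋ : ℝ) + 1 at h2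
    rw [abs_le]
    constructor <;> linarith
  rw [abs_mul, abs_of_pos hp] at key
  rw [le_div_iff₀ hp, mul_comm]
  exact key

/-- Each closed cell of a finer grid is contained in a closed cell of a coarser grid. -/
theorem mem_carrier_of_le {k m : ℕ} (hkm : k ≤ m) {x y : Fin n → ℝ}
    (hy : y ∈ (dyadicCell m x).carrier) : y ∈ (dyadicCell k x).carrier := by
  obtain ⟨l, rfl⟩ := Nat.exists_eq_add_of_le hkm
  intro i
  obtain ⟨h1, h2⟩ := hy i
  change (⌊2 ^ (k + l) * x i⌋ : ℝ) ≤ 2 ^ (k + l) * y i at h1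
  change 2 ^ (k + l) * y i ≤ (⌈2 ^ (k + l) * x i⌉ : ℝ) at h2
  change (⌊2 ^ k * x i⌋ : ℝ) ≤ 2 ^ k * y i ∧ 2 ^ k * y i ≤ (⌈2 ^ k * x i⌉ : ℝ)
  have hp : (0 : ℝ) < 2 ^ l := by positivity
  constructor
  · have : 2 ^ l * ⌊2 ^ k * x i⌋ ≤ ⌊2 ^ (k + l) * x i⌋ := by
      rw [Int.le_floor]
      push_cast
      rw [pow_add, mul_comm ((2 : ℝ) ^ k) (2 ^ l), mul_assoc]
      exact mul_le_mul_of_nonneg_left (Int.floor_le _) hp.le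
    have h : (2 : ℝ) ^ l * ⌊2 ^ k * x i⌋ ≤ 2 ^ l * (2 ^ k * y i) := by
      refine le_trans (by exact_mod_cast this) (h1.trans (le_of_eq ?_))
      ring
    exact le_of_mul_le_mul_left h hp
  · have : ⌈2 ^ (k + l) * x i⌉ ≤ 2 ^ l * ⌈2 ^ k * x i⌉ := by
      rw [Int.ceil_le]
      push_cast
      rw [pow_add, mul_comm ((2 : ℝ) ^ k) (2 ^ l), mul_assoc]
      exact mul_le_mul_of_nonneg_left (Int.le_ceil _) hp.le
    have h : (2 : ℝ) ^ l * (2 ^ k * y i) ≤ 2 ^ l * ⌈2 ^ k * x i⌉ := by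
      refine le_trans (le_of_eq ?_) (h2.trans (by exact_mod_cast this))
      ring
    exact le_of_mul_le_mul_left h hp

theorem star_subset_of_mem_carrier {m : ℕ} {x y : Fin n → ℝ}
    (hy : y ∈ (dyadicCell m x).carrier) : (dyadicCell m x).star ⊆ (dyadicCell m y).star := by
  intro z hz i
  obtain ⟨h1, h2⟩ := hz i
  obtain ⟨h3, h4⟩ := hy i
  have h5 : ⌈2 ^ m * y i⌉ ≤ ⌈2 ^ m * x i⌉ := Int.ceil_le.2 h4
  have h6 : ⌊2 ^ m * x i⌋ ≤ ⌊2 ^ m * y i⌋ := Int.le_floor.2 h3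
  have h5' : (⌈2 ^ m * y i⌉ : ℝ) ≤ ⌈2 ^ m * x i⌉ := by exact_mod_cast h5
  have h6' : (⌊2 ^ m * x i⌋ : ℝ) ≤ ⌊2 ^ m * y i⌋ := by exact_mod_cast h6
  exact ⟨(sub_le_sub_right h5' 1).trans h1, h2.trans (add_le_add_left h6' 1)⟩

theorem free_subset_of_le {k m : ℕ} (hkm : k ≤ m) (x : Fin n → ℝ) :
    (dyadicCell m x).free ⊆ (dyadicCell k x).free := by
  obtain ⟨l, rfl⟩ := Nat.exists_eq_add_of_le hkm
  intro i hi
  rw [DyadicCell.mem_free] at hi ⊢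
  intro h
  apply hi
  have hx : 2 ^ k * x i = ⌊2 ^ k * x i⌋ := by
    rcases floor_ceil_cases (2 ^ k * x i) with ⟨-, h1⟩ | ⟨h1, -⟩
    · exact h1
    · change ⌊2 ^ k * x i⌋ = ⌈2 ^ k * x i⌉ at h
      omega
  have hx' : 2 ^ (k + l) * x i = ((2 ^ l * ⌊2 ^ k * x i⌋ : ℤ) : ℝ) := by
    push_cast
    rw [← hx]
    ring
  change ⌊2 ^ (k + l) * x i⌋ = ⌈2 ^ (k + l) * x i⌉
  rw [hx', Int.floor_intCast, Int.ceil_intCast]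

/-- A point of the boundary of a cell lies in a cell of smaller dimension. -/
theorem dyadicCell_eq_or_dim_lt {m : ℕ} {x y : Fin n → ℝ}
    (hy : y ∈ (dyadicCell m x).carrier) :
    dyadicCell m y = dyadicCell m x ∨ (dyadicCell m y).dim < (dyadicCell m x).dim := by
  have key : ∀ i, (⌊2 ^ m * y i⌋ = ⌊2 ^ m * x i⌋ ∧ ⌈2 ^ m * y i⌉ = ⌈2 ^ m * x i⌉) ∨
      (⌊2 ^ m * y i⌋ = ⌈2 ^ m * y i⌉ ∧ ⌊2 ^ m * x i⌋ ≠ ⌈2 ^ m * x i⌉) := by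
    intro i
    obtain ⟨h3, h4⟩ := hy i
    have h5 : ⌈2 ^ m * y i⌉ ≤ ⌈2 ^ m * x i⌉ := Int.ceil_le.2 h4
    have h6 : ⌊2 ^ m * x i⌋ ≤ ⌊2 ^ m * y i⌋ := Int.le_floor.2 h3
    have h7 := Int.floor_le_ceil (2 ^ m * y i)
    rcases floor_ceil_cases (2 ^ m * x i) with ⟨h1, -⟩ | ⟨h1, -⟩
    · left
      omega
    · rcases floor_ceil_cases (2 ^ m * y i) with ⟨h2, -⟩ | ⟨h2, -⟩
      · right
        omega
      · left
        omega
  by_cases hall : ∀ i, ⌊2 ^ m * y i⌋ = ⌊2 ^ m * x i⌋ ∧ ⌈2 ^ m * y i⌉ = ⌈2 ^ m * x i⌉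
  · left
    exact DyadicCell.ext rfl (funext fun i => (hall i).1) (funext fun i => (hall i).2)
  · right
    obtain ⟨j, hj⟩ := not_forall.1 hall
    refine Finset.card_lt_card (Finset.ssubset_iff_of_subset ?_ |>.2 ⟨j, ?_, ?_⟩)
    · intro i hi
      rw [DyadicCell.mem_free] at hi ⊢
      rcases key i with h | h
      · intro hx
        exact hi (h.1.trans (hx.trans h.2.symm))
      · exact h.2
    · rw [DyadicCell.mem_free]
      exact ((key j).resolve_left hj).2
    · rw [DyadicCell.mem_free]
      exact fun h => h ((key j).resolve_left hj).1

variable {Z : Set (Fin n → ℝ)}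

/-- The first level at which no closed dyadic cube through `x` meets `Z`. -/
noncomputable def whitneyLevel (Z : Set (Fin n → ℝ)) (x : Fin n → ℝ) : ℕ :=
  sInf {m | Disjoint (dyadicCell m x).star Z}

/-- The cell through `x` of the Whitney decomposition of the complement of `Z`. -/
noncomputable def whitneyCell (Z : Set (Fin n → ℝ)) (x : Fin n → ℝ) : DyadicCell n :=
  dyadicCell (whitneyLevel Z x) x

theorem exists_disjoint_star (hZ : IsClosed Z) {x : Fin n → ℝ} (hx : x ∉ Z) :
    ∃ m, Disjoint (dyadicCell m x).star Z := by
  obtain ⟨δ, hδ, hb⟩ := Metric.isOpen_iff.1 hZ.isOpen_compl x hx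
  obtain ⟨m, hm⟩ := exists_pow_lt_of_lt_one hδ (by norm_num : (1 / 2 : ℝ) < 1)
  refine ⟨m, Set.disjoint_left.2 fun y hy => hb ?_⟩
  rw [Metric.mem_ball, dist_pi_lt_iff hδ]
  intro i
  rw [Real.dist_eq]
  refine (abs_sub_le_of_mem_star hy i).trans_lt ?_
  rwa [← one_div_pow]

theorem disjoint_star_whitneyCell (hZ : IsClosed Z) {x : Fin n → ℝ} (hx : x ∉ Z) :
    Disjoint (whitneyCell Z x).star Z :=
  Nat.sInf_mem (exists_disjoint_star hZ hx)

theorem notMem_of_mem_carrier_whitneyCell (hZ : IsClosed Z) {x y : Fin n → ℝ} (hx : x ∉ Z)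
    (hy : y ∈ (whitneyCell Z x).carrier) : y ∉ Z :=
  Set.disjoint_left.1 (disjoint_star_whitneyCell hZ hx) (carrier_subset_star _ _ hy)

theorem mem_carrier_whitneyCell (x : Fin n → ℝ) : x ∈ (whitneyCell Z x).carrier :=
  mem_carrier_dyadicCell _ x

/-- The cells form a decomposition: two of them are equal, or the dimension drops. -/
theorem whitneyCell_eq_or_dim_lt (hZ : IsClosed Z) {x y : Fin n → ℝ} (hx : x ∉ Z)
    (hy : y ∈ (whitneyCell Z x).carrier) :
    whitneyCell Z y = whitneyCell Z x ∨ (whitneyCell Z y).dim < (whitneyCell Z x).dim := by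
  have hyZ := notMem_of_mem_carrier_whitneyCell hZ hx hy
  have hle : whitneyLevel Z x ≤ whitneyLevel Z y := by
    by_contra hlt
    have h1 : y ∈ (dyadicCell (whitneyLevel Z y) x).carrier :=
      mem_carrier_of_le (not_le.1 hlt).le hy
    have h2 : Disjoint (dyadicCell (whitneyLevel Z y) x).star Z :=
      (disjoint_star_whitneyCell hZ hyZ).mono_left (star_subset_of_mem_carrier h1)
    exact hlt (Nat.sInf_le h2)
  rcases dyadicCell_eq_or_dim_lt hy with h | h
  · left
    have h3 : whitneyLevel Z y = whitneyLevel Z x := by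
      refine le_antisymm (Nat.sInf_le ?_) hle
      change Disjoint (dyadicCell (whitneyLevel Z x) y).star Z
      rw [h]
      exact disjoint_star_whitneyCell hZ hx
    rw [whitneyCell, h3, h, whitneyCell]
  · right
    exact (Finset.card_le_card (free_subset_of_le hle y)).trans_lt h

theorem whitneyCell_eq_of_dyadicCell_eq (hZ : IsClosed Z) {x y : Fin n → ℝ} (hx : x ∉ Z)
    (hy : dyadicCell (whitneyLevel Z x) y = whitneyCell Z x) :
    whitneyCell Z y = whitneyCell Z x := by
  have hyc : y ∈ (whitneyCell Z x).carrier := hy ▸ mem_carrier_dyadicCell _ y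
  have hyZ := notMem_of_mem_carrier_whitneyCell hZ hx hyc
  have hxc : x ∈ (dyadicCell (whitneyLevel Z x) y).carrier := by
    rw [hy]; exact mem_carrier_whitneyCell x
  have hle : whitneyLevel Z y ≤ whitneyLevel Z x := by
    refine Nat.sInf_le ?_
    change Disjoint (dyadicCell (whitneyLevel Z x) y).star Z
    rw [hy]
    exact disjoint_star_whitneyCell hZ hx
  have hge : whitneyLevel Z x ≤ whitneyLevel Z y := by
    refine Nat.sInf_le ?_
    change Disjoint (dyadicCell (whitneyLevel Z y) x).star Z
    exact (disjoint_star_whitneyCell hZ hyZ).mono_left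
      (star_subset_of_mem_carrier (mem_carrier_of_le hle hyc))
  rw [whitneyCell, le_antisymm hle hge, hy]

/-- Only finitely many Whitney cells fail to be contained in a given neighbourhood of `Z`. -/
theorem finite_whitneyCell (hZ : IsClosed Z) (hb : Bornology.IsBounded Zᶜ)
    {U : Set (Fin n → ℝ)} (hU : IsOpen U) (hZU : Z ⊆ U) :
    {c : DyadicCell n | (∃ x, x ∉ Z ∧ whitneyCell Z x = c) ∧ ∃ y ∈ c.carrier, y ∉ U}.Finite := by
  have hsub : Uᶜ ⊆ Zᶜ := Set.compl_subset_compl.2 hZU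
  have hK : IsCompact Uᶜ := Metric.isCompact_of_isClosed_isBounded hU.isClosed_compl (hb.subset hsub)
  obtain ⟨δ, hδ, hthick⟩ := hK.exists_thickening_subset_open hZ.isOpen_compl hsub
  obtain ⟨M, hM⟩ := exists_pow_lt_of_lt_one (by positivity : 0 < δ / 3)
    (by norm_num : (1 / 2 : ℝ) < 1)
  obtain ⟨R, hR⟩ := hK.isBounded.exists_norm_le
  obtain ⟨B, hB⟩ := exists_nat_gt (2 ^ M * |R| + 1)
  have hfin : ({c : DyadicCell n | c.level < M + 1 ∧ (c.lo ∈ Set.pi Set.univ fun _ =>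
      Set.Icc (-(B : ℤ)) B) ∧ c.hi ∈ Set.pi Set.univ fun _ => Set.Icc (-(B : ℤ)) B}).Finite := by
    have hinj : Function.Injective
        fun c : DyadicCell n => (c.level, c.lo, c.hi) := by
      rintro ⟨a, b, c⟩ ⟨a', b', c'⟩ h
      simpa using h
    have hpi : (Set.pi Set.univ fun _ : Fin n => Set.Icc (-(B : ℤ)) B).Finite :=
      Set.Finite.pi fun _ => Set.finite_Icc _ _
    exact (((Set.finite_Iio (M + 1)).prod (hpi.prod hpi)).preimage hinj.injOn).subset
      fun c hc => hc
  refine hfin.subset ?_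
  rintro _ ⟨⟨x, hx, rfl⟩, y, hy, hyU⟩
  have hlev : whitneyLevel Z x < M + 1 := by
    by_contra hc
    have h1 : ¬ Disjoint (dyadicCell M x).star Z := fun h => by
      have := Nat.sInf_le (s := {m | Disjoint (dyadicCell m x).star Z}) h
      have h2 : whitneyLevel Z x ≤ M := this
      omega
    obtain ⟨z, hz, hzZ⟩ := Set.not_disjoint_iff.1 h1
    refine hthick (a := z) ?_ hzZ
    refine Metric.mem_thickening_iff.2 ⟨y, hyU, ?_⟩
    have hyx : y ∈ (dyadicCell M x).star :=
      carrier_subset_star _ _ (mem_carrier_of_le (by omega) hy)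
    rw [dist_pi_lt_iff hδ]
    intro i
    have a1 := abs_sub_le_of_mem_star hz i
    have a2 := abs_sub_le_of_mem_star hyx i
    have a3 : (1 : ℝ) / 2 ^ M < δ / 3 := by rwa [← one_div_pow]
    rw [Real.dist_eq]
    have a4 : z i - y i = (z i - x i) - (y i - x i) := by ring
    rw [a4]
    refine (abs_sub _ _).trans_lt ?_
    linarith
  have hbound : ∀ i, |2 ^ whitneyLevel Z x * y i| ≤ 2 ^ M * |R| := by
    intro i
    rw [abs_mul, abs_of_pos (by positivity)]
    refine mul_le_mul (pow_le_pow_right₀ (by norm_num) (by omega)) ?_ (abs_nonneg _)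
      (by positivity)
    exact ((norm_le_pi_norm y i).trans (hR y hyU)).trans (le_abs_self R)
  have hlohi : ∀ i, (whitneyCell Z x).lo i ∈ Set.Icc (-(B : ℤ)) B ∧
      (whitneyCell Z x).hi i ∈ Set.Icc (-(B : ℤ)) B := by
    intro i
    obtain ⟨h1, h2⟩ := hy i
    have h3 := abs_le.1 (hbound i)
    have h4 : (whitneyCell Z x).hi i ≤ (whitneyCell Z x).lo i + 1 := Int.ceil_le_floor_add_one _
    have h4' : ((whitneyCell Z x).hi i : ℝ) ≤ (whitneyCell Z x).lo i + 1 := by exact_mod_cast h4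
    change ((whitneyCell Z x).lo i : ℝ) ≤ 2 ^ whitneyLevel Z x * y i at h1
    change 2 ^ whitneyLevel Z x * y i ≤ ((whitneyCell Z x).hi i : ℝ) at h2
    refine ⟨⟨?_, ?_⟩, ?_, ?_⟩
    · have : (-(B : ℝ)) ≤ (whitneyCell Z x).lo i := by linarith
      exact_mod_cast this
    · have : ((whitneyCell Z x).lo i : ℝ) ≤ (B : ℝ) := by linarith
      exact_mod_cast this
    · have : (-(B : ℝ)) ≤ (whitneyCell Z x).hi i := by linarith
      exact_mod_cast this
    · have : ((whitneyCell Z x).hi i : ℝ) ≤ (B : ℝ) := by linarith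
      exact_mod_cast this
  exact ⟨hlev, fun i _ => (hlohi i).1, fun i _ => (hlohi i).2⟩

end Whitney

/-! ### Characteristic maps of cells -/

section CellChart

variable {n : ℕ}

namespace DyadicCell

/-- A numbering of the coordinates that vary on the cell. -/
noncomputable def freeEquiv (c : DyadicCell n) {d : ℕ} (hd : c.dim = d) :
    {i // i ∈ c.free} ≃ Fin d :=
  Fintype.equivFinOfCardEq ((Fintype.card_coe _).trans hd)

open Classical in
/-- The affine map of the cube `[-1, 1]ᵈ` onto a closed `d`-dimensional cell. -/
noncomputable def chart (c : DyadicCell n) {d : ℕ} (hd : c.dim = d) (y : Fin d → ℝ) :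
    Fin n → ℝ := fun i =>
  (c.lo i + c.hi i + if h : i ∈ c.free then y (c.freeEquiv hd ⟨i, h⟩) else 0) / 2 / 2 ^ c.level

/-- The affine coordinates on a `d`-dimensional cell. -/
noncomputable def coords (c : DyadicCell n) {d : ℕ} (hd : c.dim = d) (x : Fin n → ℝ) :
    Fin d → ℝ := fun l =>
  2 * (2 ^ c.level * x ((c.freeEquiv hd).symm l)) - c.lo ((c.freeEquiv hd).symm l) -
    c.hi ((c.freeEquiv hd).symm l)

variable {c : DyadicCell n} {d : ℕ} (hd : c.dim = d)

theorem continuous_chart : Continuous (c.chart hd) := by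
  refine continuous_pi fun i => ?_
  unfold chart
  split_ifs <;> fun_prop

theorem continuous_coords : Continuous (c.coords hd) := by
  unfold coords
  fun_prop

theorem scale_chart_of_mem {i : Fin n} (h : i ∈ c.free) (y : Fin d → ℝ) :
    2 ^ c.level * c.chart hd y i = (c.lo i + c.hi i + y (c.freeEquiv hd ⟨i, h⟩)) / 2 := by
  unfold chart
  rw [dif_pos h]
  field_simp

theorem scale_chart_of_notMem {i : Fin n} (h : i ∉ c.free) (y : Fin d → ℝ) :
    2 ^ c.level * c.chart hd y i = c.lo i := by
  have h' : c.lo i = c.hi i := by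
    by_contra hne
    exact h (mem_free.2 hne)
  unfold chart
  rw [dif_neg h, ← h']
  field_simp
  ring

theorem chart_coords {x : Fin n → ℝ} (hx : x ∈ c.carrier) : c.chart hd (c.coords hd x) = x := by
  funext i
  have hp : (2 : ℝ) ^ c.level ≠ 0 := by positivity
  refine mul_left_cancel₀ hp ?_
  by_cases h : i ∈ c.free
  · rw [scale_chart_of_mem hd h]
    unfold coords
    rw [Equiv.symm_apply_apply]
    ring
  · rw [scale_chart_of_notMem hd h]
    have h' : c.lo i = c.hi i := by
      by_contra hne
      exact h (mem_free.2 hne)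
    obtain ⟨h1, h2⟩ := hx i
    rw [← h'] at h2
    exact le_antisymm h1 h2

/-- The edges of the cell have length at most one mesh. -/
def IsGridCell (c : DyadicCell n) : Prop := ∀ i, c.hi i = c.lo i ∨ c.hi i = c.lo i + 1

theorem IsGridCell.hi_eq (hc : c.IsGridCell) {i : Fin n} (h : i ∈ c.free) :
    (c.hi i : ℝ) = c.lo i + 1 := by
  have h1 := mem_free.1 h
  have : c.hi i = c.lo i + 1 := (hc i).resolve_left fun h2 => h1 h2.symm
  exact_mod_cast this

theorem IsGridCell.norm_coords_le (hc : c.IsGridCell) {x : Fin n → ℝ} (hx : x ∈ c.carrier) :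
    ‖c.coords hd x‖ ≤ 1 := by
  refine (pi_norm_le_iff_of_nonneg zero_le_one).2 fun l => ?_
  obtain ⟨h1, h2⟩ := hx ((c.freeEquiv hd).symm l)
  have h3 := hc.hi_eq ((c.freeEquiv hd).symm l).2
  rw [Real.norm_eq_abs, abs_le]
  unfold coords
  constructor <;> linarith

theorem IsGridCell.chart_mem (hc : c.IsGridCell) {y : Fin d → ℝ} (hy : ‖y‖ ≤ 1) :
    c.chart hd y ∈ c.carrier := by
  intro i
  by_cases h : i ∈ c.free
  · rw [scale_chart_of_mem hd h, hc.hi_eq h]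
    have := abs_le.1 ((norm_le_pi_norm y (c.freeEquiv hd ⟨i, h⟩)).trans hy)
    constructor <;> linarith
  · rw [scale_chart_of_notMem hd h]
    have h' : c.lo i = c.hi i := by
      by_contra hne
      exact h (mem_free.2 hne)
    rw [← h']
    exact ⟨le_rfl, le_rfl⟩

/-- The boundary of the cube is mapped to the boundary of the cell. -/
theorem IsGridCell.dyadicCell_chart_ne (hc : c.IsGridCell) {y : Fin d → ℝ} (hy : ‖y‖ = 1) :
    dyadicCell c.level (c.chart hd y) ≠ c := by
  obtain ⟨l, hl⟩ : ∃ l, |y l| = 1 := by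
    by_contra hno
    push Not at hno
    have : ‖y‖ < 1 := (pi_norm_lt_iff one_pos).2 fun l =>
      lt_of_le_of_ne ((norm_le_pi_norm y l).trans hy.le) (hno l)
    exact this.ne hy
  intro heq
  have hfree := ((c.freeEquiv hd).symm l).2
  have hlo : ⌊2 ^ c.level * c.chart hd y ((c.freeEquiv hd).symm l)⌋ =
      c.lo ((c.freeEquiv hd).symm l) := congrFun (congrArg DyadicCell.lo heq) _
  have hhi : ⌈2 ^ c.level * c.chart hd y ((c.freeEquiv hd).symm l)⌉ =
      c.hi ((c.freeEquiv hd).symm l) := congrFun (congrArg DyadicCell.hi heq) _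
  rw [scale_chart_of_mem hd hfree, hc.hi_eq hfree] at hlo hhi
  simp only [Subtype.coe_eta, Equiv.apply_symm_apply] at hlo hhi
  apply mem_free.1 hfree
  rw [← hlo, ← hhi]
  rcases eq_or_eq_neg_of_abs_eq hl with h | h
  · rw [h]
    have : ((c.lo ((c.freeEquiv hd).symm l) : ℝ) + (c.lo ((c.freeEquiv hd).symm l) + 1) + 1) / 2 =
        ((c.lo ((c.freeEquiv hd).symm l) + 1 : ℤ) : ℝ) := by
      push_cast
      ring
    rw [this, Int.floor_intCast, Int.ceil_intCast]
  · rw [h]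
    have : ((c.lo ((c.freeEquiv hd).symm l) : ℝ) + (c.lo ((c.freeEquiv hd).symm l) + 1) + -1) / 2 =
        ((c.lo ((c.freeEquiv hd).symm l) : ℤ) : ℝ) := by
      ring
    rw [this, Int.floor_intCast, Int.ceil_intCast]

/-- A point of a closed cell with coordinates in the open cube lies in the open cell. -/
theorem IsGridCell.dyadicCell_eq (hc : c.IsGridCell) {x : Fin n → ℝ} (hx : x ∈ c.carrier)
    (hlt : ‖c.coords hd x‖ < 1) : dyadicCell c.level x = c := by
  have key : ∀ i, ⌊2 ^ c.level * x i⌋ = c.lo i ∧ ⌈2 ^ c.level * x i⌉ = c.hi i := by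
    intro i
    by_cases h : i ∈ c.free
    · have h1 : |c.coords hd x (c.freeEquiv hd ⟨i, h⟩)| < 1 :=
        (norm_le_pi_norm (c.coords hd x) _).trans_lt hlt
      unfold coords at h1
      rw [Equiv.symm_apply_apply, abs_lt, hc.hi_eq h] at h1
      have h2 : c.hi i = c.lo i + 1 := (hc i).resolve_left fun h2 => mem_free.1 h h2.symm
      rw [Int.floor_eq_iff, Int.ceil_eq_iff, h2]
      push_cast
      obtain ⟨h3, h4⟩ := h1
      refine ⟨⟨?_, ?_⟩, ?_, ?_⟩ <;> linarith
    · have h' : c.lo i = c.hi i := by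
        by_contra hne
        exact h (mem_free.2 hne)
      obtain ⟨h1, h2⟩ := hx i
      rw [← h'] at h2
      rw [le_antisymm h2 h1, ← h', Int.floor_intCast, Int.ceil_intCast]
      exact ⟨rfl, rfl⟩
  exact DyadicCell.ext rfl (funext fun i => (key i).1) (funext fun i => (key i).2)

end DyadicCell

theorem isGridCell_dyadicCell (m : ℕ) (x : Fin n → ℝ) : (dyadicCell m x).IsGridCell := by
  intro i
  rcases floor_ceil_cases (2 ^ m * x i) with ⟨h, -⟩ | ⟨h, -⟩
  · exact Or.inl h.symm
  · exact Or.inr h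

end CellChart

/-! ### Killing a map on the skeleta of the Whitney decomposition -/

section Killing

universe u

variable {n : ℕ} {X : Type u} [TopologicalSpace X] {x₀ : X} {Z : Set (Fin n → ℝ)}

/-- The union of `Z` and of the Whitney cells of dimension less than `d`. -/
def whitneySkeleton (Z : Set (Fin n → ℝ)) (d : ℕ) : Set (Fin n → ℝ) :=
  {x | x ∉ Z → (whitneyCell Z x).dim < d}

/-- The `d`-dimensional cells of the Whitney decomposition. -/
abbrev WhitneyCells (Z : Set (Fin n → ℝ)) (d : ℕ) : Type :=
  {c : DyadicCell n // (∃ x, x ∉ Z ∧ whitneyCell Z x = c) ∧ c.dim = d}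

theorem WhitneyCells.isGridCell {d : ℕ} (c : WhitneyCells Z d) : c.1.IsGridCell := by
  obtain ⟨c, ⟨x, -, rfl⟩, -⟩ := c
  exact isGridCell_dyadicCell _ _

theorem WhitneyCells.notMem {d : ℕ} (hZ : IsClosed Z) (c : WhitneyCells Z d) {y : Fin n → ℝ}
    (hy : y ∈ c.1.carrier) : y ∉ Z := by
  obtain ⟨c, ⟨x, hx, rfl⟩, _⟩ := c
  exact notMem_of_mem_carrier_whitneyCell hZ hx hy

theorem WhitneyCells.eq_or_lt {d : ℕ} (hZ : IsClosed Z) (c : WhitneyCells Z d) {y : Fin n → ℝ}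
    (hy : y ∈ c.1.carrier) : whitneyCell Z y = c.1 ∨ (whitneyCell Z y).dim < d := by
  obtain ⟨c, ⟨x, hx, rfl⟩, rfl⟩ := c
  exact whitneyCell_eq_or_dim_lt hZ hx hy

theorem WhitneyCells.dim_lt_of_norm_eq {d : ℕ} (hZ : IsClosed Z) (c : WhitneyCells Z d)
    {y : Fin d → ℝ} (hy : ‖y‖ = 1) : (whitneyCell Z (c.1.chart c.2.2 y)).dim < d := by
  refine (c.eq_or_lt hZ (c.isGridCell.chart_mem c.2.2 hy.le)).resolve_left fun h => ?_
  refine c.isGridCell.dyadicCell_chart_ne c.2.2 hy ?_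
  have hl : c.1.level = whitneyLevel Z (c.1.chart c.2.2 y) := (congrArg DyadicCell.level h).symm
  rw [hl]
  exact h

theorem WhitneyCells.norm_coords_eq {d : ℕ} (hZ : IsClosed Z) (c : WhitneyCells Z d)
    {y : Fin n → ℝ} (hy : y ∈ c.1.carrier) (hne : whitneyCell Z y ≠ c.1) :
    ‖c.1.coords c.2.2 y‖ = 1 := by
  refine (c.isGridCell.norm_coords_le c.2.2 hy).eq_of_not_lt fun hlt => hne ?_
  have h := c.isGridCell.dyadicCell_eq c.2.2 hy hlt
  obtain ⟨c, ⟨x, hx, rfl⟩, _⟩ := c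
  exact whitneyCell_eq_of_dyadicCell_eq hZ hx h

theorem WhitneyCells.carrier_subset_skeleton {d : ℕ} (hZ : IsClosed Z) (c : WhitneyCells Z d) :
    c.1.carrier ⊆ whitneySkeleton Z (d + 1) := fun y hy _ => by
  rcases c.eq_or_lt hZ hy with h | h
  · rw [h, c.2.2]
    exact d.lt_succ_self
  · exact h.trans d.lt_succ_self

theorem mem_skeleton_of_mem {d : ℕ} {z : Fin n → ℝ} (hz : z ∈ Z) : z ∈ whitneySkeleton Z d :=
  fun h => absurd hz h

theorem whitneySkeleton_mono {d e : ℕ} (h : d ≤ e) :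
    whitneySkeleton Z d ⊆ whitneySkeleton Z e := fun _ hx hz => (hx hz).trans_le h

/-- The prescribed values on the bottom and the sides of the cylinder over a cell: a given map on
the bottom, a homotopy of it on the sides. -/
noncomputable def cellShellMap (α : (Fin n → ℝ) → X) (H : I × (Fin n → ℝ) → X) {d : ℕ}
    (c : WhitneyCells Z d) (p : I × (Fin d → ℝ)) : X :=
  open Classical in
  if p.1 = 0 then α (c.1.chart c.2.2 p.2) else H (p.1, c.1.chart c.2.2 p.2)

/-- `H` is a partial homotopy of `α`: it is constant over `Z`, and it is relevant only over the
union of `Z` and of the cells of dimension less than `d`. -/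
structure IsSkeletonHomotopy (x₀ : X) (α : (Fin n → ℝ) → X) (Z : Set (Fin n → ℝ)) (d : ℕ)
    (H : I × (Fin n → ℝ) → X) : Prop where
  continuousOn : ContinuousOn H (Set.univ ×ˢ whitneySkeleton Z d)
  apply_zero : ∀ x ∈ whitneySkeleton Z d, H (0, x) = α x
  apply_mem : ∀ t, ∀ z ∈ Z, H (t, z) = x₀

theorem IsSkeletonHomotopy.continuousOn_cellShellMap {α : (Fin n → ℝ) → X} (hα : Continuous α)
    (hZ : IsClosed Z) {d : ℕ} {H : I × (Fin n → ℝ) → X} (hH : IsSkeletonHomotopy x₀ α Z d H)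
    (c : WhitneyCells Z d) : ContinuousOn (cellShellMap α H c) (cylinderShell (Fin d → ℝ)) := by
  have hchart := DyadicCell.continuous_chart (c := c.1) c.2.2
  have hcov : cylinderShell (Fin d → ℝ) ⊆
      {p : I × (Fin d → ℝ) | ‖p.2‖ = 1} ∪ {p : I × (Fin d → ℝ) | p.1 = 0} := by
    rintro p (hp | hp)
    · exact Or.inl hp
    · exact Or.inr hp.1
  refine ContinuousOn.mono (ContinuousOn.union_of_isClosed ?_ ?_
    (isClosed_eq (by fun_prop) continuous_const) (isClosed_eq continuous_fst continuous_const)) hcov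
  · have hmaps : Set.MapsTo (fun p : I × (Fin d → ℝ) => (p.1, c.1.chart c.2.2 p.2))
        {p : I × (Fin d → ℝ) | ‖p.2‖ = 1} (Set.univ ×ˢ whitneySkeleton Z d) :=
      fun p hp => ⟨trivial, fun _ => c.dim_lt_of_norm_eq hZ hp⟩
    refine (hH.continuousOn.comp (by fun_prop) hmaps).congr fun p hp => ?_
    simp only [cellShellMap, Function.comp_apply]
    split_ifs with h
    · rw [h, hH.apply_zero _ (hmaps hp).2]
    · rfl
  · refine ContinuousOn.congr (f := fun p => α (c.1.chart c.2.2 p.2)) (by fun_prop) fun p hp => ?_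
    exact if_pos hp

theorem IsSkeletonHomotopy.nullFamily_cellShellMap {α : (Fin n → ℝ) → X} (hα : Continuous α)
    (hZ : IsClosed Z) (hb : Bornology.IsBounded Zᶜ) (hαZ : ∀ z ∈ Z, α z = x₀) {d : ℕ}
    {H : I × (Fin n → ℝ) → X} (hH : IsSkeletonHomotopy x₀ α Z d H) :
    NullFamily x₀ (cylinderShell (Fin d → ℝ)) fun c : WhitneyCells Z d => cellShellMap α H c := by
  intro V hV
  let U : Set (Fin n → ℝ) :=
    interior {x | α x ∈ V ∧ (x ∈ whitneySkeleton Z d → ∀ t, H (t, x) ∈ V)}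
  have hZU : Z ⊆ U := by
    intro z hz
    refine mem_interior_iff_mem_nhds.2 (Filter.inter_mem ?_ ?_)
    · exact hα.continuousAt.eventually_mem (by rw [hαZ z hz]; exact hV)
    · have h : ∀ᶠ x in 𝓝 z, ∀ t ∈ (Set.univ : Set I),
          x ∈ whitneySkeleton Z d → H (t, x) ∈ V := by
        refine isCompact_univ.eventually_forall_of_forall_eventually fun t _ => ?_
        have h1 := hH.continuousOn (t, z) ⟨trivial, mem_skeleton_of_mem hz⟩
        rw [ContinuousWithinAt, hH.apply_mem t z hz] at h1
        have h2 := eventually_nhdsWithin_iff.1 (h1.eventually_mem hV)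
        have h3 : Filter.Tendsto (fun q : (Fin n → ℝ) × I => (q.2, q.1)) (𝓝 (z, t)) (𝓝 (t, z)) :=
          (continuous_snd.prodMk continuous_fst).continuousAt
        filter_upwards [h3.eventually h2] with q hq hqs
        exact hq ⟨trivial, hqs⟩
      filter_upwards [h] with x hx hxs t
      exact hx t trivial hxs
  have hfin := finite_whitneyCell hZ hb isOpen_interior hZU
  refine (hfin.preimage (f := fun c : WhitneyCells Z d => c.1)
    (Subtype.val_injective.injOn)).subset ?_
  rintro c ⟨p, hp, hpV⟩
  refine ⟨c.2.1, c.1.chart c.2.2 p.2, c.isGridCell.chart_mem c.2.2 ?_, fun hU => hpV ?_⟩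
  · rcases hp with hp | hp
    · exact hp.le
    · exact hp.2
  · have hU' := interior_subset hU
    change (if p.1 = 0 then _ else _) ∈ V
    split_ifs with h0
    · exact hU'.1
    · have hp1 : ‖p.2‖ = 1 := hp.resolve_right fun h => h0 h.1
      exact hU'.2 (fun _ => c.dim_lt_of_norm_eq hZ hp1) _

/-- The extension of a homotopy over the skeleton to the cells of the next dimension. -/
noncomputable def glueCells {d : ℕ} (H : I × (Fin n → ℝ) → X)
    (F : WhitneyCells Z d → C(I × (Fin d → ℝ), X)) (p : I × (Fin n → ℝ)) : X :=
  open Classical in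
  if h : p.2 ∉ Z ∧ (whitneyCell Z p.2).dim = d then
    F ⟨whitneyCell Z p.2, ⟨p.2, h.1, rfl⟩, h.2⟩ (p.1, (whitneyCell Z p.2).coords h.2 p.2)
  else H p

theorem glueCells_of_mem {d : ℕ} (H : I × (Fin n → ℝ) → X)
    (F : WhitneyCells Z d → C(I × (Fin d → ℝ), X)) (t : I) {x : Fin n → ℝ}
    (hx : x ∈ whitneySkeleton Z d) : glueCells H F (t, x) = H (t, x) :=
  dif_neg fun h => (hx h.1).ne h.2

theorem glueCells_of_eq {d : ℕ} (H : I × (Fin n → ℝ) → X)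
    (F : WhitneyCells Z d → C(I × (Fin d → ℝ), X)) (t : I) {x : Fin n → ℝ} (hxZ : x ∉ Z)
    (c : WhitneyCells Z d) (hx : whitneyCell Z x = c.1) :
    glueCells H F (t, x) = F c (t, c.1.coords c.2.2 x) := by
  obtain ⟨c, hc1, hc2⟩ := c
  change whitneyCell Z x = c at hx
  subst hx
  exact dif_pos ⟨hxZ, hc2⟩

theorem glueCells_of_mem_carrier {α : (Fin n → ℝ) → X} (hZ : IsClosed Z) {d : ℕ}
    {H : I × (Fin n → ℝ) → X} (hH : IsSkeletonHomotopy x₀ α Z d H)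
    {F : WhitneyCells Z d → C(I × (Fin d → ℝ), X)}
    (hF : ∀ c, ∀ p ∈ cylinderShell (Fin d → ℝ), F c p = cellShellMap α H c p)
    (c : WhitneyCells Z d) (t : I) {x : Fin n → ℝ} (hx : x ∈ c.1.carrier) :
    glueCells H F (t, x) = F c (t, c.1.coords c.2.2 x) := by
  by_cases h : whitneyCell Z x = c.1
  · exact glueCells_of_eq H F t (c.notMem hZ hx) c h
  · have hs : x ∈ whitneySkeleton Z d := fun _ => (c.eq_or_lt hZ hx).resolve_left h
    rw [glueCells_of_mem H F t hs, hF c _ (Or.inl (c.norm_coords_eq hZ hx h))]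
    unfold cellShellMap
    dsimp only
    rw [DyadicCell.chart_coords c.2.2 hx]
    split_ifs with h0
    · rw [h0, hH.apply_zero x hs]
    · rfl

/-- A null family of extensions over the `d`-dimensional cells yields an extension of a homotopy
over the next skeleton. -/
theorem IsSkeletonHomotopy.glueCells {α : (Fin n → ℝ) → X} (hZ : IsClosed Z)
    (hb : Bornology.IsBounded Zᶜ) {d : ℕ}
    {H : I × (Fin n → ℝ) → X} (hH : IsSkeletonHomotopy x₀ α Z d H)
    {F : WhitneyCells Z d → C(I × (Fin d → ℝ), X)}
    (hF : ∀ c, ∀ p ∈ cylinderShell (Fin d → ℝ), F c p = cellShellMap α H c p)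
    (hFn : NullFamily x₀ Set.univ fun c => F c) :
    IsSkeletonHomotopy x₀ α Z (d + 1) (glueCells H F) where
  apply_mem t z hz := by
    rw [glueCells_of_mem H F t (mem_skeleton_of_mem hz), hH.apply_mem t z hz]
  apply_zero x hx := by
    by_cases hs : x ∈ whitneySkeleton Z d
    · rw [glueCells_of_mem H F 0 hs, hH.apply_zero x hs]
    · have hs' := hs
      simp only [whitneySkeleton, Set.mem_ofPred_eq, not_forall, not_lt] at hs
      obtain ⟨hxZ, hdim⟩ := hs
      have hdim' : (whitneyCell Z x).dim = d := le_antisymm (Nat.lt_succ_iff.1 (hx hxZ)) hdim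
      let c : WhitneyCells Z d := ⟨whitneyCell Z x, ⟨x, hxZ, rfl⟩, hdim'⟩
      have hxc : x ∈ c.1.carrier := mem_carrier_whitneyCell x
      rw [glueCells_of_eq H F 0 hxZ c rfl,
        hF c _ (Or.inr ⟨rfl, c.isGridCell.norm_coords_le c.2.2 hxc⟩)]
      unfold cellShellMap
      rw [if_pos rfl, DyadicCell.chart_coords c.2.2 hxc]
  continuousOn := by
    rintro ⟨t, x⟩ ⟨-, hx⟩
    by_cases hxZ : x ∈ Z
    · -- almost all cells are mapped close to the basepoint, the others stay away from `x`
      rw [ContinuousWithinAt, glueCells_of_mem H F t (mem_skeleton_of_mem hxZ),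
        hH.apply_mem t x hxZ]
      intro V hV
      have h1 := hH.continuousOn (t, x) ⟨trivial, mem_skeleton_of_mem hxZ⟩
      rw [ContinuousWithinAt, hH.apply_mem t x hxZ] at h1
      have h2 := eventually_nhdsWithin_iff.1 (h1.eventually_mem hV)
      have h3 : ∀ᶠ y in 𝓝 x, ∀ c ∈ {c | ∃ p ∈ (Set.univ : Set (I × (Fin d → ℝ))), F c p ∉ V},
          y ∉ c.1.carrier := by
        refine (Filter.eventually_all_finite (hFn V hV)).2 fun c _ => ?_
        exact c.1.isClosed_carrier.isOpen_compl.mem_nhds fun hc => c.notMem hZ hc hxZ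
      have h4 : ∀ᶠ p : I × (Fin n → ℝ) in 𝓝 (t, x),
          ∀ c ∈ {c | ∃ p ∈ (Set.univ : Set (I × (Fin d → ℝ))), F c p ∉ V},
          p.2 ∉ c.1.carrier :=
        (continuous_snd.tendsto ((t, x) : I × (Fin n → ℝ))).eventually h3
      refine Filter.mem_map.2 (eventually_nhdsWithin_iff.2 ?_)
      filter_upwards [h2, h4] with p hp2 hp4 hpS
      by_cases hs : p.2 ∈ whitneySkeleton Z d
      · have := hp2 ⟨trivial, hs⟩
        change _root_.glueCells H F (p.1, p.2) ∈ V
        rwa [glueCells_of_mem H F p.1 hs]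
      · simp only [whitneySkeleton, Set.mem_ofPred_eq, not_forall, not_lt] at hs
        obtain ⟨hpZ, hdim⟩ := hs
        have hdim' : (whitneyCell Z p.2).dim = d :=
          le_antisymm (Nat.lt_succ_iff.1 (hpS.2 hpZ)) hdim
        let c : WhitneyCells Z d := ⟨whitneyCell Z p.2, ⟨p.2, hpZ, rfl⟩, hdim'⟩
        change _root_.glueCells H F (p.1, p.2) ∈ V
        rw [glueCells_of_eq H F p.1 hpZ c rfl]
        by_contra hc
        exact hp4 c ⟨_, trivial, hc⟩ (mem_carrier_whitneyCell p.2)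
    · -- near `x` the skeleton is a finite union of closed cells
      obtain ⟨ε, hε, hball⟩ := Metric.nhds_basis_closedBall.mem_iff.1
        (hZ.isOpen_compl.mem_nhds hxZ)
      have hfin := finite_whitneyCell hZ hb (Metric.isClosed_closedBall (x := x) (ε := ε)).isOpen_compl
        (fun z hz hzb => hball hzb hz)
      have hcov : (⋃ c ∈ {c : DyadicCell n | (∃ x, x ∉ Z ∧ whitneyCell Z x = c) ∧
          ∃ y ∈ c.carrier, y ∉ (Metric.closedBall x ε)ᶜ},
          ((Set.univ : Set I) ×ˢ {y | y ∈ c.carrier ∧ c.dim < d + 1})) ∈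
          𝓝[Set.univ ×ˢ whitneySkeleton Z (d + 1)] (t, x) := by
        have h1 : ∀ᶠ p : I × (Fin n → ℝ) in 𝓝 (t, x), p.2 ∈ Metric.closedBall x ε :=
          (continuous_snd.tendsto ((t, x) : I × (Fin n → ℝ))).eventually
            (Metric.closedBall_mem_nhds x hε)
        refine eventually_nhdsWithin_iff.2 ?_
        filter_upwards [h1] with p hp hpS
        have hpZ : p.2 ∉ Z := hball hp
        exact Set.mem_biUnion (x := whitneyCell Z p.2)
          ⟨⟨p.2, hpZ, rfl⟩, p.2, mem_carrier_whitneyCell p.2, not_not_intro hp⟩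
          ⟨trivial, mem_carrier_whitneyCell p.2, hpS.2 hpZ⟩
      refine ContinuousWithinAt.mono_of_mem_nhdsWithin ?_ hcov
      rw [ContinuousWithinAt, nhdsWithin_biUnion hfin]
      refine Filter.tendsto_iSup.2 fun c => Filter.tendsto_iSup.2 fun hc => ?_
      by_cases hcd : c.dim < d + 1
      · have hset : {y | y ∈ c.carrier ∧ c.dim < d + 1} = c.carrier :=
          Set.ext fun y => and_iff_left hcd
        rw [hset]
        by_cases hxc : x ∈ c.carrier
        · refine ContinuousOn.continuousWithinAt ?_ (⟨trivial, hxc⟩ : (t, x) ∈ Set.univ ×ˢ c.carrier)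
          rcases (Nat.lt_succ_iff.1 hcd).eq_or_lt with hcd' | hcd'
          · let c' : WhitneyCells Z d := ⟨c, hc.1, hcd'⟩
            have hcoords := DyadicCell.continuous_coords (c := c'.1) c'.2.2
            refine ContinuousOn.congr (f := fun p => F c' (p.1, c'.1.coords c'.2.2 p.2))
              (by fun_prop) fun p hp => ?_
            exact glueCells_of_mem_carrier hZ hH hF c' p.1 hp.2
          · obtain ⟨c', hc', hdim⟩ : ∃ c' : WhitneyCells Z c.dim, c'.1 = c ∧ c.dim + 1 ≤ d :=
              ⟨⟨c, hc.1, rfl⟩, rfl, hcd'⟩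
            have hsub : c.carrier ⊆ whitneySkeleton Z d := by
              rw [← hc']
              exact (c'.carrier_subset_skeleton hZ).trans (whitneySkeleton_mono hdim)
            refine (hH.continuousOn.mono (Set.prod_mono_right hsub)).congr fun p hp => ?_
            exact glueCells_of_mem H F p.1 (hsub hp.2)
        · refine continuousWithinAt_of_notMem_closure ?_
          rw [(isClosed_univ.prod c.isClosed_carrier).closure_eq]
          exact fun h => hxc h.2
      · have hset : {y | y ∈ c.carrier ∧ c.dim < d + 1} = ∅ :=
          Set.eq_empty_of_forall_notMem fun y hy => hcd hy.2
        rw [hset, Set.prod_empty, nhdsWithin_empty]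
        exact Filter.tendsto_bot

/-- In a sequentially `m`-connected space, a map can be contracted on the `m`-skeleton of the
Whitney decomposition of its support. -/
theorem SequentiallyConnectedAt.exists_skeleton_contraction {m : ℕ}
    (hX : SequentiallyConnectedAt m X x₀) {α : (Fin n → ℝ) → X} (hα : Continuous α)
    (hZ : IsClosed Z) (hb : Bornology.IsBounded Zᶜ) (hαZ : ∀ z ∈ Z, α z = x₀) (d : ℕ)
    (hd : d ≤ m + 1) : ∃ H, IsSkeletonHomotopy x₀ α Z d H ∧
      ∀ x ∈ whitneySkeleton Z d, H (1, x) = x₀ := by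
  induction d with
  | zero =>
    have hs : ∀ x ∈ whitneySkeleton Z 0, x ∈ Z := fun x hx => by
      by_contra h
      exact Nat.not_lt_zero _ (hx h)
    exact ⟨fun _ => x₀, ⟨continuousOn_const, fun x hx => (hαZ x (hs x hx)).symm,
      fun _ _ _ => rfl⟩, fun _ _ => rfl⟩
  | succ d ih =>
    obtain ⟨H, hH, hH1⟩ := ih (by omega)
    obtain ⟨F, hF, hF1, hFn⟩ := hX.exists_fill_of_shell (by omega : d ≤ m)
      (fun c : WhitneyCells Z d => cellShellMap α H c)
      (fun c => hH.continuousOn_cellShellMap hα hZ c)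
      (fun c y hy => by
        unfold cellShellMap
        rw [if_neg one_ne_zero]
        exact hH1 _ fun _ => c.dim_lt_of_norm_eq hZ hy)
      (hH.nullFamily_cellShellMap hα hZ hb hαZ)
    refine ⟨glueCells H F, hH.glueCells hZ hb hF hFn, fun x hx => ?_⟩
    by_cases hs : x ∈ whitneySkeleton Z d
    · rw [glueCells_of_mem H F 1 hs, hH1 x hs]
    · simp only [whitneySkeleton, Set.mem_ofPred_eq, not_forall, not_lt] at hs
      obtain ⟨hxZ, hdim⟩ := hs
      have hdim' : (whitneyCell Z x).dim = d := le_antisymm (Nat.lt_succ_iff.1 (hx hxZ)) hdim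
      rw [glueCells_of_eq H F 1 hxZ ⟨whitneyCell Z x, ⟨x, hxZ, rfl⟩, hdim'⟩ rfl, hF1]

/-- A map of bounded support into a sequentially `(n - 1)`-connected space is homotopic, relative
to its zero set, to a map that is supported in the interiors of a family of dyadic cubes contained
in the support of the given map. -/
theorem SequentiallyConnectedAt.exists_dyadic_homotopy
    (hX : SequentiallyConnectedAt (n - 1) X x₀) (hn : 1 ≤ n) (hx₀ : IsClosed {x₀})
    {α : (Fin n → ℝ) → X} (hα : Continuous α) (hb : Bornology.IsBounded {x | α x ≠ x₀}) :
    ∃ K : C(I × (Fin n → ℝ), X), (∀ x, K (0, x) = α x) ∧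
      (∀ t x, α x = x₀ → K (t, x) = x₀) ∧
      ∀ x, K (1, x) ≠ x₀ → ∃ m : ℕ, (∀ i, ⌊2 ^ m * x i⌋ ≠ ⌈2 ^ m * x i⌉) ∧
        ∀ y ∈ (dyadicCell m x).carrier, α y ≠ x₀ := by
  let Z : Set (Fin n → ℝ) := {x | α x = x₀}
  have hZ : IsClosed Z := hx₀.preimage hα
  obtain ⟨H, hH, hH1⟩ := hX.exists_skeleton_contraction hα hZ hb (fun z hz => hz) n (by omega)
  -- over the cells of the top dimension the homotopy is extended, but nothing is contracted
  obtain ⟨F, hF, -, hFn⟩ := exists_extension_of_shell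
    (fun c : WhitneyCells Z n => cellShellMap α H c)
    (fun c => hH.continuousOn_cellShellMap hα hZ c)
    (hH.nullFamily_cellShellMap hα hZ hb fun z hz => hz)
  have hG := hH.glueCells hZ hb hF hFn
  have huniv : ∀ x, x ∈ whitneySkeleton Z (n + 1) := fun x _ =>
    Nat.lt_succ_iff.2 (DyadicCell.dim_le _)
  refine ⟨⟨glueCells H F, ?_⟩, fun x => hG.apply_zero x (huniv x), hG.apply_mem, fun x hx => ?_⟩
  · rw [← continuousOn_univ]
    exact hG.continuousOn.mono fun p _ => ⟨trivial, huniv _⟩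
  · change glueCells H F (1, x) ≠ x₀ at hx
    have hs : x ∉ whitneySkeleton Z n := fun hs => hx (by
      rw [glueCells_of_mem H F 1 hs, hH1 x hs])
    simp only [whitneySkeleton, Set.mem_ofPred_eq, not_forall, not_lt] at hs
    obtain ⟨hxZ, hdim⟩ := hs
    refine ⟨whitneyLevel Z x, fun i => ?_, fun y hy =>
      notMem_of_mem_carrier_whitneyCell hZ hxZ hy⟩
    have hfree : (whitneyCell Z x).free = Finset.univ :=
      (Finset.card_eq_iff_eq_univ _).1
        ((le_antisymm (DyadicCell.dim_le _) hdim).trans (Fintype.card_fin n).symm)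
    exact DyadicCell.mem_free.1 (hfree ▸ Finset.mem_univ i)

end Killing

/-! ### Loops supported in dyadic cubes -/

section DyadicLoops

universe u

variable {n : ℕ} {A : ℕ → Type u} [∀ j, TopologicalSpace (A j)] {a : ∀ j, A j}

/-- A map of the cube to the shrinking wedge is dyadic if each point outside the preimage of the
wedge point lies in the interior of a dyadic cube that is mapped into a single summand. -/
def IsDyadicMap (f : (Fin n → I) → ShrinkingWedge a) : Prop :=
  ∀ j x, ShrinkingWedge.retr a j (f x) ≠ a j → ∃ m : ℕ,
    (∀ i, ⌊(2 : ℝ) ^ m * x i⌋ ≠ ⌈(2 : ℝ) ^ m * x i⌉) ∧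
    ∀ y : Fin n → I, (fun i => (y i : ℝ)) ∈ (dyadicCell m fun i => (x i : ℝ)).carrier →
      ∀ k, k ≠ j → ShrinkingWedge.retr a k (f y) = a k

/-- The projection of `ℝⁿ` onto the unit cube. -/
noncomputable def cubeProj (x : Fin n → ℝ) : Fin n → I :=
  fun i => Set.projIcc 0 1 zero_le_one (x i)

theorem continuous_cubeProj : Continuous (cubeProj : (Fin n → ℝ) → Fin n → I) :=
  continuous_pi fun i => continuous_projIcc.comp (continuous_apply i)

theorem cubeProj_coe (x : Fin n → I) : cubeProj (fun i => (x i : ℝ)) = x :=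
  funext fun i => Set.projIcc_val _ (x i)

theorem isBounded_of_cubeProj {s : Set (Fin n → ℝ)}
    (hs : ∀ x ∈ s, cubeProj x ∉ Cube.boundary (Fin n)) : Bornology.IsBounded s := by
  refine (Metric.isBounded_Icc (0 : Fin n → ℝ) 1).subset fun x hx => ?_
  have h := hs x hx
  constructor
  · intro i
    by_contra hc
    exact h ⟨i, Or.inl (Set.projIcc_of_le_left _ (not_le.1 hc).le)⟩
  · intro i
    by_contra hc
    exact h ⟨i, Or.inr (Set.projIcc_of_right_le _ (not_le.1 hc).le)⟩

/-- The coordinates of a loop have disjoint supports, so homotopies that do not enlarge the supports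
can be applied to all of them at the same time. -/
theorem GenLoop.exists_homotopic_isDyadicMap [∀ j, T1Space (A j)] (hn : 1 ≤ n)
    (hA : ∀ j, SequentiallyConnectedAt (n - 1) (A j) (a j))
    (f : GenLoop (Fin n) (ShrinkingWedge a) (ShrinkingWedge.base a)) :
    ∃ g : GenLoop (Fin n) (ShrinkingWedge a) (ShrinkingWedge.base a),
      GenLoop.Homotopic f g ∧ IsDyadicMap g := by
  have hα : ∀ j, Continuous fun x : Fin n → ℝ => ShrinkingWedge.retr a j (f (cubeProj x)) :=
    fun j => (ShrinkingWedge.retr a j).continuous.comp (f.1.continuous.comp continuous_cubeProj)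
  have hne : ∀ j y, ShrinkingWedge.retr a j (f y) ≠ a j → y ∉ Cube.boundary (Fin n) := by
    intro j y hy hb
    apply hy
    rw [GenLoop.boundary f y hb, ShrinkingWedge.retr_base]
  choose K hK0 hKr hK1 using fun j => (hA j).exists_dyadic_homotopy hn isClosed_singleton (hα j)
    (isBounded_of_cubeProj fun x hx => hne j _ hx)
  have hcoe : Continuous fun x : Fin n → I => fun i => (x i : ℝ) := by fun_prop
  let h : ∀ j, C(I × (Fin n → I), A j) := fun j =>
    (K j).comp ((ContinuousMap.id I).prodMap ⟨_, hcoe⟩)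
  have hsupp : ∀ j t x, h j (t, x) ≠ a j → ShrinkingWedge.retr a j (f x) ≠ a j := by
    intro j t x hx hf
    refine hx (hKr j t _ ?_)
    change ShrinkingWedge.retr a j (f (cubeProj fun i => (x i : ℝ))) = a j
    rwa [cubeProj_coe]
  have hdisj : ∀ p i j, h i p ≠ a i → h j p ≠ a j → i = j := fun p i j hi hj =>
    ShrinkingWedge.eq_of_retr_ne (hsupp i p.1 p.2 hi) (hsupp j p.1 p.2 hj)
  have hbdry : ∀ t, ∀ y ∈ Cube.boundary (Fin n),
      ShrinkingWedge.ofFamily h hdisj (t, y) = ShrinkingWedge.base a := by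
    intro t y hy
    refine ShrinkingWedge.eq_base_of_retr_eq fun j => ?_
    rw [ShrinkingWedge.retr_ofFamily]
    by_contra hc
    exact hne j y (hsupp j t y hc) hy
  refine ⟨⟨(ShrinkingWedge.ofFamily h hdisj).comp ⟨fun y => (1, y), by fun_prop⟩, hbdry 1⟩,
    GenLoop.homotopic_of_map (ShrinkingWedge.ofFamily h hdisj) (fun y => ?_) (fun y => rfl) hbdry,
    fun j x hx => ?_⟩
  · refine ShrinkingWedge.ext_retr fun j => ?_
    rw [ShrinkingWedge.retr_ofFamily]
    refine (hK0 j _).trans ?_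
    change ShrinkingWedge.retr a j (f (cubeProj fun i => (y i : ℝ))) = _
    rw [cubeProj_coe]
  · change ShrinkingWedge.retr a j (ShrinkingWedge.ofFamily h hdisj (1, x)) ≠ a j at hx
    rw [ShrinkingWedge.retr_ofFamily] at hx
    obtain ⟨m, hm, hcar⟩ := hK1 j _ hx
    refine ⟨m, hm, fun y hy k hk => ?_⟩
    change ShrinkingWedge.retr a k (ShrinkingWedge.ofFamily h hdisj (1, y)) = a k
    rw [ShrinkingWedge.retr_ofFamily]
    by_contra hc
    have h1 := hcar _ hy
    change ShrinkingWedge.retr a j (f (cubeProj fun i => (y i : ℝ))) ≠ a j at h1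
    rw [cubeProj_coe] at h1
    exact hk (ShrinkingWedge.eq_of_retr_ne (hsupp k 1 y hc) h1)

end DyadicLoops

/-! ### Infinite concatenation of homotopies -/

section InfiniteHomotopy

universe u

variable {n : ℕ} {A : ℕ → Type u} [∀ j, TopologicalSpace (A j)] {a : ∀ j, A j}

/-- `F` and `G` are homotopic relative to the boundary of the cube, by a homotopy whose `j`-th
coordinate at any point `x` takes only values that the `j`-th coordinate of `f` takes near `x`:
within distance `c i` in the direction of the `i`-th coordinate axis. -/
def ControlledHomotopic (c : Fin n → ℝ) (f F G : (Fin n → I) → ShrinkingWedge a) : Prop :=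
  ∃ H : C(I × (Fin n → I), ShrinkingWedge a), (∀ x, H (0, x) = F x) ∧ (∀ x, H (1, x) = G x) ∧
    (∀ t, ∀ x ∈ Cube.boundary (Fin n), H (t, x) = ShrinkingWedge.base a) ∧
    ∀ t x j, ∃ y : Fin n → I, (∀ i, |(x i : ℝ) - y i| ≤ c i) ∧
      ShrinkingWedge.retr a j (H (t, x)) = ShrinkingWedge.retr a j (f y)

/-- The partial concatenations of a sequence of homotopies: the first `M` of them are run
through, the `m`-th one on the `m`-th slot of the time interval. -/
noncomputable def partialConcat (F : (Fin n → I) → ShrinkingWedge a)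
    (H : ℕ → C(I × (Fin n → I), ShrinkingWedge a)) : ℕ → I × (Fin n → I) → ShrinkingWedge a
  | 0, p => F p.2
  | M + 1, p => open Classical in
      if (p.1 : ℝ) ≤ 1 - 1 / 2 ^ M then partialConcat F H M p else H M (slotCoord M p.1, p.2)

theorem slotCoord_of_le {M : ℕ} {t : I} (h : (t : ℝ) ≤ 1 - 1 / 2 ^ M) : slotCoord M t = 0 := by
  refine Set.projIcc_of_le_left _ ?_
  have hp : (0 : ℝ) < 2 ^ M := by positivity
  have : (2 : ℝ) ^ M * t ≤ 2 ^ M - 1 := by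
    calc (2 : ℝ) ^ M * t ≤ 2 ^ M * (1 - 1 / 2 ^ M) := mul_le_mul_of_nonneg_left h hp.le
      _ = 2 ^ M - 1 := by field_simp
  rw [pow_succ]
  nlinarith

theorem slotCoord_of_ge {M : ℕ} {t : I} (h : 1 - 1 / 2 ^ (M + 1) ≤ (t : ℝ)) :
    slotCoord M t = 1 := by
  refine Set.projIcc_of_right_le _ ?_
  have hp : (0 : ℝ) < 2 ^ (M + 1) := by positivity
  have : (2 : ℝ) ^ (M + 1) - 1 ≤ 2 ^ (M + 1) * t := by
    calc (2 : ℝ) ^ (M + 1) - 1 = 2 ^ (M + 1) * (1 - 1 / 2 ^ (M + 1)) := by field_simp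
      _ ≤ 2 ^ (M + 1) * t := mul_le_mul_of_nonneg_left h hp.le
  linarith

theorem one_sub_one_div_pow_mono {M N : ℕ} (h : M ≤ N) :
    (1 : ℝ) - 1 / 2 ^ M ≤ 1 - 1 / 2 ^ N := by
  have : (1 : ℝ) / 2 ^ N ≤ 1 / 2 ^ M :=
    one_div_le_one_div_of_le (by positivity) (pow_le_pow_right₀ (by norm_num) h)
  linarith

section

variable {F : ℕ → (Fin n → I) → ShrinkingWedge a} {H : ℕ → C(I × (Fin n → I), ShrinkingWedge a)}

theorem partialConcat_of_ge (h1 : ∀ m x, H m (1, x) = F (m + 1) x) (M : ℕ) {t : I}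
    (ht : 1 - 1 / 2 ^ M ≤ (t : ℝ)) (x : Fin n → I) : partialConcat (F 0) H M (t, x) = F M x := by
  cases M with
  | zero => rfl
  | succ M =>
    have hlt : (1 : ℝ) - 1 / 2 ^ M < t := by
      refine lt_of_lt_of_le ?_ ht
      have : (1 : ℝ) / 2 ^ (M + 1) < 1 / 2 ^ M :=
        one_div_lt_one_div_of_lt (by positivity) (pow_lt_pow_right₀ (by norm_num) M.lt_succ_self)
      linarith
    rw [partialConcat, if_neg (not_le.2 hlt)]
    dsimp only
    rw [slotCoord_of_ge ht, h1]

theorem continuous_partialConcat (hF : Continuous (F 0)) (h0 : ∀ m x, H m (0, x) = F m x)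
    (h1 : ∀ m x, H m (1, x) = F (m + 1) x) (M : ℕ) : Continuous (partialConcat (F 0) H M) := by
  induction M with
  | zero => exact hF.comp continuous_snd
  | succ M ih =>
    have hs := continuous_slotCoord M
    refine Continuous.if_le ih ((H M).continuous.comp (by fun_prop)) (by fun_prop)
      continuous_const fun p hp => ?_
    rw [← Prod.mk.eta (p := p), partialConcat_of_ge h1 M hp.ge]
    dsimp only
    rw [slotCoord_of_le hp.le, h0]

theorem partialConcat_of_le {M N : ℕ} (hMN : M ≤ N) {t : I} (ht : (t : ℝ) ≤ 1 - 1 / 2 ^ M)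
    (x : Fin n → I) : partialConcat (F 0) H N (t, x) = partialConcat (F 0) H M (t, x) := by
  induction N, hMN using Nat.le_induction with
  | base => rfl
  | succ N hN ih =>
    rw [partialConcat, if_pos (ht.trans (one_sub_one_div_pow_mono hN)), ih]

theorem exists_partialConcat_eq (h0 : ∀ m x, H m (0, x) = F m x)
    (h1 : ∀ m x, H m (1, x) = F (m + 1) x) {M N : ℕ} (hMN : M ≤ N) {t : I}
    (ht : 1 - 1 / 2 ^ M ≤ (t : ℝ)) (x : Fin n → I) :
    ∃ m, M ≤ m ∧ ∃ s, partialConcat (F 0) H N (t, x) = H m (s, x) := by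
  induction N, hMN using Nat.le_induction with
  | base => exact ⟨M, le_rfl, 0, (partialConcat_of_ge h1 M ht x).trans (h0 M x).symm⟩
  | succ N hN ih =>
    rw [partialConcat]
    split_ifs
    · exact ih
    · exact ⟨N, hN, _, rfl⟩

end

/-- If consecutive members of a sequence of loops are homotopic by homotopies controlled by a loop
`f`, and the control becomes arbitrarily small, then all of them are homotopic to `f`. -/
theorem GenLoop.homotopic_of_controlledHomotopic [∀ j, T1Space (A j)]
    {f g : GenLoop (Fin n) (ShrinkingWedge a) (ShrinkingWedge.base a)}
    {F : ℕ → (Fin n → I) → ShrinkingWedge a} {c : ℕ → Fin n → ℝ}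
    (hc : ∀ δ > 0, ∃ M, ∀ m ≥ M, ∀ i, c m i < δ) (hg : F 0 = g)
    (hF : ∀ m, ControlledHomotopic (c m) f (F m) (F (m + 1))) : GenLoop.Homotopic g f := by
  choose H h0 h1 hb hctl using hF
  have hF0 : Continuous (F 0) := hg ▸ g.1.continuous
  have hex : ∀ t : I, t ≠ 1 → ∃ M : ℕ, (t : ℝ) < 1 - 1 / 2 ^ M := by
    intro t ht
    have ht' : (t : ℝ) < 1 := lt_of_le_of_ne t.2.2 fun h => ht (Subtype.ext h)
    obtain ⟨M, hM⟩ := exists_pow_lt_of_lt_one (sub_pos.2 ht') (by norm_num : (1 / 2 : ℝ) < 1)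
    refine ⟨M, ?_⟩
    rw [← one_div_pow]
    linarith
  classical
  let G : I × (Fin n → I) → ShrinkingWedge a := fun p =>
    if h : p.1 = 1 then f p.2 else partialConcat (F 0) H (hex p.1 h).choose p
  have hG1 : ∀ x, G (1, x) = f x := fun x => dif_pos rfl
  have hG : ∀ M (t : I) x, (t : ℝ) < 1 - 1 / 2 ^ M → G (t, x) = partialConcat (F 0) H M (t, x) := by
    intro M t x ht
    have ht1 : t ≠ 1 := by
      rintro rfl
      have : (0 : ℝ) < 1 / 2 ^ M := by positivity
      rw [Set.Icc.coe_one] at ht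
      linarith
    have h2 := (hex t ht1).choose_spec
    change dite _ _ _ = _
    rw [dif_neg ht1]
    rcases le_total M (hex t ht1).choose with h | h
    · exact partialConcat_of_le h ht.le x
    · exact (partialConcat_of_le h h2.le x).symm
  have hGc : Continuous G := by
    refine ShrinkingWedge.continuous_of_retr fun j => continuous_iff_continuousAt.2 ?_
    rintro ⟨t, x⟩
    by_cases ht : t = 1
    · -- close to time `1` the coordinate takes values of the coordinate of `f` at nearby points
      subst ht
      rw [ContinuousAt, hG1]
      intro V hV
      have hfc : ContinuousAt (fun y => ShrinkingWedge.retr a j (f y)) x :=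
        ((ShrinkingWedge.retr a j).continuous.comp f.1.continuous).continuousAt
      obtain ⟨δ, hδ, hball⟩ := Metric.mem_nhds_iff.1 (hfc.preimage_mem_nhds hV)
      obtain ⟨M, hM⟩ := hc (δ / 2) (by positivity)
      have hnear : ∀ᶠ p : I × (Fin n → I) in 𝓝 ((1 : I), x), 1 - 1 / 2 ^ M < (p.1 : ℝ) :=
        (isOpen_lt continuous_const (by fun_prop)).mem_nhds (by
          change (1 : ℝ) - 1 / 2 ^ M < ((1 : I) : ℝ)
          have : (0 : ℝ) < 1 / 2 ^ M := by positivity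
          rw [Set.Icc.coe_one]
          linarith)
      have hnear' : ∀ᶠ p : I × (Fin n → I) in 𝓝 ((1 : I), x), p.2 ∈ Metric.ball x (δ / 2) :=
        (continuous_snd.tendsto ((1 : I), x)).eventually (Metric.ball_mem_nhds x (by positivity))
      refine Filter.mem_map.2 ?_
      filter_upwards [hnear, hnear'] with p hp1 hp2
      change ShrinkingWedge.retr a j (G (p.1, p.2)) ∈ V
      by_cases hp : p.1 = 1
      · rw [hp, hG1]
        exact hball (Metric.ball_subset_ball (by linarith) hp2)
      · obtain ⟨N, hN⟩ := hex p.1 hp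
        have hN' : (p.1 : ℝ) < 1 - 1 / 2 ^ max M N :=
          hN.trans_le (one_sub_one_div_pow_mono (le_max_right M N))
        rw [hG _ p.1 p.2 hN']
        obtain ⟨m, hm, s, hs⟩ := exists_partialConcat_eq h0 h1 (le_max_left M N) hp1.le p.2
        obtain ⟨y, hy, hyj⟩ := hctl m s p.2 j
        rw [hs, hyj]
        refine hball (?_ : y ∈ Metric.ball x δ)
        have hyp : dist y p.2 < δ / 2 := by
          rw [dist_pi_lt_iff (by positivity)]
          intro i
          rw [dist_comm, Subtype.dist_eq, Real.dist_eq]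
          exact (hy i).trans_lt (hM m hm i)
        have hpx : dist p.2 x < δ / 2 := hp2
        rw [Metric.mem_ball]
        linarith [dist_triangle y p.2 x]
    · obtain ⟨M, hM⟩ := hex t ht
      have hnear : ∀ᶠ p : I × (Fin n → I) in 𝓝 (t, x), (p.1 : ℝ) < 1 - 1 / 2 ^ M :=
        (isOpen_lt (by fun_prop) continuous_const).mem_nhds hM
      refine ((ShrinkingWedge.retr a j).continuous.comp
        (continuous_partialConcat hF0 h0 h1 M)).continuousAt.congr ?_
      filter_upwards [hnear] with p hp
      exact congrArg (ShrinkingWedge.retr a j) (hG M p.1 p.2 hp).symm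
  refine GenLoop.homotopic_of_map ⟨G, hGc⟩ (fun x => ?_) hG1 fun t x hx => ?_
  · change G (0, x) = g x
    rw [hG 1 0 x (by norm_num), ← hg]
    exact partialConcat_of_le (Nat.zero_le 1) (by simp) x
  · change G (t, x) = _
    by_cases ht : t = 1
    · rw [ht, hG1]
      exact f.2 x hx
    · obtain ⟨M, hM⟩ := hex t ht
      rw [hG M t x hM]
      obtain ⟨m, -, s, hs⟩ := exists_partialConcat_eq h0 h1 (Nat.zero_le M) (t := t)
        (by simpa using t.2.1) x
      rw [hs, hb m s x hx]

end InfiniteHomotopy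

/-! ### Bisection of the cube -/

section Bisection

universe u w

variable {N : Type w} [DecidableEq N]

/-- The affine map of the cube onto its lower half in the direction of the `k`-th coordinate. -/
noncomputable def lowerHalf (k : N) : C(N → I, N → I) where
  toFun x := Function.update x k ⟨(x k : ℝ) / 2, by linarith [(x k).2.1], by linarith [(x k).2.2]⟩
  continuous_toFun := continuous_id.update k (Continuous.subtype_mk (by fun_prop) _)

/-- The affine map of the cube onto its upper half in the direction of the `k`-th coordinate. -/
noncomputable def upperHalf (k : N) : C(N → I, N → I) where
  toFun x := Function.update x k
    ⟨(1 + (x k : ℝ)) / 2, by linarith [(x k).2.1], by linarith [(x k).2.2]⟩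
  continuous_toFun := continuous_id.update k (Continuous.subtype_mk (by fun_prop) _)

theorem lowerHalf_apply_self (k : N) (x : N → I) : (lowerHalf k x k : ℝ) = x k / 2 := by
  simp [lowerHalf]

theorem upperHalf_apply_self (k : N) (x : N → I) : (upperHalf k x k : ℝ) = (1 + x k) / 2 := by
  simp [upperHalf]

theorem lowerHalf_apply_of_ne {i k : N} (h : i ≠ k) (x : N → I) : lowerHalf k x i = x i := by
  simp [lowerHalf, h]

theorem upperHalf_apply_of_ne {i k : N} (h : i ≠ k) (x : N → I) : upperHalf k x i = x i := by
  simp [upperHalf, h]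

/-- The map of the cube that stretches its lower half in the direction of the `k`-th coordinate
over the whole cube. -/
noncomputable def stretchLower (k : N) : C(N → I, N → I) where
  toFun x := Function.update x k (Set.projIcc 0 1 zero_le_one (2 * (x k : ℝ)))
  continuous_toFun := continuous_id.update k (continuous_projIcc.comp (by fun_prop))

/-- The map of the cube that stretches its upper half in the direction of the `k`-th coordinate
over the whole cube. -/
noncomputable def stretchUpper (k : N) : C(N → I, N → I) where
  toFun x := Function.update x k (Set.projIcc 0 1 zero_le_one (2 * (x k : ℝ) - 1))
  continuous_toFun := continuous_id.update k (continuous_projIcc.comp (by fun_prop))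

theorem stretchLower_apply_of_ne {i k : N} (h : i ≠ k) (x : N → I) :
    stretchLower k x i = x i := by
  simp [stretchLower, h]

theorem stretchUpper_apply_of_ne {i k : N} (h : i ≠ k) (x : N → I) :
    stretchUpper k x i = x i := by
  simp [stretchUpper, h]

theorem stretchLower_apply_self {k : N} {x : N → I} (h : (x k : ℝ) ≤ 1 / 2) :
    (stretchLower k x k : ℝ) = 2 * x k := by
  have h0 := (x k).2.1
  simp only [stretchLower, ContinuousMap.coe_mk, Function.update_self, Set.coe_projIcc]
  rw [min_eq_right (by linarith), max_eq_right (by linarith)]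

theorem stretchUpper_apply_self {k : N} {x : N → I} (h : 1 / 2 ≤ (x k : ℝ)) :
    (stretchUpper k x k : ℝ) = 2 * x k - 1 := by
  have h0 := (x k).2.2
  simp only [stretchUpper, ContinuousMap.coe_mk, Function.update_self, Set.coe_projIcc]
  rw [min_eq_right (by linarith), max_eq_right (by linarith)]

theorem lowerHalf_stretchLower {k : N} {x : N → I} (h : (x k : ℝ) ≤ 1 / 2) :
    lowerHalf k (stretchLower k x) = x := by
  funext i
  by_cases hi : i = k
  · subst hi
    refine Subtype.ext ?_
    rw [lowerHalf_apply_self, stretchLower_apply_self h]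
    ring
  · rw [lowerHalf_apply_of_ne hi, stretchLower_apply_of_ne hi]

theorem upperHalf_stretchUpper {k : N} {x : N → I} (h : 1 / 2 ≤ (x k : ℝ)) :
    upperHalf k (stretchUpper k x) = x := by
  funext i
  by_cases hi : i = k
  · subst hi
    refine Subtype.ext ?_
    rw [upperHalf_apply_self, stretchUpper_apply_self h]
    ring
  · rw [upperHalf_apply_of_ne hi, stretchUpper_apply_of_ne hi]

theorem stretchLower_mem_boundary {k : N} {x : N → I} (hx : x ∈ Cube.boundary N)
    (h : (x k : ℝ) ≤ 1 / 2) : stretchLower k x ∈ Cube.boundary N := by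
  obtain ⟨i, hi⟩ := hx
  refine ⟨i, ?_⟩
  by_cases hik : i = k
  · subst hik
    rcases hi with hi | hi
    · left
      refine Subtype.ext ?_
      rw [stretchLower_apply_self h, hi]
      simp
    · rw [hi, Set.Icc.coe_one] at h
      norm_num at h
  · rwa [stretchLower_apply_of_ne hik]

theorem stretchUpper_mem_boundary {k : N} {x : N → I} (hx : x ∈ Cube.boundary N)
    (h : 1 / 2 ≤ (x k : ℝ)) : stretchUpper k x ∈ Cube.boundary N := by
  obtain ⟨i, hi⟩ := hx
  refine ⟨i, ?_⟩
  by_cases hik : i = k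
  · subst hik
    rcases hi with hi | hi
    · rw [hi, Set.Icc.coe_zero] at h
      norm_num at h
    · right
      refine Subtype.ext ?_
      rw [stretchUpper_apply_self h, hi]
      norm_num
  · rwa [stretchUpper_apply_of_ne hik]

/-- The map of the cube that is `g₀` on its lower half and `g₁` on its upper half in the direction
of the `k`-th coordinate. -/
noncomputable def glueHalves {X : Type u} (k : N) (g₀ g₁ : (N → I) → X) (x : N → I) : X :=
  open Classical in if (x k : ℝ) ≤ 1 / 2 then g₀ (stretchLower k x) else g₁ (stretchUpper k x)

theorem GenLoop.transAt_eq_glueHalves {X : Type u} [TopologicalSpace X] {x : X} (k : N)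
    (f g : GenLoop N X x) (t : N → I) : GenLoop.transAt k f g t = glueHalves k f g t := by
  rw [GenLoop.transAt_apply, glueHalves]
  split_ifs <;> rfl

theorem glueHalves_halves {X : Type u} (k : N) (g : (N → I) → X) :
    glueHalves k (fun x => g (lowerHalf k x)) (fun x => g (upperHalf k x)) = g := by
  funext x
  unfold glueHalves
  split_ifs with h
  · exact congrArg g (lowerHalf_stretchLower h)
  · exact congrArg g (upperHalf_stretchUpper (not_le.1 h).le)

theorem lowerHalf_eq_base {X : Type u} {b : X} {g : (N → I) → X}
    (hb : ∀ x ∈ Cube.boundary (N), g x = b)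
    {k : N} (hk : ∀ x, (x k : ℝ) = 1 / 2 → g x = b)
    {x : N → I} (hx : x ∈ Cube.boundary (N)) :
    g (lowerHalf k x) = b := by
  obtain ⟨i, hi⟩ := hx
  by_cases hik : i = k
  · subst hik
    rcases hi with hi | hi
    · exact hb _ ⟨i, Or.inl (Subtype.ext (by rw [lowerHalf_apply_self, hi]; simp))⟩
    · exact hk _ (by rw [lowerHalf_apply_self, hi]; simp)
  · exact hb _ ⟨i, by rwa [lowerHalf_apply_of_ne hik]⟩

theorem upperHalf_eq_base {X : Type u} {b : X} {g : (N → I) → X}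
    (hb : ∀ x ∈ Cube.boundary (N), g x = b)
    {k : N} (hk : ∀ x, (x k : ℝ) = 1 / 2 → g x = b)
    {x : N → I} (hx : x ∈ Cube.boundary (N)) :
    g (upperHalf k x) = b := by
  obtain ⟨i, hi⟩ := hx
  by_cases hik : i = k
  · subst hik
    rcases hi with hi | hi
    · exact hk _ (by rw [upperHalf_apply_self, hi]; simp)
    · exact hb _ ⟨i, Or.inr (Subtype.ext (by rw [upperHalf_apply_self, hi]; norm_num))⟩
  · exact hb _ ⟨i, by rwa [upperHalf_apply_of_ne hik]⟩

end Bisection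

/-! ### Refining an infinite concatenation along bisections -/

section Refinement

universe u

variable {n : ℕ} {A : ℕ → Type u} [∀ j, TopologicalSpace (A j)] {a : ∀ j, A j}

theorem ControlledHomotopic.refl {c : Fin n → ℝ} (hc : ∀ i, 0 ≤ c i)
    {g : (Fin n → I) → ShrinkingWedge a} (hg : Continuous g)
    (hb : ∀ x ∈ Cube.boundary (Fin n), g x = ShrinkingWedge.base a) :
    ControlledHomotopic c g g g :=
  ⟨⟨fun p => g p.2, hg.comp continuous_snd⟩, fun _ => rfl, fun _ => rfl, fun _ => hb,
    fun _ x _ => ⟨x, fun i => by simpa using hc i, rfl⟩⟩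

/-- Controlled homotopies on the two halves of the cube form one on the whole cube, and the control
in the direction of the bisection improves by the factor two. -/
theorem ControlledHomotopic.glueHalves {c c' : Fin n → ℝ} {k : Fin n}
    {g F₀ F₁ G₀ G₁ : (Fin n → I) → ShrinkingWedge a} (hk : c k / 2 ≤ c' k)
    (hne : ∀ i, i ≠ k → c i ≤ c' i)
    (h₀ : ControlledHomotopic c (fun x => g (lowerHalf k x)) F₀ G₀)
    (h₁ : ControlledHomotopic c (fun x => g (upperHalf k x)) F₁ G₁) :
    ControlledHomotopic c' g (glueHalves k F₀ F₁) (glueHalves k G₀ G₁) := by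
  classical
  obtain ⟨H, H0, H1, Hb, Hc⟩ := h₀
  obtain ⟨K, K0, K1, Kb, Kc⟩ := h₁
  refine ⟨⟨fun p => if (p.2 k : ℝ) ≤ 1 / 2 then H (p.1, stretchLower k p.2)
    else K (p.1, stretchUpper k p.2), ?_⟩, fun x => ?_, fun x => ?_, fun t x hx => ?_,
    fun t x j => ?_⟩
  · refine Continuous.if_le (by fun_prop) (by fun_prop) (by fun_prop) continuous_const
      fun p hp => ?_
    rw [Hb _ _ ⟨k, Or.inr (Subtype.ext ?_)⟩, Kb _ _ ⟨k, Or.inl (Subtype.ext ?_)⟩]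
    · rw [stretchUpper_apply_self hp.ge, hp]
      norm_num
    · rw [stretchLower_apply_self hp.le, hp]
      norm_num
  · simp only [ContinuousMap.coe_mk, H0, K0, _root_.glueHalves]
  · simp only [ContinuousMap.coe_mk, H1, K1, _root_.glueHalves]
  · change ite _ _ _ = _
    split_ifs with h
    · exact Hb _ _ (stretchLower_mem_boundary hx h)
    · exact Kb _ _ (stretchUpper_mem_boundary hx (not_le.1 h).le)
  · change ∃ y : Fin n → I, _ ∧ ShrinkingWedge.retr a j (ite _ _ _) = _
    split_ifs with h
    · obtain ⟨y, hy, hyj⟩ := Hc t (stretchLower k x) j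
      refine ⟨lowerHalf k y, fun i => ?_, hyj⟩
      have := hy i
      by_cases hi : i = k
      · subst hi
        rw [stretchLower_apply_self h] at this
        rw [lowerHalf_apply_self]
        rw [abs_le] at this ⊢
        constructor <;> linarith
      · rw [stretchLower_apply_of_ne hi] at this
        rw [lowerHalf_apply_of_ne hi]
        exact this.trans (hne i hi)
    · have h' := (not_le.1 h).le
      obtain ⟨y, hy, hyj⟩ := Kc t (stretchUpper k x) j
      refine ⟨upperHalf k y, fun i => ?_, hyj⟩
      have := hy i
      by_cases hi : i = k
      · subst hi
        rw [stretchUpper_apply_self h'] at this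
        rw [upperHalf_apply_self]
        rw [abs_le] at this ⊢
        constructor <;> linarith
      · rw [stretchUpper_apply_of_ne hi] at this
        rw [upperHalf_apply_of_ne hi]
        exact this.trans (hne i hi)

theorem abs_unitInterval_sub_le_one (x y : I) : |(x : ℝ) - y| ≤ 1 := by
  rw [abs_le]
  constructor <;> linarith [x.2.1, x.2.2, y.2.1, y.2.2]

variable [NeZero n]

/-- The infinite concatenation of the coordinates of a map to the shrinking wedge. -/
noncomputable def coordConcat (g : (Fin n → I) → ShrinkingWedge a) (x : Fin n → I) :
    ShrinkingWedge a :=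
  WedgeSet.ofFamily a fun j => ShrinkingWedge.retr a j (g (slot 0 j x))

theorem retr_coordConcat {g : (Fin n → I) → ShrinkingWedge a}
    (hg : ∀ x ∈ Cube.boundary (Fin n), g x = ShrinkingWedge.base a) (j : ℕ) (x : Fin n → I) :
    ShrinkingWedge.retr a j (coordConcat g x) = ShrinkingWedge.retr a j (g (slot 0 j x)) := by
  have hne : ∀ i, ShrinkingWedge.retr a i (g (slot 0 i x)) ≠ a i →
      slot 0 i x ∉ Cube.boundary (Fin n) := fun i hi hb => hi (by
    rw [hg _ hb, ShrinkingWedge.retr_base])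
  exact WedgeSet.retr_ofFamily (fun i k hi hk => slot_disjoint (hne i hi) (hne k hk)) j

/-- A map to the shrinking wedge has a single coordinate if its values lie in one summand. -/
def IsSingle (g : (Fin n → I) → ShrinkingWedge a) : Prop :=
  ∃ j, ∀ x k, k ≠ j → ShrinkingWedge.retr a k (g x) = a k

/-- The homotopy stretches the slot of the only nontrivial coordinate over the whole cube. -/
theorem IsSingle.controlledHomotopic_coordConcat {g : (Fin n → I) → ShrinkingWedge a}
    (hs : IsSingle g) (hg : Continuous g)
    (hb : ∀ x ∈ Cube.boundary (Fin n), g x = ShrinkingWedge.base a) :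
    ControlledHomotopic (fun _ => 1) g (coordConcat g) g := by
  obtain ⟨j, hj⟩ := hs
  refine ⟨⟨fun p => g (slotHomotopy 0 j p), by fun_prop⟩, fun x => ?_, fun x => ?_,
    fun t x hx => hb _ (slotHomotopy_mem_boundary 0 j t hx),
    fun t x i => ⟨_, fun i => abs_unitInterval_sub_le_one _ _, rfl⟩⟩
  · change g (slotHomotopy 0 j (0, x)) = _
    rw [slotHomotopy_zero]
    refine ShrinkingWedge.ext_retr fun k => ?_
    rw [retr_coordConcat hb]
    by_cases hk : k = j
    · rw [hk]
    · rw [hj _ k hk, hj _ k hk]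
  · change g (slotHomotopy 0 j (1, x)) = _
    rw [slotHomotopy_one]

end Refinement

/-! ### Cyclic bisection -/

section BisectionCount

variable {n : ℕ}

/-- The number of the first `N` bisections of the cube that are in the direction of the `i`-th
coordinate axis. -/
def bisectionCount (N : ℕ) (i : Fin n) : ℕ := (N + (n - 1 - i)) / n

theorem bisectionCount_zero (i : Fin n) : bisectionCount 0 i = 0 := by
  have := i.2
  exact Nat.div_eq_of_lt (by omega)

variable [NeZero n]

/-- The number of bisections in the `i`-th direction grows exactly at those `N` for which `i` is the
residue of `N` modulo `n`. -/
theorem dvd_add_sub_iff (N : ℕ) (i : Fin n) : n ∣ N + (n - 1 - i) + 1 ↔ i = Fin.ofNat n N := by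
  have hn : 0 < n := NeZero.pos n
  have hi := i.2
  have hr := Nat.mod_lt N hn
  have hN := Nat.div_add_mod N n
  have h : N + (n - 1 - i) + 1 = n * (N / n) + (N % n + (n - i)) := by omega
  rw [h, Nat.dvd_add_right (dvd_mul_right _ _), Fin.ext_iff, Fin.val_ofNat]
  constructor
  · rintro ⟨q, hq⟩
    rcases q with _ | _ | q
    · omega
    · omega
    · have : n * 2 ≤ n * (q + 1 + 1) := Nat.mul_le_mul_left n (by omega)
      omega
  · intro h
    exact ⟨1, by omega⟩

theorem bisectionCount_succ_self (N : ℕ) :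
    bisectionCount (N + 1) (Fin.ofNat n N) = bisectionCount N (Fin.ofNat n N) + 1 := by
  unfold bisectionCount
  rw [Nat.add_right_comm, Nat.succ_div, if_pos ((dvd_add_sub_iff N _).2 rfl)]

theorem bisectionCount_succ_of_ne {N : ℕ} {i : Fin n} (h : i ≠ Fin.ofNat n N) :
    bisectionCount (N + 1) i = bisectionCount N i := by
  unfold bisectionCount
  rw [Nat.add_right_comm, Nat.succ_div, if_neg fun hd => h ((dvd_add_sub_iff N _).1 hd), add_zero]

/-- The `N`-th direction is one in which the boxes are longest after `N` bisections. -/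
theorem bisectionCount_le (N : ℕ) (i : Fin n) :
    bisectionCount N (Fin.ofNat n N) ≤ bisectionCount N i := by
  have hn : 0 < n := NeZero.pos n
  have hi := i.2
  have hr := Nat.mod_lt N hn
  have hN := Nat.div_add_mod N n
  unfold bisectionCount
  have h : N + (n - 1 - (Fin.ofNat n N : ℕ)) = n - 1 + n * (N / n) := by
    rw [Fin.val_ofNat]
    omega
  rw [h, Nat.add_mul_div_left _ _ hn, Nat.div_eq_of_lt (by omega), zero_add]
  exact Nat.div_le_div_right (Nat.le_add_right _ _)

theorem le_bisectionCount (q : ℕ) {N : ℕ} (h : n * q ≤ N) (i : Fin n) :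
    q ≤ bisectionCount N i := by
  unfold bisectionCount
  rw [Nat.le_div_iff_mul_le (NeZero.pos n), mul_comm]
  omega

end BisectionCount

/-! ### Boxes of a dyadic map -/

section Boxes

universe u

variable {n : ℕ} {A : ℕ → Type u} [∀ j, TopologicalSpace (A j)] {a : ∀ j, A j}

variable [NeZero n]

/-- The map `g` is the restriction of `f` to one of the boxes that arise from `N` bisections of
the cube, and it is trivial on the boundary of this box. -/
structure IsBoxOf (f : (Fin n → I) → ShrinkingWedge a) (N : ℕ)
    (g : (Fin n → I) → ShrinkingWedge a) : Prop where
  continuous : Continuous g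
  boundary : ∀ x ∈ Cube.boundary (Fin n), g x = ShrinkingWedge.base a
  box : ∃ p : Fin n → ℕ, ∀ x, ∃ y : Fin n → I,
    (∀ i, (y i : ℝ) = (p i + x i) / 2 ^ bisectionCount N i) ∧ g x = f y

/-- If a box of a dyadic map is not mapped into a single summand, then the map is trivial on the
hyperplane that bisects the box in its longest direction.  Otherwise some dyadic cube that is mapped
into a single summand has an interior point on this hyperplane.  Then it is at least as long as the
box in every direction, and so contains the whole box. -/
theorem IsBoxOf.eq_base {f g : (Fin n → I) → ShrinkingWedge a} (hf : IsDyadicMap f) {N : ℕ}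
    (hg : IsBoxOf f N g) (hs : ¬ IsSingle g) {x : Fin n → I}
    (hx : (x (Fin.ofNat n N) : ℝ) = 1 / 2) : g x = ShrinkingWedge.base a := by
  obtain ⟨p, hp⟩ := hg.box
  obtain ⟨y, hy, hgy⟩ := hp x
  refine ShrinkingWedge.eq_base_of_retr_eq fun j => ?_
  by_contra hj
  rw [hgy] at hj
  obtain ⟨m, hm, hcar⟩ := hf j y hj
  have hlevel : m ≤ bisectionCount N (Fin.ofNat n N) := by
    by_contra hlt
    push Not at hlt
    obtain ⟨d, rfl⟩ := Nat.exists_eq_add_of_lt hlt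
    refine hm (Fin.ofNat n N) ?_
    have : (2 : ℝ) ^ (bisectionCount N (Fin.ofNat n N) + d + 1) * y (Fin.ofNat n N) =
        ((2 ^ d * (2 * p (Fin.ofNat n N) + 1) : ℤ) : ℝ) := by
      rw [hy, hx]
      push_cast
      rw [pow_succ, pow_add]
      field_simp
    rw [this, Int.floor_intCast, Int.ceil_intCast]
  refine hs ⟨j, fun x' k hk => ?_⟩
  obtain ⟨y', hy', hgy'⟩ := hp x'
  rw [hgy']
  refine hcar y' (fun i => ?_) k hk
  obtain ⟨d, hd⟩ := Nat.exists_eq_add_of_le (hlevel.trans (bisectionCount_le N i))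
  have hscale : ∀ z : I, (2 : ℝ) ^ m * ((p i + z) / 2 ^ bisectionCount N i) =
      (p i + z) / 2 ^ d := by
    intro z
    rw [hd, pow_add]
    field_simp
  have hd0 : (0 : ℝ) < 2 ^ d := by positivity
  have hmi := hm i
  change ((⌊(2 : ℝ) ^ m * y i⌋ : ℤ) : ℝ) ≤ 2 ^ m * y' i ∧
    2 ^ m * (y' i : ℝ) ≤ (⌈(2 : ℝ) ^ m * y i⌉ : ℤ)
  rw [hy', hscale]
  rw [hy, hscale] at hmi ⊢
  set r : ℝ := (p i + x i) / 2 ^ d with hr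
  have hr' : r * 2 ^ d = p i + x i := by rw [hr]; field_simp
  have h1 : (⌊r⌋ : ℝ) < r := lt_of_le_of_ne (Int.floor_le r) fun h => hmi (by
    rw [← h, Int.floor_intCast, Int.ceil_intCast])
  have h2 : r < ⌈r⌉ := lt_of_le_of_ne (Int.le_ceil r) fun h => hmi (by
    rw [h, Int.floor_intCast, Int.ceil_intCast])
  constructor
  · have h3 : (⌊r⌋ : ℝ) * 2 ^ d < p i + 1 := by
      have := mul_lt_mul_of_pos_right h1 hd0
      linarith [(x i).2.2]
    have h4 : ⌊r⌋ * 2 ^ d ≤ (p i : ℤ) := Int.lt_add_one_iff.1 (by exact_mod_cast h3)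
    have h5 : (⌊r⌋ : ℝ) * 2 ^ d ≤ p i := by exact_mod_cast h4
    rw [le_div_iff₀ hd0]
    linarith [(x' i).2.1]
  · have h3 : (p i : ℝ) < ⌈r⌉ * 2 ^ d := by
      have := mul_lt_mul_of_pos_right h2 hd0
      linarith [(x i).2.1]
    have h4 : (p i : ℤ) + 1 ≤ ⌈r⌉ * 2 ^ d := Int.add_one_le_iff.2 (by exact_mod_cast h3)
    have h5 : (p i : ℝ) + 1 ≤ ⌈r⌉ * 2 ^ d := by exact_mod_cast h4
    rw [div_le_iff₀ hd0]
    linarith [(x' i).2.2]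

theorem IsBoxOf.lowerHalf {f g : (Fin n → I) → ShrinkingWedge a} (hf : IsDyadicMap f) {N : ℕ}
    (hg : IsBoxOf f N g) (hs : ¬ IsSingle g) :
    IsBoxOf f (N + 1) fun x => g (lowerHalf (Fin.ofNat n N) x) where
  continuous := hg.continuous.comp (ContinuousMap.continuous _)
  boundary x hx := lowerHalf_eq_base hg.boundary (fun _ h => hg.eq_base hf hs h) hx
  box := by
    obtain ⟨p, hp⟩ := hg.box
    refine ⟨Function.update p (Fin.ofNat n N) (2 * p (Fin.ofNat n N)), fun x => ?_⟩
    obtain ⟨y, hy, hgy⟩ := hp (_root_.lowerHalf (Fin.ofNat n N) x)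
    refine ⟨y, fun i => ?_, hgy⟩
    rw [hy]
    by_cases hi : i = Fin.ofNat n N
    · rw [hi, bisectionCount_succ_self, lowerHalf_apply_self, Function.update_self, pow_succ]
      push_cast
      field_simp
    · rw [bisectionCount_succ_of_ne hi, lowerHalf_apply_of_ne hi, Function.update_of_ne hi]

theorem IsBoxOf.upperHalf {f g : (Fin n → I) → ShrinkingWedge a} (hf : IsDyadicMap f) {N : ℕ}
    (hg : IsBoxOf f N g) (hs : ¬ IsSingle g) :
    IsBoxOf f (N + 1) fun x => g (upperHalf (Fin.ofNat n N) x) where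
  continuous := hg.continuous.comp (ContinuousMap.continuous _)
  boundary x hx := upperHalf_eq_base hg.boundary (fun _ h => hg.eq_base hf hs h) hx
  box := by
    obtain ⟨p, hp⟩ := hg.box
    refine ⟨Function.update p (Fin.ofNat n N) (2 * p (Fin.ofNat n N) + 1), fun x => ?_⟩
    obtain ⟨y, hy, hgy⟩ := hp (_root_.upperHalf (Fin.ofNat n N) x)
    refine ⟨y, fun i => ?_, hgy⟩
    rw [hy]
    by_cases hi : i = Fin.ofNat n N
    · rw [hi, bisectionCount_succ_self, upperHalf_apply_self, Function.update_self, pow_succ]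
      push_cast
      field_simp
      ring
    · rw [bisectionCount_succ_of_ne hi, upperHalf_apply_of_ne hi, Function.update_of_ne hi]

end Boxes

/-! ### Deforming the infinite concatenation to a dyadic loop -/

section RefinementHomotopy

universe u

variable {n : ℕ} {A : ℕ → Type u} [∀ j, TopologicalSpace (A j)] {a : ∀ j, A j}
  [n.AtLeastTwo] [∀ j, T1Space (A j)]

/-- The infinite concatenation of the coordinates of `g` is homotopic to the map that performs the
infinite concatenation on both halves of the cube, provided that `g` is trivial on the hyperplane
between the halves.  As the interchange homotopy is performed in the shrinking wedge of the images
of the coordinates of `g`, it takes no other values. -/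
theorem controlledHomotopic_coordConcat_glueHalves {g : (Fin n → I) → ShrinkingWedge a}
    (hg : Continuous g) (hb : ∀ x ∈ Cube.boundary (Fin n), g x = ShrinkingWedge.base a)
    (k : Fin n) (hk : ∀ x, (x k : ℝ) = 1 / 2 → g x = ShrinkingWedge.base a) :
    ControlledHomotopic (fun _ => 1) g (coordConcat g)
      (glueHalves k (coordConcat fun x => g (lowerHalf k x))
        (coordConcat fun x => g (upperHalf k x))) := by
  have hlow : ∀ x ∈ Cube.boundary (Fin n), g (lowerHalf k x) = ShrinkingWedge.base a :=
    fun x hx => lowerHalf_eq_base hb hk hx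
  have hupp : ∀ x ∈ Cube.boundary (Fin n), g (upperHalf k x) = ShrinkingWedge.base a :=
    fun x hx => upperHalf_eq_base hb hk hx
  have hbase : ∀ j, ShrinkingWedge.retr a j (g 0) = a j := fun j => by
    rw [hb 0 ⟨k, Or.inl rfl⟩, ShrinkingWedge.retr_base]
  let B : ℕ → Type u := fun j => Set.range fun x => ShrinkingWedge.retr a j (g x)
  let b : ∀ j, B j := fun j => ⟨a j, 0, hbase j⟩
  have hloop : ∀ φ : C(Fin n → I, Fin n → I),
      (∀ x ∈ Cube.boundary (Fin n), g (φ x) = ShrinkingWedge.base a) →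
      ∀ j, ∃ p : GenLoop (Fin n) (B j) (b j), ∀ x,
        (p x).1 = ShrinkingWedge.retr a j (g (φ x)) := by
    intro φ hφ j
    refine ⟨⟨⟨fun x => ⟨ShrinkingWedge.retr a j (g (φ x)), φ x, rfl⟩,
      Continuous.subtype_mk (by fun_prop) _⟩, fun x hx => Subtype.ext ?_⟩, fun x => rfl⟩
    change ShrinkingWedge.retr a j (g (φ x)) = a j
    rw [hφ x hx, ShrinkingWedge.retr_base]
  choose p hp using hloop (lowerHalf k) hlow
  choose q hq using hloop (upperHalf k) hupp
  obtain ⟨H, H0, H1, Hb⟩ := (GenLoop.homotopic_concat_transAt 0 k p q).exists_map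
  have hd : ∀ z i j, (ShrinkingWedge.retr b i (H z)).1 ≠ a i →
      (ShrinkingWedge.retr b j (H z)).1 ≠ a j → i = j := fun z i j hi hj =>
    ShrinkingWedge.eq_of_retr_ne (a := b) (fun h => hi (congrArg Subtype.val h))
      fun h => hj (congrArg Subtype.val h)
  have hc : ∀ j, Continuous fun z => ((ShrinkingWedge.retr b j (H z)).1 : A j) := fun j =>
    continuous_subtype_val.comp ((ShrinkingWedge.retr b j).continuous.comp H.continuous)
  let K : C(I × (Fin n → I), ShrinkingWedge a) :=
    ShrinkingWedge.ofFamily (fun j => ⟨_, hc j⟩) hd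
  have hK : ∀ z j, ShrinkingWedge.retr a j (K z) = (ShrinkingWedge.retr b j (H z)).1 :=
    fun z j => ShrinkingWedge.retr_ofFamily _ hd j z
  refine ⟨K, fun x => ?_, fun x => ?_, fun t x hx => ?_, fun t x j => ?_⟩
  · refine ShrinkingWedge.ext_retr fun j => ?_
    rw [hK, H0, GenLoop.retr_concat, retr_coordConcat hb, GenLoop.transAt_eq_glueHalves,
      ← congrFun (glueHalves_halves k g) (slot 0 j x)]
    unfold glueHalves
    split_ifs
    · exact hp _ _
    · exact hq _ _
  · refine ShrinkingWedge.ext_retr fun j => ?_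
    rw [hK, H1, GenLoop.transAt_eq_glueHalves]
    unfold glueHalves
    split_ifs
    · rw [GenLoop.retr_concat, retr_coordConcat hlow]
      exact hp _ _
    · rw [GenLoop.retr_concat, retr_coordConcat hupp]
      exact hq _ _
  · refine ShrinkingWedge.eq_base_of_retr_eq fun j => ?_
    rw [hK, Hb t x hx, ShrinkingWedge.retr_base]
  · obtain ⟨y, hy⟩ := (ShrinkingWedge.retr b j (H (t, x))).2
    exact ⟨y, fun i => abs_unitInterval_sub_le_one _ _, (hK _ _).trans hy.symm⟩

/-- The `m`-th refinement of the infinite concatenation of the coordinates of `g`: the cube is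
bisected `m` times, in the direction of the coordinate axes in cyclic order, from the `N`-th
direction on, except that boxes on which `g` has a single coordinate are left as they are.  On the
resulting boxes, the infinite concatenation is performed. -/
noncomputable def refinedConcat :
    ℕ → ℕ → ((Fin n → I) → ShrinkingWedge a) → (Fin n → I) → ShrinkingWedge a
  | 0, _, g => coordConcat g
  | m + 1, N, g => open Classical in if IsSingle g then g else
      glueHalves (Fin.ofNat n N) (refinedConcat m (N + 1) fun x => g (lowerHalf (Fin.ofNat n N) x))
        (refinedConcat m (N + 1) fun x => g (upperHalf (Fin.ofNat n N) x))

/-- Consecutive refinements are homotopic within the boxes of the coarser one. -/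
theorem IsBoxOf.controlledHomotopic_refinedConcat {f : (Fin n → I) → ShrinkingWedge a}
    (hf : IsDyadicMap f) (m : ℕ) : ∀ {N : ℕ} {g : (Fin n → I) → ShrinkingWedge a},
    IsBoxOf f N g → ControlledHomotopic
      (fun i => 2 ^ bisectionCount N i / 2 ^ bisectionCount (N + m) i) g
      (refinedConcat m N g) (refinedConcat (m + 1) N g) := by
  induction m with
  | zero =>
    intro N g hg
    have h1 : (fun i : Fin n => (2 : ℝ) ^ bisectionCount N i / 2 ^ bisectionCount (N + 0) i) =
        fun _ => 1 := funext fun i => div_self (by positivity)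
    rw [h1, refinedConcat, refinedConcat]
    split_ifs with hs
    · exact hs.controlledHomotopic_coordConcat hg.continuous hg.boundary
    · exact controlledHomotopic_coordConcat_glueHalves hg.continuous hg.boundary _
        fun _ h => hg.eq_base hf hs h
  | succ m ih =>
    intro N g hg
    rw [refinedConcat, refinedConcat]
    split_ifs with hs
    · exact ControlledHomotopic.refl (fun i => by positivity) hg.continuous hg.boundary
    · refine ControlledHomotopic.glueHalves ?_ (fun i hi => ?_) (ih (hg.lowerHalf hf hs))
        (ih (hg.upperHalf hf hs))
      · rw [bisectionCount_succ_self, pow_succ, Nat.add_right_comm, Nat.add_assoc]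
        exact le_of_eq (by ring)
      · rw [bisectionCount_succ_of_ne hi, Nat.add_right_comm, Nat.add_assoc]

/-- A dyadic loop is homotopic to the infinite concatenation of its coordinates. -/
theorem GenLoop.homotopic_concat_retr
    {f : GenLoop (Fin n) (ShrinkingWedge a) (ShrinkingWedge.base a)} (hf : IsDyadicMap f) :
    GenLoop.Homotopic (GenLoop.concat 0 fun j =>
      GenLoop.postcomp (ShrinkingWedge.retr a j) (ShrinkingWedge.retr_base j) f) f := by
  have hbox : IsBoxOf (f : (Fin n → I) → ShrinkingWedge a) 0 f :=
    ⟨f.1.continuous, f.2, fun _ => 0, fun x => ⟨x, fun i => by simp [bisectionCount_zero], rfl⟩⟩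
  refine GenLoop.homotopic_of_controlledHomotopic (fun δ hδ => ?_) ?_ fun m =>
    hbox.controlledHomotopic_refinedConcat hf m
  · obtain ⟨q, hq⟩ := exists_pow_lt_of_lt_one hδ (by norm_num : (1 / 2 : ℝ) < 1)
    refine ⟨n * q, fun m hm i => ?_⟩
    rw [bisectionCount_zero, pow_zero, ← one_div_pow]
    refine lt_of_le_of_lt (pow_le_pow_of_le_one (by norm_num) (by norm_num) ?_) hq
    rw [zero_add]
    exact le_bisectionCount q hm i
  · funext x
    refine ShrinkingWedge.ext_retr fun j => ?_
    rw [GenLoop.retr_concat]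
    exact retr_coordConcat f.2 j x

variable (a n) in
/-- Every loop is homotopic to a dyadic one, hence to the infinite concatenation of its
coordinates. -/
theorem HomotopyGroup.concatHom_canonicalHom
    (hA : ∀ j, SequentiallyConnectedAt (n - 1) (A j) (a j))
    (x : π_ n (ShrinkingWedge a) (ShrinkingWedge.base a)) :
    HomotopyGroup.concatHom a n (ShrinkingWedge.canonicalHom a n x) = x := by
  obtain ⟨f, rfl⟩ := HomotopyGroup.exists_ofLoop_eq x
  obtain ⟨g, hfg, hg⟩ := GenLoop.exists_homotopic_isDyadicMap (NeZero.one_le) hA f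
  rw [HomotopyGroup.ofLoop_eq_iff.2 hfg]
  have h : ShrinkingWedge.canonicalHom a n (HomotopyGroup.ofLoop g) = fun j =>
      HomotopyGroup.ofLoop (GenLoop.postcomp (ShrinkingWedge.retr a j)
        (ShrinkingWedge.retr_base j) g) :=
    funext fun j => ShrinkingWedge.canonicalHom_ofLoop a n g j
  rw [h, HomotopyGroup.concatHom_ofLoop]
  exact HomotopyGroup.ofLoop_eq_iff.2 (GenLoop.homotopic_concat_retr hg)

variable (n) in
theorem ShrinkingWedge.bijective_canonicalHom
    (hA : ∀ j, SequentiallyConnectedAt (n - 1) (A j) (a j)) :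
    Function.Bijective (ShrinkingWedge.canonicalHom a n) :=
  ⟨Function.LeftInverse.injective (HomotopyGroup.concatHom_canonicalHom n a hA),
    Function.RightInverse.surjective (ShrinkingWedge.canonicalHom_concatHom a n)⟩

end RefinementHomotopy

/-! ### The ordinary wedge -/

section WeakWedge

universe u

variable {A : ℕ → Type u} [∀ j, TopologicalSpace (A j)] {a : ∀ j, A j}

theorem WeakWedge.isOpen_iff {U : Set (WeakWedge a)} :
    IsOpen U ↔ ∀ j, IsOpen ((WedgeSet.incl a j : A j → WeakWedge a) ⁻¹' U) := by
  refine isOpen_coinduced.trans (isOpen_sum_iff.trans ?_)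
  rw [isOpen_sigma_iff]
  exact and_iff_right (isOpen_discrete _)

variable (a) in
/-- The identity map from the ordinary to the shrinking wedge. -/
def WeakWedge.toShrinking : C(WeakWedge a, ShrinkingWedge a) where
  toFun x := x
  continuous_toFun := continuous_def.2 fun _ hU => WeakWedge.isOpen_iff.2 hU.1

variable (a) in
/-- The canonical injection of the `j`-th summand into the ordinary wedge. -/
def WeakWedge.incl (j : ℕ) : C(A j, WeakWedge a) where
  toFun := WedgeSet.incl a j
  continuous_toFun := continuous_def.2 fun _ hU => WeakWedge.isOpen_iff.1 hU j

theorem WeakWedge.incl_basepoint (j : ℕ) : WeakWedge.incl a j (a j) = WeakWedge.base a :=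
  WedgeSet.incl_basepoint a j

theorem WeakWedge.retr_base (j : ℕ) : WeakWedge.retr a j (WeakWedge.base a) = a j := rfl

theorem WeakWedge.retr_incl_self (j : ℕ) (x : A j) :
    WeakWedge.retr a j (WeakWedge.incl a j x) = x := WedgeSet.retr_incl_self a j x

theorem WeakWedge.retr_incl_of_ne {i j : ℕ} (h : i ≠ j) (x : A i) :
    WeakWedge.retr a j (WeakWedge.incl a i x) = a j := WedgeSet.retr_incl_of_ne a h x

theorem WeakWedge.eq_base_or_incl (x : WeakWedge a) :
    x = WeakWedge.base a ∨ ∃ j y, x = WeakWedge.incl a j y := WedgeSet.eq_base_or_incl x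

variable (a) in
/-- The map from the shrinking to the ordinary wedge that is the identity on the first `m` summands
and collapses the other ones to the wedge point. -/
def ShrinkingWedge.truncate (m : ℕ) : C(ShrinkingWedge a, WeakWedge a) :=
  ShrinkingWedge.desc (y := WeakWedge.base a)
    (fun j => if j < m then WeakWedge.incl a j else ContinuousMap.const _ (WeakWedge.base a))
    (fun j => by
      split_ifs
      · exact WeakWedge.incl_basepoint j
      · rfl)
    (fun V hV => (Set.finite_lt_nat m).subset fun j hj => by
      by_contra hjm
      refine hj ?_
      rintro _ ⟨y, rfl⟩
      rw [if_neg (show ¬ j < m from hjm)]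
      exact mem_of_mem_nhds hV)

theorem ShrinkingWedge.truncate_base (m : ℕ) :
    ShrinkingWedge.truncate a m (ShrinkingWedge.base a) = WeakWedge.base a := rfl

theorem ShrinkingWedge.truncate_incl_of_lt {m j : ℕ} (h : j < m) (x : A j) :
    ShrinkingWedge.truncate a m (ShrinkingWedge.incl a j x) = WeakWedge.incl a j x := by
  refine (ShrinkingWedge.desc_incl _ _ _ j x).trans ?_
  rw [if_pos h]

theorem ShrinkingWedge.truncate_incl_of_le {m j : ℕ} (h : m ≤ j) (x : A j) :
    ShrinkingWedge.truncate a m (ShrinkingWedge.incl a j x) = WeakWedge.base a := by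
  refine (ShrinkingWedge.desc_incl _ _ _ j x).trans ?_
  rw [if_neg (not_lt.2 h)]
  rfl

theorem ShrinkingWedge.truncate_toShrinking {m : ℕ} {x : WeakWedge a}
    (h : ∀ j, m ≤ j → WeakWedge.retr a j x = a j) :
    ShrinkingWedge.truncate a m (WeakWedge.toShrinking a x) = x := by
  rcases WeakWedge.eq_base_or_incl x with rfl | ⟨i, y, rfl⟩
  · rfl
  · rcases lt_or_ge i m with hi | hi
    · exact ShrinkingWedge.truncate_incl_of_lt hi y
    · have hy := h i hi
      rw [WeakWedge.retr_incl_self] at hy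
      rw [hy, WeakWedge.incl_basepoint]
      rfl

theorem WeakWedge.retr_truncate_of_le {m j : ℕ} (h : m ≤ j) (x : ShrinkingWedge a) :
    WeakWedge.retr a j (ShrinkingWedge.truncate a m x) = a j := by
  rcases ShrinkingWedge.eq_base_or_incl x with rfl | ⟨i, y, rfl⟩
  · rfl
  · rcases lt_or_ge i m with hi | hi
    · rw [ShrinkingWedge.truncate_incl_of_lt hi, WeakWedge.retr_incl_of_ne (by omega)]
    · rw [ShrinkingWedge.truncate_incl_of_le hi, WeakWedge.retr_base]

theorem WeakWedge.retr_truncate_of_lt {m j : ℕ} (h : j < m) (x : ShrinkingWedge a) :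
    WeakWedge.retr a j (ShrinkingWedge.truncate a m x) = ShrinkingWedge.retr a j x := by
  rcases ShrinkingWedge.eq_base_or_incl x with rfl | ⟨i, y, rfl⟩
  · rfl
  · rcases lt_or_ge i m with hi | hi
    · rw [ShrinkingWedge.truncate_incl_of_lt hi]
      rfl
    · rw [ShrinkingWedge.truncate_incl_of_le hi, WeakWedge.retr_base,
        ShrinkingWedge.retr_incl_of_ne (by omega)]

/-- A compact subset of the ordinary wedge meets only finitely many summands outside of the wedge
point: points chosen in infinitely many summands would form an infinite closed discrete set. -/
theorem WeakWedge.exists_retr_eq_of_isCompact [∀ j, T1Space (A j)] {K : Set (WeakWedge a)}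
    (hK : IsCompact K) : ∃ m, ∀ x ∈ K, ∀ j, m ≤ j → WeakWedge.retr a j x = a j := by
  classical
  have hy : ∀ j, ∃ y : A j, (∃ x ∈ K, WeakWedge.retr a j x ≠ a j) →
      y ≠ a j ∧ ∃ x ∈ K, WeakWedge.retr a j x = y := by
    intro j
    by_cases h : ∃ x ∈ K, WeakWedge.retr a j x ≠ a j
    · obtain ⟨x, hx, hne⟩ := h
      exact ⟨_, fun _ => ⟨hne, x, hx, rfl⟩⟩
    · exact ⟨a j, fun h' => absurd h' h⟩
  choose y hy using hy
  let V : ℕ → Set (WeakWedge a) := fun m =>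
    {z | ∀ j, m ≤ j → y j ≠ a j → WeakWedge.retr a j z ≠ y j}
  have hVo : ∀ m, IsOpen (V m) := by
    intro m
    refine WeakWedge.isOpen_iff.2 fun i => ?_
    by_cases hi : m ≤ i ∧ y i ≠ a i
    · convert isOpen_compl_singleton (x := y i) using 1
      ext z
      constructor
      · intro hz
        have : WeakWedge.retr a i (WeakWedge.incl a i z) ≠ y i := hz i hi.1 hi.2
        rwa [WeakWedge.retr_incl_self] at this
      · intro hz j hj hne
        change WeakWedge.retr a j (WeakWedge.incl a i z) ≠ y j
        by_cases hij : i = j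
        · subst hij
          rwa [WeakWedge.retr_incl_self]
        · rw [WeakWedge.retr_incl_of_ne hij]
          exact hne.symm
    · convert isOpen_univ using 1
      refine Set.eq_univ_of_forall fun z j hj hne => ?_
      have hij : i ≠ j := by
        rintro rfl
        exact hi ⟨hj, hne⟩
      change WeakWedge.retr a j (WeakWedge.incl a i z) ≠ y j
      rw [WeakWedge.retr_incl_of_ne hij]
      exact hne.symm
  have hmono : Monotone V := fun k m hkm z hz j hj => hz j (hkm.trans hj)
  have hcov : K ⊆ ⋃ m, V m := by
    intro z _
    rcases WeakWedge.eq_base_or_incl z with rfl | ⟨i, w, rfl⟩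
    · exact Set.mem_iUnion.2 ⟨0, fun j _ hne => hne.symm⟩
    · refine Set.mem_iUnion.2 ⟨i + 1, fun j hj hne => ?_⟩
      rw [WeakWedge.retr_incl_of_ne (by omega)]
      exact hne.symm
  obtain ⟨m, hm⟩ := hK.elim_directed_cover V hVo hcov hmono.directed_le
  refine ⟨m, fun x hx j hj => ?_⟩
  by_contra hne
  obtain ⟨h1, z, hz, hzy⟩ := hy j ⟨x, hx, hne⟩
  exact hm hz j hj h1 hzy

theorem HomotopyGroup.inducedHom_comp {X Y Z : Type u} [TopologicalSpace X] [TopologicalSpace Y]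
    [TopologicalSpace Z] {x : X} {y : Y} {z : Z} (n : ℕ) [NeZero n] (φ : C(X, Y)) (hφ : φ x = y)
    (ψ : C(Y, Z)) (hψ : ψ y = z) (χ : C(X, Z)) (hχ : χ x = z) (h : ∀ w, ψ (φ w) = χ w)
    (p : π_ n X x) : HomotopyGroup.inducedHom n ψ hψ (HomotopyGroup.inducedHom n φ hφ p) =
      HomotopyGroup.inducedHom n χ hχ p := by
  obtain ⟨f, rfl⟩ := HomotopyGroup.exists_ofLoop_eq p
  rw [HomotopyGroup.inducedHom_ofLoop, HomotopyGroup.inducedHom_ofLoop,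
    HomotopyGroup.inducedHom_ofLoop]
  exact congrArg _ (GenLoop.ext _ _ fun w => h (f w))

theorem HomotopyGroup.ofLoop_eq_one {X : Type u} [TopologicalSpace X] {x : X} (n : ℕ) [NeZero n]
    {f : GenLoop (Fin n) X x} (hf : ∀ y, f y = x) : HomotopyGroup.ofLoop f = 1 :=
  (congrArg HomotopyGroup.ofLoop (GenLoop.ext f GenLoop.const hf)).trans
    HomotopyGroup.one_def.symm

variable (n : ℕ)

section

variable [NeZero n]

theorem WeakWedge.canonicalHom_apply (x : π_ n (WeakWedge a) (WeakWedge.base a)) :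
    WeakWedge.canonicalHom a n x = ShrinkingWedge.canonicalHom a n
      (HomotopyGroup.inducedHom n (WeakWedge.toShrinking a) rfl x) :=
  funext fun j => (HomotopyGroup.inducedHom_comp n (WeakWedge.toShrinking a) rfl
    (ShrinkingWedge.retr a j) _ (WeakWedge.retr a j) _ (fun _ => rfl) x).symm

theorem WeakWedge.canonicalHom_truncate_of_lt {m j : ℕ} (h : j < m)
    (x : π_ n (ShrinkingWedge a) (ShrinkingWedge.base a)) :
    WeakWedge.canonicalHom a n (HomotopyGroup.inducedHom n (ShrinkingWedge.truncate a m)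
      (ShrinkingWedge.truncate_base m) x) j = ShrinkingWedge.canonicalHom a n x j :=
  HomotopyGroup.inducedHom_comp n _ _ (WeakWedge.retr a j) _ (ShrinkingWedge.retr a j) _
    (WeakWedge.retr_truncate_of_lt h) x

theorem WeakWedge.canonicalHom_truncate_of_le {m j : ℕ} (h : m ≤ j)
    (x : π_ n (ShrinkingWedge a) (ShrinkingWedge.base a)) :
    WeakWedge.canonicalHom a n (HomotopyGroup.inducedHom n (ShrinkingWedge.truncate a m)
      (ShrinkingWedge.truncate_base m) x) j = 1 := by
  obtain ⟨f, rfl⟩ := HomotopyGroup.exists_ofLoop_eq x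
  exact HomotopyGroup.ofLoop_eq_one n fun y => WeakWedge.retr_truncate_of_le h (f y)

/-- A loop in the ordinary wedge is compact, hence is not changed by collapsing almost all
summands. -/
theorem WeakWedge.exists_inducedHom_truncate_eq [∀ j, T1Space (A j)]
    (x : π_ n (WeakWedge a) (WeakWedge.base a)) :
    ∃ m, HomotopyGroup.inducedHom n (ShrinkingWedge.truncate a m) (ShrinkingWedge.truncate_base m)
      (HomotopyGroup.inducedHom n (WeakWedge.toShrinking a) rfl x) = x := by
  obtain ⟨f, rfl⟩ := HomotopyGroup.exists_ofLoop_eq x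
  obtain ⟨m, hm⟩ := WeakWedge.exists_retr_eq_of_isCompact (isCompact_range f.1.continuous)
  exact ⟨m, congrArg HomotopyGroup.ofLoop (GenLoop.ext _ _ fun y =>
    ShrinkingWedge.truncate_toShrinking (hm _ ⟨y, rfl⟩))⟩

end

variable [n.AtLeastTwo] [∀ j, T1Space (A j)]

theorem WeakWedge.injective_canonicalHom (hA : ∀ j, SequentiallyConnectedAt (n - 1) (A j) (a j)) :
    Function.Injective (WeakWedge.canonicalHom a n) := by
  refine (injective_iff_map_eq_one _).2 fun x hx => ?_
  rw [WeakWedge.canonicalHom_apply] at hx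
  have h1 := (injective_iff_map_eq_one _).1 (ShrinkingWedge.bijective_canonicalHom n hA).1 _ hx
  obtain ⟨m, hm⟩ := WeakWedge.exists_inducedHom_truncate_eq n x
  rw [← hm, h1, map_one]

theorem WeakWedge.exists_canonicalHom_eq_iff (z : ∀ j, π_ n (A j) (a j)) :
    (∃ x, WeakWedge.canonicalHom a n x = z) ↔ ∃ m, ∀ j, m ≤ j → z j = 1 := by
  constructor
  · rintro ⟨x, rfl⟩
    obtain ⟨m, hm⟩ := WeakWedge.exists_inducedHom_truncate_eq n x
    refine ⟨m, fun j hj => ?_⟩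
    rw [← hm]
    exact WeakWedge.canonicalHom_truncate_of_le n hj _
  · rintro ⟨m, hm⟩
    refine ⟨HomotopyGroup.inducedHom n (ShrinkingWedge.truncate a m)
      (ShrinkingWedge.truncate_base m) (HomotopyGroup.concatHom a n z), funext fun j => ?_⟩
    rcases lt_or_ge j m with h | h
    · rw [WeakWedge.canonicalHom_truncate_of_lt n h, ShrinkingWedge.canonicalHom_concatHom]
    · rw [WeakWedge.canonicalHom_truncate_of_le n h, hm j h]

end WeakWedge

/-- A homomorphism to a product of commutative groups that is injective and whose image consists of
the families of finite support induces an isomorphism with the direct sum. -/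
theorem exists_addEquiv_directSum {G : Type*} [Group G] {B : ℕ → Type*} [∀ j, CommGroup (B j)]
    (φ : G →* ∀ j, B j) (hφ : Function.Injective φ)
    (hr : ∀ z, (∃ x, φ x = z) ↔ ∃ m, ∀ j, m ≤ j → z j = 1) :
    ∃ e : Additive G ≃+ ⨁ j, Additive (B j),
      ∀ (x : G) (j : ℕ), e (Additive.ofMul x) j = Additive.ofMul (φ x j) := by
  classical
  have hfin : ∀ x, ∃ z : ⨁ j, Additive (B j), ∀ j, z j = Additive.ofMul (φ x j) := by
    intro x
    obtain ⟨m, hm⟩ := (hr _).1 ⟨x, rfl⟩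
    refine ⟨DFinsupp.mk (Finset.range m) fun j => Additive.ofMul (φ x j), fun j => ?_⟩
    refine (DFinsupp.mk_apply).trans ?_
    split_ifs with h
    · rfl
    · rw [hm j (by simpa using h)]
      rfl
  choose ψ hψ using hfin
  let Ψ : Additive G →+ ⨁ j, Additive (B j) := AddMonoidHom.mk' (fun x => ψ x.toMul) fun x y => by
    refine DFinsupp.ext fun j => ?_
    refine (hψ _ j).trans ?_
    rw [DFinsupp.add_apply, hψ, hψ, toMul_add, map_mul]
    rfl
  have hΨ : ∀ x j, Ψ (Additive.ofMul x) j = Additive.ofMul (φ x j) := fun x j => hψ x j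
  refine ⟨AddEquiv.ofBijective Ψ ⟨fun x y hxy => ?_, fun z => ?_⟩, hΨ⟩
  · refine Additive.toMul.injective (hφ (funext fun j => Additive.ofMul.injective ?_))
    rw [← hΨ, ← hΨ]
    exact congrArg (fun w : ⨁ j, Additive (B j) => w j) hxy
  · obtain ⟨x, hx⟩ := (hr fun j => (z j).toMul).2 (by
      obtain ⟨m, hm⟩ := z.support.bddAbove
      refine ⟨m + 1, fun j hj => ?_⟩
      by_contra hne
      have := hm (DFinsupp.mem_support_iff.2 (show z j ≠ 0 from hne))
      omega)
    refine ⟨Additive.ofMul x, DFinsupp.ext fun j => (hΨ x j).trans ?_⟩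
    rw [hx]
    rfl

/-! ### The homotopy groups of shrinking and ordinary wedges -/

theorem mainTheorem7 (n : ℕ) [n.AtLeastTwo] (A : ℕ → Type*)
    [∀ j, TopologicalSpace (A j)] [∀ j, T2Space (A j)] (a : ∀ j, A j) :
    (∃ s : (∀ j, π_ n (A j) (a j)) →* π_ n (ShrinkingWedge a) (ShrinkingWedge.base a),
      (ShrinkingWedge.canonicalHom a n).comp s = MonoidHom.id (∀ j, π_ n (A j) (a j))) ∧
    ((∀ j, SequentiallyConnectedAt (n - 1) (A j) (a j)) →
      Function.Bijective (ShrinkingWedge.canonicalHom a n) ∧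
      ∃ e : Additive (π_ n (WeakWedge a) (WeakWedge.base a)) ≃+
          ⨁ j, Additive (π_ n (A j) (a j)),
        ∀ (x : π_ n (WeakWedge a) (WeakWedge.base a)) (j : ℕ),
          e (Additive.ofMul x) j = Additive.ofMul (WeakWedge.canonicalHom a n x j)) := by
  refine ⟨⟨HomotopyGroup.concatHom a n, MonoidHom.ext (ShrinkingWedge.canonicalHom_concatHom a n)⟩,
    fun hA => ⟨ShrinkingWedge.bijective_canonicalHom n hA, ?_⟩⟩
  exact exists_addEquiv_directSum (WeakWedge.canonicalHom a n)
    (WeakWedge.injective_canonicalHom n hA) (WeakWedge.exists_canonicalHom_eq_iff n)
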